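/- Let $N \ge 0$ and let $U_1,\dots,U_N \subset \mathbb{R}^3$ be bounded domains (nonempty connected open sets) with $C^\infty$ boundary, lying locally on one side of their boundary, with pairwise disjoint closures, and such that $U := \mathbb{R}^3\setminus\bigcup_{i=1}^N \overline{U_i}$ is connected. Let $\mathfrak n$ denote the unit normal on $\partial U_i$ pointing out of $U_i$, and let $dS$ be the surface measure. For a field $w\in L^2(U)=L^2(U;\mathbb{R}^3)$ with $\operatorname{div} w=0$ in the sense of distributions and for $g \in L^1(\partial U)$, the condition $w\cdot\mathfrak n=g$ on $\partial U$ is understood in the weak sense $$\int_U w\cdot\nabla\varphi\,dx=-\sum_{i=1}^N\int_{\partial U_i} g\,\varphi\,dS\qquad\text{for all }\varphi\in C_c^\infty(\mathbb{R}^3),$$ and likewise for Neumann conditions $\partial q/\partial\mathfrak n=g$ with $w=\nabla q$. Put $$L^2_\sigma(U)=\{w\in L^2(U):\operatorname{div}w=0,\ w\cdot\mathfrak n=0\text{ on }\partial U\},$$ $$L^2_{\mathrm{dil}}(U)=\{w\in L^2(U):\operatorname{div}w=0,\ \exists\, s_i\in\mathbb{R},\,v_i\in\mathbb{R}^3\ \text{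 with }\ w\cdot\mathfrak n=s_i+v_i\cdot\mathfrak n\text{ on }\partial U_i\ \text{ for all } 1\le i\le N\},$$ $$\mathbb{G}(U)=\{w\in L^2_{\mathrm{dil}}(U):\langle w,u\rangle_{L^2(U)}=0\ \ \forall u\in L^2_\sigma(U)\}.$$ Then: 1. $L^2_{\mathrm{dil}}(U)=L^2_\sigma(U)\oplus\mathbb{G}(U)$, and the sum is orthogonal. 2. $\mathbb{G}(U)$ is exactly the set of all $w\in L^2(U)$ of the form $w=\nabla q$ with $q$ harmonic in $U$ and $\partial q/\partial\mathfrak n=s_i+v_i\cdot\mathfrak n$ on $\partial U_i$, $1\le i\le N$, for some $s_i\in\mathbb{R}$, $v_i\in\mathbb{R}^3$. 3. For all $1\le i\le N$ and $1\le k\le 3$ there are functions $q_i$, $q_i^k$, harmonic in $U$ and with gradients in $L^2(U)$, such that $\partial q_i/\partial\mathfrak n=\delta_{ij}$ and $\partial q_i^k/\partial\mathfrak n=\delta_{ij}\mathfrak n^k$ on $\partial U_j$ for all $j$, and the $4N$ fields $\nabla q_i$, $\nabla q_i^k$ form a basis of $\mathbb{G}(U)$. 4. $\mathbb{G}(U)$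 is finite dimensional, of dimension exactly $4N$. 5. $L^2_{\mathrm{dil}}(U)$ is closed in $L^2(U)$. -/

import Mathlib

open MeasureTheory Set Filter Topology
open scoped ContDiff Gradient InnerProductSpace

namespace ExteriorFlow

/-- Three-dimensional Euclidean space. -/
abbrev E3 : Type := EuclideanSpace ℝ (Fin 3)

/-- `ρ` is a smooth local defining function of `Ω` at the boundary point `x`: it is smooth on an
open neighbourhood `V` of `x` in which `Ω = {ρ < 0}`, and `∇ρ(x) ≠ 0`. -/
def IsLocalDefiningFunction (Ω : Set E3) (x : E3) (ρ : E3 → ℝ) : Prop :=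
  ∃ V : Set E3, IsOpen V ∧ x ∈ V ∧ ContDiffOn ℝ ∞ ρ V ∧ (∀ y ∈ V, y ∈ Ω ↔ ρ y < 0) ∧ ∇ ρ x ≠ 0

/-- Bounded domain (nonempty connected open set) of `ℝ³` with smooth boundary, lying locally on
one side of its boundary. -/
structure IsSmoothBoundedDomain (Ω : Set E3) : Prop where
  isOpen : IsOpen Ω
  isConnected : IsConnected Ω
  isBounded : Bornology.IsBounded Ω
  smooth_boundary : ∀ x ∈ frontier Ω, ∃ ρ : E3 → ℝ, IsLocalDefiningFunction Ω x ρ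

open Classical in
/-- The unit normal to `∂Ω` at a boundary point `x` that points out of `Ω`, namely
`∇ρ(x) / |∇ρ(x)|` for a local defining function `ρ` at `x`. It does not depend on the choice of
`ρ`, see `outwardNormal_eq`. (The value is `0` where there is no local defining function.) -/
noncomputable def outwardNormal (Ω : Set E3) (x : E3) : E3 :=
  if h : ∃ ρ : E3 → ℝ, IsLocalDefiningFunction Ω x ρ then ‖∇ h.choose x‖⁻¹ • ∇ h.choose x else 0

/-- The set `ℝ³ \ ⋃ i, closure (Ω i)`. -/
def exterior {N : ℕ} (Ω : Fin N → Set E3) : Set E3 := (⋃ i, closure (Ω i))ᶜ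

/-- The Hilbert space `L²(U)` of square-integrable vector fields on `U`. -/
abbrev VecL2 (U : Set E3) : Type := Lp E3 2 (volume.restrict U)

/-- `div w = 0` in `U` in the sense of distributions. -/
def IsDivFree {U : Set E3} (w : VecL2 U) : Prop :=
  ∀ φ : E3 → ℝ, ContDiff ℝ ∞ φ → HasCompactSupport φ → tsupport φ ⊆ U →
    ∫ x in U, ⟪w x, ∇ φ x⟫_ℝ = 0

/-- For a divergence-free `w ∈ L²(U)`, `U = exterior Ω`: the (weak) normal trace of `w` satisfies
`w · n = g i` on `∂(Ω i)` for all `i`, where `n` is the unit normal that points out of `Ω i`, that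
is, into `U`. Hence the minus sign in Green's formula
`∫_U w · ∇φ = - ∑ i, ∫_{∂(Ω i)} g i φ dS`, required for all `φ ∈ C_c^∞(ℝ³)`.
The surface measure `dS` is the two-dimensional Hausdorff measure, normalized so as to
agree with Lebesgue measure on planes. -/
def HasNormalTrace {N : ℕ} (Ω : Fin N → Set E3) (w : VecL2 (exterior Ω))
    (g : Fin N → E3 → ℝ) : Prop :=
  (∀ i, IntegrableOn (g i) (frontier (Ω i)) μHE[2]) ∧
  ∀ φ : E3 → ℝ, ContDiff ℝ ∞ φ → HasCompactSupport φ →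
    ∫ x in exterior Ω, ⟪w x, ∇ φ x⟫_ℝ = -∑ i, ∫ x in frontier (Ω i), g i x * φ x ∂μHE[2]

/-- The normal velocity `s i + v i · n` on `∂(Ω i)`: dilation at speed `s i`, translation at
velocity `v i`. -/
noncomputable def dilData {N : ℕ} (Ω : Fin N → Set E3) (s : Fin N → ℝ) (v : Fin N → E3) :
    Fin N → E3 → ℝ :=
  fun i x => s i + ⟪v i, outwardNormal (Ω i) x⟫_ℝ

/-! ### Well-definedness of the normal, and linearity of the conditions above -/

theorem line_sign {ρ : E3 → ℝ} {x d : E3} (hd : DifferentiableAt ℝ ρ x) (h0 : ρ x = 0)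
    (hpos : 0 < ⟪∇ ρ x, d⟫_ℝ) : ∀ᶠ t : ℝ in 𝓝[>] 0, 0 < ρ (x + t • d) := by
  have h1 : HasLineDerivAt ℝ ρ ⟪∇ ρ x, d⟫_ℝ x d := by
    have := (hd.hasGradientAt.hasFDerivAt).hasLineDerivAt d
    simpa using this
  have h2 : HasDerivAt (fun t : ℝ => ρ (x + t • d)) ⟪∇ ρ x, d⟫_ℝ 0 := h1
  have h3 := h2.tendsto_slope_zero_right
  filter_upwards [h3.eventually (lt_mem_nhds hpos), self_mem_nhdsWithin] with t ht ht0
  have ht0' : (0 : ℝ) < t := ht0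
  simp only [zero_add, zero_smul, add_zero, h0, sub_zero, smul_eq_mul] at ht
  exact (pos_iff_pos_of_mul_pos ht).1 (inv_pos.2 ht0')

theorem IsLocalDefiningFunction.basic {Ω : Set E3} {x : E3} {ρ : E3 → ℝ} (hx : x ∈ frontier Ω)
    (hΩ : IsOpen Ω) (h : IsLocalDefiningFunction Ω x ρ) :
    DifferentiableAt ℝ ρ x ∧ ρ x = 0 ∧ (∀ᶠ y in 𝓝 x, y ∈ Ω ↔ ρ y < 0) := by
  obtain ⟨V, hV, hxV, hρ, hiff, -⟩ := h
  have hVx : V ∈ 𝓝 x := hV.mem_nhds hxV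
  have hdiff : DifferentiableAt ℝ ρ x := (hρ.contDiffAt hVx).differentiableAt (by simp)
  refine ⟨hdiff, ?_, Filter.mem_of_superset hVx hiff⟩
  have hnot : x ∉ Ω := by
    rw [hΩ.frontier_eq] at hx
    exact hx.2
  refine le_antisymm ?_ (not_lt.1 fun hlt => hnot ((hiff x hxV).2 hlt))
  by_contra hpos
  have hpos' : 0 < ρ x := not_le.1 hpos
  have hev : ∀ᶠ y in 𝓝 x, y ∉ Ω := by
    filter_upwards [hVx, hdiff.continuousAt.eventually (lt_mem_nhds hpos')] with y hy hy'
    exact fun hyΩ => absurd ((hiff y hy).1 hyΩ) (not_lt.2 hy'.le)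
  exact (mem_closure_iff_frequently.1 (frontier_subset_closure hx)) hev

/-- The normal does not depend on the local defining function. -/
theorem outwardNormal_eq {Ω : Set E3} {x : E3} {ρ : E3 → ℝ} (hΩ : IsOpen Ω)
    (hx : x ∈ frontier Ω) (h : IsLocalDefiningFunction Ω x ρ) :
    outwardNormal Ω x = ‖∇ ρ x‖⁻¹ • ∇ ρ x := by
  have hex : ∃ ρ : E3 → ℝ, IsLocalDefiningFunction Ω x ρ := ⟨ρ, h⟩
  have key : ∀ σ : E3 → ℝ, IsLocalDefiningFunction Ω x σ →
      ‖∇ σ x‖⁻¹ • ∇ σ x = ‖∇ ρ x‖⁻¹ • ∇ ρ x := by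
    intro σ hσ
    obtain ⟨hd1, h01, hi1⟩ := hσ.basic hx hΩ
    obtain ⟨hd2, h02, hi2⟩ := h.basic hx hΩ
    obtain ⟨-, -, -, -, -, hne1⟩ := hσ
    obtain ⟨-, -, -, -, -, hne2⟩ := h
    by_contra hne
    set a := ‖∇ σ x‖⁻¹ • ∇ σ x with ha
    set b := ‖∇ ρ x‖⁻¹ • ∇ ρ x with hb
    have ha1 : ‖a‖ = 1 := norm_smul_inv_norm (𝕜 := ℝ) hne1
    have hb1 : ‖b‖ = 1 := norm_smul_inv_norm (𝕜 := ℝ) hne2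
    have hab : ⟪a, b⟫_ℝ < 1 := (inner_lt_one_iff_real_of_norm_eq_one ha1 hb1).2 hne
    have haa : ⟪a, a⟫_ℝ = 1 := by rw [real_inner_self_eq_norm_sq, ha1]; norm_num
    have hbb : ⟪b, b⟫_ℝ = 1 := by rw [real_inner_self_eq_norm_sq, hb1]; norm_num
    have hσa : ∇ σ x = ‖∇ σ x‖ • a := by
      rw [ha, smul_smul, mul_inv_cancel₀ (norm_ne_zero_iff.2 hne1), one_smul]
    have hρb : ∇ ρ x = ‖∇ ρ x‖ • b := by
      rw [hb, smul_smul, mul_inv_cancel₀ (norm_ne_zero_iff.2 hne2), one_smul]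
    have hpρ : 0 < ⟪∇ ρ x, b - a⟫_ℝ := by
      rw [hρb, real_inner_smul_left, inner_sub_right, hbb, real_inner_comm]
      exact mul_pos (norm_pos_iff.2 hne2) (by linarith)
    have hgneg : ∇ (fun y => -σ y) x = -∇ σ x := by
      have : HasGradientAt (fun y => -σ y) (-∇ σ x) x := by
        rw [hasGradientAt_iff_hasFDerivAt, map_neg]
        exact hd1.hasGradientAt.hasFDerivAt.neg
      exact this.gradient
    have hpσ : 0 < ⟪∇ (fun y => -σ y) x, b - a⟫_ℝ := by
      rw [hgneg, hσa, inner_neg_left, real_inner_smul_left, inner_sub_right, haa]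
      have := mul_pos (norm_pos_iff.2 hne1) (sub_pos.2 hab)
      linarith
    have e1 := line_sign hd2 h02 hpρ
    have e2 := line_sign hd1.neg (by simp [h01]) hpσ
    have hcont : Tendsto (fun t : ℝ => x + t • (b - a)) (𝓝[>] 0) (𝓝 x) := by
      have : Continuous fun t : ℝ => x + t • (b - a) := by fun_prop
      have h' := this.tendsto 0
      simp only [zero_smul, add_zero] at h'
      exact h'.mono_left nhdsWithin_le_nhds
    obtain ⟨t, ht1, ht2, ht3, ht4⟩ :=
      (e1.and (e2.and ((hcont.eventually hi1).and (hcont.eventually hi2)))).exists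
    have hin : x + t • (b - a) ∈ Ω := ht3.2 (neg_pos.1 ht2)
    exact absurd (ht4.1 hin) (not_lt.2 ht1.le)
  rw [outwardNormal, dif_pos hex]
  exact key _ hex.choose_spec

theorem integrable_inner_gradient {U : Set E3} (w : VecL2 U) {φ : E3 → ℝ}
    (hφ : ContDiff ℝ ∞ φ) (hc : HasCompactSupport φ) :
    Integrable (fun x => ⟪w x, ∇ φ x⟫_ℝ) (volume.restrict U) := by
  have hcont : Continuous (∇ φ) :=
    (InnerProductSpace.toDual ℝ E3).symm.continuous.comp (hφ.continuous_fderiv (by simp))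
  have hcs : HasCompactSupport (∇ φ) :=
    (hc.fderiv (𝕜 := ℝ)).comp_left (g := (InnerProductSpace.toDual ℝ E3).symm) (by simp)
  have hL : MemLp (∇ φ) 2 (volume.restrict U) :=
    (hcont.memLp_of_hasCompactSupport hcs (μ := volume)).restrict U
  refine (L2.integrable_inner (𝕜 := ℝ) w hL.toLp).congr ?_
  filter_upwards [hL.coeFn_toLp] with x hx
  rw [hx]

theorem integral_inner_add {U : Set E3} (w₁ w₂ : VecL2 U) {φ : E3 → ℝ}
    (hφ : ContDiff ℝ ∞ φ) (hc : HasCompactSupport φ) :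
    ∫ x in U, ⟪(w₁ + w₂ : VecL2 U) x, ∇ φ x⟫_ℝ
      = (∫ x in U, ⟪w₁ x, ∇ φ x⟫_ℝ) + ∫ x in U, ⟪w₂ x, ∇ φ x⟫_ℝ := by
  rw [← integral_add (integrable_inner_gradient w₁ hφ hc) (integrable_inner_gradient w₂ hφ hc)]
  refine integral_congr_ae ?_
  filter_upwards [Lp.coeFn_add w₁ w₂] with x hx
  rw [hx, Pi.add_apply, inner_add_left]

theorem integral_inner_smul {U : Set E3} (c : ℝ) (w : VecL2 U) (φ : E3 → ℝ) :
    ∫ x in U, ⟪(c • w : VecL2 U) x, ∇ φ x⟫_ℝ = c * ∫ x in U, ⟪w x, ∇ φ x⟫_ℝ := by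
  rw [← integral_const_mul]
  refine integral_congr_ae ?_
  filter_upwards [Lp.coeFn_smul c w] with x hx
  rw [hx, Pi.smul_apply, real_inner_smul_left]

theorem integral_inner_zero (U : Set E3) (φ : E3 → ℝ) :
    ∫ x in U, ⟪(0 : VecL2 U) x, ∇ φ x⟫_ℝ = 0 := by
  have := integral_inner_smul 0 (0 : VecL2 U) φ
  simpa using this

theorem IsDivFree.zero {U : Set E3} : IsDivFree (0 : VecL2 U) :=
  fun φ _ _ _ => integral_inner_zero U φ

theorem IsDivFree.add {U : Set E3} {w₁ w₂ : VecL2 U} (h₁ : IsDivFree w₁) (h₂ : IsDivFree w₂) :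
    IsDivFree (w₁ + w₂) := fun φ hφ hc hU => by
  rw [integral_inner_add w₁ w₂ hφ hc, h₁ φ hφ hc hU, h₂ φ hφ hc hU, add_zero]

theorem IsDivFree.smul {U : Set E3} {w : VecL2 U} (c : ℝ) (h : IsDivFree w) :
    IsDivFree (c • w) := fun φ hφ hc hU => by
  rw [integral_inner_smul, h φ hφ hc hU, mul_zero]

theorem HasNormalTrace.zero {N : ℕ} {Ω : Fin N → Set E3} :
    HasNormalTrace Ω 0 (fun _ _ => 0) :=
  ⟨fun _ => integrableOn_zero, fun φ _ _ => by rw [integral_inner_zero]; simp⟩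

theorem HasNormalTrace.add {N : ℕ} {Ω : Fin N → Set E3} {w₁ w₂ : VecL2 (exterior Ω)}
    {g₁ g₂ : Fin N → E3 → ℝ} (h₁ : HasNormalTrace Ω w₁ g₁) (h₂ : HasNormalTrace Ω w₂ g₂) :
    HasNormalTrace Ω (w₁ + w₂) (fun i x => g₁ i x + g₂ i x) := by
  refine ⟨fun i => (h₁.1 i).add (h₂.1 i), fun φ hφ hc => ?_⟩
  obtain ⟨C, hC⟩ := hφ.continuous.bounded_above_of_compact_support hc
  have hint : ∀ {g : Fin N → E3 → ℝ}, (∀ i, IntegrableOn (g i) (frontier (Ω i)) μHE[2]) → ∀ i,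
      Integrable (fun x => g i x * φ x) ((μHE[2] : Measure E3).restrict (frontier (Ω i))) :=
    fun hg i => (hg i).mul_bdd (c := C) hφ.continuous.aestronglyMeasurable
      (Filter.Eventually.of_forall hC)
  rw [integral_inner_add w₁ w₂ hφ hc, h₁.2 φ hφ hc, h₂.2 φ hφ hc, ← neg_add,
    ← Finset.sum_add_distrib]
  congr 1
  refine Finset.sum_congr rfl fun i _ => ?_
  rw [← integral_add (hint h₁.1 i) (hint h₂.1 i)]
  simp only [add_mul]

theorem HasNormalTrace.smul {N : ℕ} {Ω : Fin N → Set E3} {w : VecL2 (exterior Ω)}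
    {g : Fin N → E3 → ℝ} (c : ℝ) (h : HasNormalTrace Ω w g) :
    HasNormalTrace Ω (c • w) (fun i x => c * g i x) := by
  refine ⟨fun i => (h.1 i).const_mul c, fun φ hφ hc => ?_⟩
  rw [integral_inner_smul, h.2 φ hφ hc, mul_neg, Finset.mul_sum]
  simp only [mul_assoc, integral_const_mul]

/-! ### The spaces -/

/-- `L²_σ(U)`: divergence-free fields `w ∈ L²(U)` with `w · n = 0` on `∂U`. -/
def L2sigma {N : ℕ} (Ω : Fin N → Set E3) : Submodule ℝ (VecL2 (exterior Ω)) where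
  carrier := {w | IsDivFree w ∧ HasNormalTrace Ω w (fun _ _ => 0)}
  zero_mem' := ⟨IsDivFree.zero, HasNormalTrace.zero⟩
  add_mem' := fun h₁ h₂ => ⟨h₁.1.add h₂.1, by simpa using h₁.2.add h₂.2⟩
  smul_mem' := fun c _ h => ⟨h.1.smul c, by simpa using h.2.smul c⟩

/-- `L²_dil(U)`: divergence-free fields `w ∈ L²(U)` such that, for every `i`,
`w · n = s i + v i · n` on `∂(Ω i)` for some constants `s i ∈ ℝ` and `v i ∈ ℝ³`. -/
def L2dil {N : ℕ} (Ω : Fin N → Set E3) : Submodule ℝ (VecL2 (exterior Ω)) where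
  carrier := {w | IsDivFree w ∧
    ∃ (s : Fin N → ℝ) (v : Fin N → E3), HasNormalTrace Ω w (dilData Ω s v)}
  zero_mem' := ⟨IsDivFree.zero, 0, 0, by
    convert HasNormalTrace.zero using 3
    simp [dilData]⟩
  add_mem' := by
    rintro _ _ ⟨h₁, s₁, v₁, H₁⟩ ⟨h₂, s₂, v₂, H₂⟩
    refine ⟨h₁.add h₂, s₁ + s₂, v₁ + v₂, ?_⟩
    convert H₁.add H₂ using 3 with i x
    simp only [dilData, Pi.add_apply, inner_add_left]
    ring
  smul_mem' := by
    rintro c _ ⟨h, s, v, H⟩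
    refine ⟨h.smul c, c • s, c • v, ?_⟩
    convert H.smul c using 3 with i x
    simp only [dilData, Pi.smul_apply, real_inner_smul_left, smul_eq_mul]
    ring

/-- `𝔾(U)`: the orthogonal complement of `L²_σ(U)` inside `L²_dil(U)`. -/
noncomputable def Gspace {N : ℕ} (Ω : Fin N → Set E3) : Submodule ℝ (VecL2 (exterior Ω)) :=
  L2dil Ω ⊓ (L2sigma Ω)ᗮ

/-- `w ∈ L²(U)` is the gradient of a function `q` that is harmonic in `U` and satisfies the
Neumann condition `∂q/∂n = g i` on `∂(Ω i)` for all `i`, in the sense of normal traces. -/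
def IsNeumannGradient {N : ℕ} (Ω : Fin N → Set E3) (w : VecL2 (exterior Ω))
    (g : Fin N → E3 → ℝ) : Prop :=
  ∃ q : E3 → ℝ, InnerProductSpace.HarmonicOnNhd q (exterior Ω) ∧
    w =ᵐ[volume.restrict (exterior Ω)] ∇ q ∧ HasNormalTrace Ω w g

end ExteriorFlow

/-!
Write `U` for the exterior domain. The condition `w · n = 0` says that `w` is orthogonal to the
gradients `∇φ|_U` of all test functions `φ` on `ℝ³`, so `L²_σ(U)` is the orthogonal complement of
these gradients (`L2sigma_eq_orthogonal`). Hence it is closed, its own orthogonal complement is the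
closure of these gradients, and the orthogonal decomposition of `L²_dil(U)` is the one given by the
projection onto `L²_σ(U)`. A field in `L²_σ(U)ᗮ` is determined by its normal trace
(`eq_of_hasNormalTrace`). All the remaining claims follow from two facts.

*The divergence-free fields in `L²_σ(U)ᗮ` are the square-integrable gradients of harmonic functions*
(`mem_orthogonal_L2sigma_iff`).

Let `∇φₙ` converge in `L²(U)` to a divergence-free field `w`. The `φₙ` converge in `L²_loc`, by the
Dirichlet bound below, so their mollifications at a fixed scale converge pointwise. For a radial
mollifier `η` the field `-η(y) y` is a gradient, so the derivative of a mollification with respect to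
the scale is the pairing of `∇φₙ` with the gradient of a test function. In the limit it vanishes,
since `w` is divergence-free. The limit `q` of the mollifications is therefore independent of the
scale. Its gradient is a mollification of `w`, which is smooth and divergence-free, and which tends
to `w` as the scale tends to zero. So `q` is harmonic and `∇q = w`
(`exists_harmonicOnNhd_of_mem_closure`).

Conversely a square-integrable gradient `∇q` is a limit of gradients of test functions
(`mem_closure_of_gradient`). The function `q - c` is cut off on a large shell, with `c` from
Poincaré's inequality there, which bounds the error by the tail of `‖∇q‖²`. A function with bounded
support is localized by a partition of unity, and each piece is translated a little so that it is
defined beyond the boundary.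

*The data `(s, v)` and the fields in `𝔾(U)` correspond to each other*
(`exists_linearEquiv_Gspace`).

Existence (`exists_hasNormalTrace_dilData`) is Riesz representation of the functional
`φ ↦ -∑ i, ∫_{∂Ω i} (s i + v i · n) φ dS`, which is bounded in the norm `‖∇φ‖_{L²(U)}` by the trace
inequality `exists_lintegral_frontier_sq_le`. That inequality rests on the Dirichlet bound
`exists_lintegral_sq_le`: the norm `‖φ‖` in `L²` of a bounded part of `U` is at most a constant times
`‖∇φ‖_{L²(U)}`. Far from the origin this is Hardy's inequality along rays, and the bound spreads over
`U` and up to its boundary by short translations, since `U` is connected (`ControlledAt`).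

Uniqueness (`eq_zero_of_hasNormalTrace_zero`): if `s i + v i · n` vanishes on `∂Ω i`, then so do `s i`
and `v i`, because the normal is `v i / ‖v i‖` at a point of `∂Ω i` where `⟪v i, ·⟫` is maximal, and
`-v i / ‖v i‖` at a point where it is minimal.

Thus `𝔾(U)` is linearly isomorphic to `ℝ^{4N}`, the fields for the unit vectors of data form the
basis, and `L²_dil(U)` is closed as the sum of a closed and a finite-dimensional subspace.

Of the surface measure only two properties are needed. It is dominated, on small pieces of the
boundary, by Lebesgue measure of a coordinate projection, and it is positive on nonempty relatively
open pieces. The first holds because the projection has a Lipschitz inverse, the second because the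
projection is Lipschitz and its image contains a disc.
-/


namespace ExteriorFlow
open scoped ENNReal NNReal

/-! ### Square integrals of differences -/

theorem ennreal_add_sq_le (a b : ℝ≥0∞) : (a + b) ^ 2 ≤ 2 * a ^ 2 + 2 * b ^ 2 := by
  rcases eq_or_ne a ⊤ with rfl | ha
  · simp
  rcases eq_or_ne b ⊤ with rfl | hb
  · simp
  lift a to ℝ≥0 using ha
  lift b to ℝ≥0 using hb
  norm_cast
  rw [← NNReal.coe_le_coe]
  push_cast
  nlinarith [sq_nonneg ((a : ℝ) - b)]

theorem sq_lintegral_mul_le {α : Type*} [MeasurableSpace α] (μ : Measure α) {f g : α → ℝ≥0∞}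
    (hf : AEMeasurable f μ) (hg : AEMeasurable g μ) :
    (∫⁻ x, f x * g x ∂μ) ^ 2 ≤ (∫⁻ x, f x ^ 2 ∂μ) * ∫⁻ x, g x ^ 2 ∂μ := by
  have h := ENNReal.lintegral_mul_le_Lp_mul_Lq μ (p := 2) (q := 2)
    Real.HolderConjugate.two_two hf hg
  have h2 : ∀ a : ℝ≥0∞, (a ^ ((1 : ℝ) / 2)) ^ 2 = a := fun a => by
    rw [← ENNReal.rpow_two, ← ENNReal.rpow_mul]; norm_num
  calc (∫⁻ x, f x * g x ∂μ) ^ 2 ≤ _ := pow_le_pow_left' h 2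
    _ = _ := by
      rw [mul_pow, h2, h2]
      simp

theorem sq_lintegral_le {α : Type*} [MeasurableSpace α] (μ : Measure α) {f : α → ℝ≥0∞}
    (hf : AEMeasurable f μ) :
    (∫⁻ x, f x ∂μ) ^ 2 ≤ μ univ * ∫⁻ x, f x ^ 2 ∂μ := by
  simpa using sq_lintegral_mul_le μ (f := fun _ => 1) (g := f) aemeasurable_const hf

theorem enorm_sub_le_lintegral_deriv {g g' : ℝ → ℝ} {a b : ℝ} (hab : a ≤ b)
    (hd : ∀ t ∈ Icc a b, HasDerivAt g (g' t) t) (hc : ContinuousOn g' (Icc a b)) :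
    ‖g b - g a‖ₑ ≤ ∫⁻ t in Ioc a b, ‖g' t‖ₑ := by
  have h := intervalIntegral.integral_eq_sub_of_hasDerivAt (f := g) (f' := g') (a := a) (b := b)
    (by rwa [uIcc_of_le hab]) (ContinuousOn.intervalIntegrable (by rwa [uIcc_of_le hab]))
  rw [← h, intervalIntegral.integral_of_le hab]
  exact enorm_integral_le_lintegral_enorm _

/-- The increment of `f` along a segment is bounded by the integral of its derivative. -/
theorem enorm_sub_le_lintegral_segment {W : Set E3} {f : E3 → ℝ} (hW : IsOpen W)
    (hf : ContDiffOn ℝ 1 f W) {y h : E3} {a b : ℝ} (hab : a ≤ b)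
    (hy : ∀ t ∈ Icc a b, y + t • h ∈ W) :
    ‖f (y + b • h) - f (y + a • h)‖ₑ
      ≤ ∫⁻ t in Ioc a b, ‖h‖ₑ * W.indicator (fun z => ‖fderiv ℝ f z‖ₑ) (y + t • h) := by
  have hl : ∀ t : ℝ, HasDerivAt (fun t : ℝ => y + t • h) h t := fun t => by
    simpa using ((hasDerivAt_id t).smul_const h).const_add y
  have hd : ∀ t ∈ Icc a b, HasDerivAt (fun t : ℝ => f (y + t • h)) (fderiv ℝ f (y + t • h) h) t := by
    intro t ht
    have h1 : DifferentiableAt ℝ f (y + t • h) :=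
      (hf.differentiableOn (by simp)).differentiableAt (hW.mem_nhds (hy t ht))
    exact h1.hasFDerivAt.comp_hasDerivAt t (hl t)
  have hc : ContinuousOn (fun t : ℝ => fderiv ℝ f (y + t • h) h) (Icc a b) := by
    have h1 : ContinuousOn (fderiv ℝ f) W := hf.continuousOn_fderiv_of_isOpen hW (by simp)
    have h2 : ContinuousOn (fun t : ℝ => fderiv ℝ f (y + t • h)) (Icc a b) :=
      h1.comp (by fun_prop) hy
    exact h2.clm_apply continuousOn_const
  refine (enorm_sub_le_lintegral_deriv hab hd hc).trans
    (setLIntegral_mono' measurableSet_Ioc fun t ht => ?_)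
  rw [indicator_of_mem (hy t (Ioc_subset_Icc_self ht)), mul_comm]
  exact ContinuousLinearMap.le_opENorm _ _

theorem measurable_indicator_fderiv {W : Set E3} (hW : IsOpen W) (f : E3 → ℝ) :
    Measurable (W.indicator fun z => ‖fderiv ℝ f z‖ₑ) :=
  (measurable_fderiv ℝ f).enorm.indicator hW.measurableSet

/-- Translation estimate: `‖f(· + h) - f‖ ≤ ‖h‖ ‖∇f‖` in `L²`. -/
theorem lintegral_translate_sub_sq_le {W S : Set E3} {f : E3 → ℝ} {h : E3} (hW : IsOpen W)
    (hf : ContDiffOn ℝ 1 f W) (hSm : MeasurableSet S)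
    (hS : ∀ y ∈ S, ∀ t ∈ Icc (0 : ℝ) 1, y + t • h ∈ W) :
    ∫⁻ y in S, ‖f (y + h) - f y‖ₑ ^ 2 ≤ ‖h‖ₑ ^ 2 * ∫⁻ y in W, ‖fderiv ℝ f y‖ₑ ^ 2 := by
  set G := W.indicator fun z => ‖fderiv ℝ f z‖ₑ with hG
  have hGm : Measurable G := measurable_indicator_fderiv hW f
  have hGh : Measurable fun p : E3 × ℝ => G (p.1 + p.2 • h) := hGm.comp (by fun_prop)
  have h1 : ∀ y ∈ S, ‖f (y + h) - f y‖ₑ ^ 2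
      ≤ ∫⁻ t in Ioc (0 : ℝ) 1, (‖h‖ₑ * G (y + t • h)) ^ 2 := by
    intro y hy
    have h2 := enorm_sub_le_lintegral_segment hW hf zero_le_one (hS y hy)
    simp only [one_smul, zero_smul, add_zero] at h2
    refine (pow_le_pow_left' h2 2).trans ?_
    refine (sq_lintegral_le _ ?_).trans (by simp [hG])
    exact ((hGh.comp (measurable_prodMk_left (x := y))).const_mul _).aemeasurable
  calc ∫⁻ y in S, ‖f (y + h) - f y‖ₑ ^ 2
      ≤ ∫⁻ y in S, ∫⁻ t in Ioc (0 : ℝ) 1, (‖h‖ₑ * G (y + t • h)) ^ 2 := setLIntegral_mono' hSm h1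
    _ ≤ ∫⁻ y, ∫⁻ t in Ioc (0 : ℝ) 1, (‖h‖ₑ * G (y + t • h)) ^ 2 := setLIntegral_le_lintegral _ _
    _ = ∫⁻ t in Ioc (0 : ℝ) 1, ∫⁻ y, (‖h‖ₑ * G (y + t • h)) ^ 2 :=
      lintegral_lintegral_swap ((hGh.const_mul _).pow_const 2).aemeasurable
    _ = ∫⁻ t in Ioc (0 : ℝ) 1, ‖h‖ₑ ^ 2 * ∫⁻ y, G y ^ 2 := by
      refine lintegral_congr fun t => ?_
      simp only [mul_pow]
      rw [lintegral_const_mul' _ _ (by simp),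
        lintegral_add_right_eq_self (fun y => G y ^ 2)]
    _ = ‖h‖ₑ ^ 2 * ∫⁻ y, G y ^ 2 := by simp
    _ = _ := by
      congr 1
      rw [← lintegral_indicator hW.measurableSet]
      refine lintegral_congr fun y => ?_
      by_cases hy : y ∈ W <;> simp [hG, hy]

/-! ### Local control of a function by its gradient -/

/-- Near `x`, the square integral over `W` of every function of the class `𝒞` is bounded by a
constant multiple of the quantity `Q f`. -/
def ControlledAt (W : Set E3) (𝒞 : Set (E3 → ℝ)) (Q : (E3 → ℝ) → ℝ≥0∞) (x : E3) : Prop :=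
  ∃ r > 0, ∃ C : ℝ≥0, ∀ f ∈ 𝒞, ∫⁻ y in W ∩ Metric.ball x r, ‖f y‖ₑ ^ 2 ≤ C * Q f

theorem ControlledAt.isOpen (W : Set E3) (𝒞 : Set (E3 → ℝ)) (Q : (E3 → ℝ) → ℝ≥0∞) :
    IsOpen {x | ControlledAt W 𝒞 Q x} := by
  rw [Metric.isOpen_iff]
  rintro x ⟨r, hr, C, hC⟩
  refine ⟨r / 2, half_pos hr, fun y hy => ⟨r / 2, half_pos hr, C, fun f hf => ?_⟩⟩
  refine (lintegral_mono_set (inter_subset_inter_right _ ?_)).trans (hC f hf)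
  refine Metric.ball_subset_ball' ?_
  have := Metric.mem_ball.1 hy
  linarith

/-- Control propagates backwards along a translation that keeps a neighbourhood inside `W`. -/
theorem ControlledAt.of_translate {W : Set E3} {𝒞 : Set (E3 → ℝ)} {Q : (E3 → ℝ) → ℝ≥0∞}
    (hW : IsOpen W) (h𝒞 : ∀ f ∈ 𝒞, ContDiffOn ℝ 1 f W)
    (hQ : ∀ f ∈ 𝒞, ∫⁻ y in W, ‖fderiv ℝ f y‖ₑ ^ 2 ≤ Q f) {x h : E3}
    (hx : ControlledAt W 𝒞 Q (x + h)) {r₀ : ℝ} (hr₀ : 0 < r₀)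
    (hseg : ∀ y ∈ W ∩ Metric.ball x r₀, ∀ t ∈ Icc (0 : ℝ) 1, y + t • h ∈ W) :
    ControlledAt W 𝒞 Q x := by
  obtain ⟨r, hr, C, hC⟩ := hx
  refine ⟨min r r₀, lt_min hr hr₀, 2 * C + 2 * ‖h‖₊ ^ 2, fun f hf => ?_⟩
  set S := W ∩ Metric.ball x (min r r₀) with hS
  have hSm : MeasurableSet S := hW.measurableSet.inter measurableSet_ball
  have hSr : ∀ y ∈ S, y ∈ W ∩ Metric.ball x r₀ := fun y hy =>
    ⟨hy.1, Metric.ball_subset_ball (min_le_right _ _) hy.2⟩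
  set T := W ∩ Metric.ball (x + h) r with hT
  have hTm : MeasurableSet T := hW.measurableSet.inter measurableSet_ball
  have hST : ∀ y ∈ S, y + h ∈ T := by
    intro y hy
    refine ⟨?_, ?_⟩
    · have := hseg y (hSr y hy) 1 (by simp)
      simpa using this
    · have h1 := Metric.ball_subset_ball (min_le_left _ _) hy.2
      simpa [Metric.mem_ball] using h1
  set F := T.indicator fun z => ‖f z‖ₑ ^ 2 with hF
  have hFm : AEMeasurable F volume := by
    rw [hF, aemeasurable_indicator_iff hTm]
    exact (((h𝒞 f hf).continuousOn.mono inter_subset_left).aemeasurable hTm).enorm.pow_const 2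
  have hle : ∀ y ∈ S, ‖f y‖ₑ ^ 2 ≤ 2 * F (y + h) + 2 * ‖f (y + h) - f y‖ₑ ^ 2 := by
    intro y hy
    rw [hF, indicator_of_mem (hST y hy)]
    refine le_trans ?_ (ennreal_add_sq_le _ _)
    refine pow_le_pow_left' ?_ 2
    calc ‖f y‖ₑ = ‖f (y + h) - (f (y + h) - f y)‖ₑ := by congr 1; ring
      _ ≤ _ := enorm_sub_le
  have hFh : AEMeasurable (fun y => F (y + h)) (volume.restrict S) :=
    (hFm.comp_quasiMeasurePreserving
      (quasiMeasurePreserving_add_right volume h)).mono_measure Measure.restrict_le_self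
  calc ∫⁻ y in S, ‖f y‖ₑ ^ 2
      ≤ ∫⁻ y in S, (2 * F (y + h) + 2 * ‖f (y + h) - f y‖ₑ ^ 2) := setLIntegral_mono' hSm hle
    _ = 2 * (∫⁻ y in S, F (y + h)) + 2 * ∫⁻ y in S, ‖f (y + h) - f y‖ₑ ^ 2 := by
      rw [lintegral_add_left' (hFh.const_mul _), lintegral_const_mul' _ _ (by simp),
        lintegral_const_mul' _ _ (by simp)]
    _ ≤ 2 * (C * Q f) + 2 * (‖h‖ₑ ^ 2 * Q f) := by
      gcongr
      · calc ∫⁻ y in S, F (y + h) ≤ ∫⁻ y, F (y + h) := setLIntegral_le_lintegral _ _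
          _ = ∫⁻ y, F y := lintegral_add_right_eq_self F h
          _ = ∫⁻ y in T, ‖f y‖ₑ ^ 2 := lintegral_indicator hTm _
          _ ≤ _ := hC f hf
      · refine (lintegral_translate_sub_sq_le hW (h𝒞 f hf) hSm
          fun y hy => hseg y (hSr y hy)).trans ?_
        gcongr
        exact hQ f hf
    _ = _ := by
      push_cast
      rw [enorm_eq_nnnorm]
      ring

/-- Control at one point of a connected open set gives control at all of its points. -/
theorem ControlledAt.of_isPreconnected {W : Set E3} {𝒞 : Set (E3 → ℝ)} {Q : (E3 → ℝ) → ℝ≥0∞}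
    (hW : IsOpen W) (hconn : IsPreconnected W) (h𝒞 : ∀ f ∈ 𝒞, ContDiffOn ℝ 1 f W)
    (hQ : ∀ f ∈ 𝒞, ∫⁻ y in W, ‖fderiv ℝ f y‖ₑ ^ 2 ≤ Q f) {x₀ : E3} (hx₀ : x₀ ∈ W)
    (h₀ : ControlledAt W 𝒞 Q x₀) {x : E3} (hx : x ∈ W) : ControlledAt W 𝒞 Q x := by
  refine hconn.subset_of_closure_inter_subset (ControlledAt.isOpen W 𝒞 Q) ⟨x₀, hx₀, h₀⟩ ?_ hx
  rintro y ⟨hy, hyW⟩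
  obtain ⟨r, hr, hball⟩ := Metric.isOpen_iff.1 hW y hyW
  obtain ⟨z, hz, hyz⟩ := Metric.mem_closure_iff.1 hy (r / 2) (half_pos hr)
  have hz' : ControlledAt W 𝒞 Q (y + (z - y)) := by simpa using hz
  refine hz'.of_translate hW h𝒞 hQ (half_pos hr) fun u hu t ht => hball ?_
  rw [dist_comm, dist_eq_norm] at hyz
  have h1 : ‖u - y‖ < r / 2 := by simpa [dist_eq_norm] using hu.2
  rw [Metric.mem_ball, dist_eq_norm]
  calc ‖u + t • (z - y) - y‖ = ‖(u - y) + t • (z - y)‖ := by congr 1; abel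
    _ ≤ ‖u - y‖ + ‖t • (z - y)‖ := norm_add_le _ _
    _ ≤ ‖u - y‖ + 1 * ‖z - y‖ := by
      rw [norm_smul, Real.norm_of_nonneg ht.1]; gcongr; exact ht.2
    _ < r := by linarith

theorem ControlledAt.of_isCompact {W K : Set E3} {𝒞 : Set (E3 → ℝ)} {Q : (E3 → ℝ) → ℝ≥0∞}
    (hK : IsCompact K) (h : ∀ x ∈ K, ControlledAt W 𝒞 Q x) :
    ∃ C : ℝ≥0, ∀ f ∈ 𝒞, ∫⁻ y in W ∩ K, ‖f y‖ₑ ^ 2 ≤ C * Q f := by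
  refine hK.induction_on (p := fun K => ∃ C : ℝ≥0, ∀ f ∈ 𝒞, ∫⁻ y in W ∩ K, ‖f y‖ₑ ^ 2 ≤ C * Q f)
    ⟨0, by simp⟩ ?_ ?_ ?_
  · rintro s t hst ⟨C, hC⟩
    exact ⟨C, fun f hf => (lintegral_mono_set (inter_subset_inter_right _ hst)).trans (hC f hf)⟩
  · rintro s t ⟨C, hC⟩ ⟨D, hD⟩
    refine ⟨C + D, fun f hf => ?_⟩
    rw [inter_union_distrib_left]
    refine (lintegral_union_le _ _ _).trans ?_
    push_cast
    rw [add_mul]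
    exact add_le_add (hC f hf) (hD f hf)
  · intro x hx
    obtain ⟨r, hr, C, hC⟩ := h x hx
    exact ⟨Metric.ball x r, mem_nhdsWithin_of_mem_nhds (Metric.ball_mem_nhds x hr), C, hC⟩

/-- Poincaré inequality on a ball. The double integral of `|f u - f v|²` over pairs of points is
estimated by the translation estimate for every difference `h = u - v`; some point `v` is no worse
than the average, and the constant is `f v`. -/
theorem exists_lintegral_sub_const_sq_le (a : E3) {r : ℝ} (hr : 0 < r) :
    ∃ C : ℝ≥0, ∀ f : E3 → ℝ, ContDiffOn ℝ 1 f (Metric.ball a r) → ∃ c : ℝ,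
      ∫⁻ y in Metric.ball a r, ‖f y - c‖ₑ ^ 2
        ≤ C * ∫⁻ y in Metric.ball a r, ‖fderiv ℝ f y‖ₑ ^ 2 := by
  set B := Metric.ball a r with hB
  have hBm : MeasurableSet B := measurableSet_ball
  have hBo : IsOpen B := Metric.isOpen_ball
  have hB0 : volume B ≠ 0 := (Metric.measure_ball_pos volume a hr).ne'
  have hBt : volume B ≠ ⊤ := measure_ball_lt_top.ne
  set M : ℝ≥0∞ := (volume B)⁻¹ * (ENNReal.ofReal (2 * r) ^ 2 * volume (Metric.ball (0 : E3) (2 * r)))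
    with hM
  have hMt : M ≠ ⊤ := ENNReal.mul_ne_top (ENNReal.inv_ne_top.2 hB0)
    (ENNReal.mul_ne_top (ENNReal.pow_ne_top ENNReal.ofReal_ne_top) measure_ball_lt_top.ne)
  refine ⟨M.toNNReal, fun f hf => ?_⟩
  rw [ENNReal.coe_toNNReal hMt]
  set D := ∫⁻ y in B, ‖fderiv ℝ f y‖ₑ ^ 2 with hD
  set F := B.indicator f with hF
  have hFm : Measurable F := by
    classical
    have := hf.continuousOn.measurable_piecewise (g := 0) continuousOn_const hBm
    rwa [piecewise_eq_indicator] at this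
  set I : E3 → ℝ≥0∞ := B.indicator 1 with hI
  have hIm : Measurable I := measurable_one.indicator hBm
  set H : E3 → E3 → ℝ≥0∞ := fun v h => I v * I (v + h) * ‖F (v + h) - F v‖ₑ ^ 2 with hH
  have hHm : Measurable (Function.uncurry H) :=
    ((hIm.comp measurable_fst).mul (hIm.comp (measurable_fst.add measurable_snd))).mul
      (((hFm.comp (measurable_fst.add measurable_snd)).sub (hFm.comp measurable_fst)).enorm.pow_const 2)
  -- substitute `u = v + h` and integrate over `v` first
  have key : ∫⁻ v in B, ∫⁻ u in B, ‖f u - f v‖ₑ ^ 2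
      ≤ (ENNReal.ofReal (2 * r) ^ 2 * volume (Metric.ball (0 : E3) (2 * r))) * D := by
    calc ∫⁻ v in B, ∫⁻ u in B, ‖f u - f v‖ₑ ^ 2
        = ∫⁻ v, ∫⁻ h, H v h := by
          rw [← lintegral_indicator hBm]
          refine lintegral_congr fun v => ?_
          by_cases hv : v ∈ B
          · rw [indicator_of_mem hv, ← lintegral_indicator hBm,
              ← lintegral_add_left_eq_self _ v]
            refine lintegral_congr fun h => ?_
            by_cases hu : v + h ∈ B <;> simp [hH, hI, hF, hv, hu]
          · simp [hH, hI, hv]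
      _ = ∫⁻ h, ∫⁻ v, H v h := lintegral_lintegral_swap hHm.aemeasurable
      _ ≤ ∫⁻ h, (Metric.ball (0 : E3) (2 * r)).indicator
            (fun _ => ENNReal.ofReal (2 * r) ^ 2 * D) h := by
          refine lintegral_mono fun h => ?_
          set S := B ∩ (fun v => v + h) ⁻¹' B with hS
          have hSm : MeasurableSet S := hBm.inter (measurable_add_const h hBm)
          have h1 : ∫⁻ v, H v h = ∫⁻ v in S, ‖f (v + h) - f v‖ₑ ^ 2 := by
            rw [← lintegral_indicator hSm]
            refine lintegral_congr fun v => ?_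
            by_cases hv : v ∈ B <;> by_cases hu : v + h ∈ B <;> simp [hH, hI, hF, hS, hv, hu]
          rw [h1]
          by_cases hh : h ∈ Metric.ball (0 : E3) (2 * r)
          · rw [indicator_of_mem hh]
            refine (lintegral_translate_sub_sq_le hBo hf hSm ?_).trans ?_
            · rintro y ⟨hy1, hy2⟩ t ht
              have := (convex_ball a r).add_smul_sub_mem hy1 hy2 ht
              rwa [add_sub_cancel_left] at this
            · gcongr
              rw [← ofReal_norm]
              exact ENNReal.ofReal_le_ofReal (mem_ball_zero_iff.1 hh).le
          · have hS0 : S = ∅ := by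
              rw [eq_empty_iff_forall_notMem]
              rintro v ⟨hv1, hv2⟩
              refine hh (mem_ball_zero_iff.2 ?_)
              have e1 : dist v a < r := hv1
              have e2 : dist (v + h) a < r := hv2
              have e3 := dist_triangle_right (v + h) v a
              rw [dist_eq_norm (v + h) v, add_sub_cancel_left] at e3
              linarith
            simp [hS0]
      _ = _ := by
          rw [lintegral_indicator measurableSet_ball, setLIntegral_const]
          ring
  obtain ⟨v, -, hv⟩ := exists_le_setLAverage (μ := volume) (s := B)
    (f := fun v => ∫⁻ u in B, ‖f u - f v‖ₑ ^ 2) hB0 hBt (by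
      have h1 : Measurable fun v => ∫⁻ u in B, ‖F u - F v‖ₑ ^ 2 :=
        Measurable.lintegral_prod_right'
          (f := fun p : E3 × E3 => ‖F p.2 - F p.1‖ₑ ^ 2)
          (((hFm.comp measurable_snd).sub (hFm.comp measurable_fst)).enorm.pow_const 2)
      refine h1.aemeasurable.congr ?_
      filter_upwards [ae_restrict_mem hBm] with v hv
      refine setLIntegral_congr_fun hBm fun u hu => ?_
      simp [hF, hu, hv])
  refine ⟨f v, hv.trans ?_⟩
  rw [setLAverage_eq, ENNReal.div_eq_inv_mul, hM, mul_assoc]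
  gcongr

/-! ### Smooth boundaries as graphs over a coordinate plane -/

/-- The projection of `ℝ³` to `ℝ²` that forgets the `k`-th coordinate. -/
def dropCoord (k : Fin 3) (y : E3) : Fin 2 → ℝ := fun j => y (k.succAbove j)

/-- The point of `ℝ³` with `k`-th coordinate `t` and remaining coordinates `z`. -/
noncomputable def insertCoord (k : Fin 3) (t : ℝ) (z : Fin 2 → ℝ) : E3 :=
  WithLp.toLp 2 (k.insertNth t z : Fin 3 → ℝ)

theorem dropCoord_insertCoord (k : Fin 3) (t : ℝ) (z : Fin 2 → ℝ) :
    dropCoord k (insertCoord k t z) = z := by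
  ext j; simp [dropCoord, insertCoord]

theorem continuous_dropCoord (k : Fin 3) : Continuous (dropCoord k) := by
  unfold dropCoord; fun_prop

theorem continuous_insertCoord (k : Fin 3) :
    Continuous fun p : ℝ × (Fin 2 → ℝ) => insertCoord k p.1 p.2 :=
  (PiLp.continuous_toLp 2 _).comp (Continuous.finInsertNth k continuous_fst continuous_snd)

theorem dropCoord_add (k : Fin 3) (y z : E3) : dropCoord k (y + z) = dropCoord k y + dropCoord k z := by
  ext j; simp [dropCoord]

theorem dropCoord_sub (k : Fin 3) (y z : E3) : dropCoord k (y - z) = dropCoord k y - dropCoord k z := by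
  ext j; simp [dropCoord]

theorem dropCoord_smul_single (k : Fin 3) (t s : ℝ) :
    dropCoord k (t • EuclideanSpace.single k s) = 0 := by
  ext j; simp [dropCoord]

theorem lipschitzWith_dropCoord (k : Fin 3) : LipschitzWith 1 (dropCoord k) := by
  refine LipschitzWith.of_dist_le_mul fun x y => ?_
  simp only [NNReal.coe_one, one_mul]
  refine (dist_pi_le_iff dist_nonneg).2 fun j => ?_
  rw [dist_eq_norm, dist_eq_norm]
  exact PiLp.norm_apply_le (x - y) _

theorem norm_le_abs_add_norm_dropCoord (k : Fin 3) (v : E3) :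
    ‖v - v k • EuclideanSpace.single k (1 : ℝ)‖ ≤ 2 * ‖dropCoord k v‖ := by
  set u := v - v k • EuclideanSpace.single k (1 : ℝ) with hu
  have h1 : u k = 0 := by simp [hu]
  have h2 : ∀ j, u (k.succAbove j) = dropCoord k v j := fun j => by simp [hu, dropCoord]
  have h3 : ‖u‖ ^ 2 = ‖dropCoord k v 0‖ ^ 2 + ‖dropCoord k v 1‖ ^ 2 := by
    rw [EuclideanSpace.norm_sq_eq, Fin.sum_univ_succAbove _ k, h1]
    simp [h2]
  have h4 := norm_le_pi_norm (dropCoord k v) 0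
  have h5 := norm_le_pi_norm (dropCoord k v) 1
  refine abs_le_of_sq_le_sq' ?_ (by positivity) |>.2
  rw [h3]
  have h6 : ‖dropCoord k v 0‖ ^ 2 ≤ ‖dropCoord k v‖ ^ 2 := by gcongr
  have h7 : ‖dropCoord k v 1‖ ^ 2 ≤ ‖dropCoord k v‖ ^ 2 := by gcongr
  nlinarith [sq_nonneg ‖dropCoord k v‖]

/-- A local defining function is nonpositive on the closure of the domain. -/
theorem nonpos_of_mem_closure {Ω V : Set E3} {ρ : E3 → ℝ}
    (hV : IsOpen V) (hρ : ContinuousOn ρ V) (hiff : ∀ y ∈ V, y ∈ Ω ↔ ρ y < 0) {z : E3}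
    (hz : z ∈ V) (hzc : z ∈ closure Ω) : ρ z ≤ 0 := by
  by_contra hpos
  have hc : ContinuousAt ρ z := hρ.continuousAt (hV.mem_nhds hz)
  have hev : ∀ᶠ y in 𝓝 z, y ∉ Ω := by
    filter_upwards [hV.mem_nhds hz, hc.eventually (lt_mem_nhds (not_le.1 hpos))] with y hy hy'
    exact fun hyΩ => absurd ((hiff y hy).1 hyΩ) (not_lt.2 hy'.le)
  exact (mem_closure_iff_frequently.1 hzc) hev

/-- `∂Ω` near a boundary point `x`: some coordinate direction `d = ± e k` is transversal to the
boundary. Short translations along `d` move points off `Ω` into the exterior (and inside the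
prescribed neighbourhood `O`), those along `-d` move points of the closure into `Ω`, and the
projection along `d` is injective on `∂Ω` with Lipschitz inverse. -/
theorem IsSmoothBoundedDomain.exists_boundary_chart {Ω : Set E3} (hΩ : IsSmoothBoundedDomain Ω)
    {x : E3} (hx : x ∈ frontier Ω) {O : Set E3} (hO : IsOpen O) (hxO : x ∈ O) :
    ∃ (k : Fin 3) (σ r δ : ℝ) (K : ℝ≥0), 0 < r ∧ 0 < δ ∧ |σ| = 1 ∧
      (∀ y ∈ Metric.ball x r, y ∉ Ω → ∀ t ∈ Ioc 0 δ,
        y + t • EuclideanSpace.single k σ ∈ O \ closure Ω) ∧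
      (∀ y ∈ Metric.ball x r, y ∈ closure Ω → ∀ t ∈ Ioc 0 δ,
        y - t • EuclideanSpace.single k σ ∈ Ω) ∧
      (∀ y ∈ frontier Ω ∩ Metric.ball x r, ∀ y' ∈ frontier Ω ∩ Metric.ball x r,
        dist y y' ≤ K * dist (dropCoord k y) (dropCoord k y')) := by
  obtain ⟨ρ, V, hV, hxV, hρ, hiff, hgrad⟩ := hΩ.smooth_boundary x hx
  have hne : fderiv ℝ ρ x ≠ 0 := fun h => hgrad (by simp [gradient, h])
  obtain ⟨k, hk⟩ : ∃ k, fderiv ℝ ρ x (EuclideanSpace.single k 1) ≠ 0 := by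
    by_contra! h
    refine hne (ContinuousLinearMap.ext fun v => ?_)
    have hv : v = ∑ i, v i • EuclideanSpace.single i (1 : ℝ) := by
      ext j; simp [Finset.sum_apply, Pi.single_apply]
    rw [hv, map_sum]
    simp [h]
  obtain ⟨σ, hσ, hσk⟩ : ∃ σ : ℝ, |σ| = 1 ∧ 0 < fderiv ℝ ρ x (EuclideanSpace.single k σ) := by
    have hneg : EuclideanSpace.single k (-1 : ℝ) = - EuclideanSpace.single k (1 : ℝ) := by
      ext j; by_cases hj : j = k <;> simp [hj]
    rcases lt_or_gt_of_ne hk with h | h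
    · exact ⟨-1, by simp, by rw [hneg, map_neg]; linarith⟩
    · exact ⟨1, by simp, h⟩
  set d : E3 := EuclideanSpace.single k σ with hd
  have hdn : ‖d‖ = 1 := by simp [hd, hσ]
  set c := fderiv ℝ ρ x d with hc
  have hfc : ContinuousOn (fderiv ℝ ρ) V := hρ.continuousOn_fderiv_of_isOpen hV (by simp)
  have hfx : ContinuousAt (fderiv ℝ ρ) x := hfc.continuousAt (hV.mem_nhds hxV)
  have e1 : ∀ᶠ z in 𝓝 x, c / 2 < fderiv ℝ ρ z d :=
    (hfx.clm_apply continuousAt_const).eventually (lt_mem_nhds (by linarith))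
  have e2 : ∀ᶠ z in 𝓝 x, ‖fderiv ℝ ρ z‖ < ‖fderiv ℝ ρ x‖ + 1 :=
    hfx.norm.eventually (gt_mem_nhds (by linarith))
  have e3 : ∀ᶠ z in 𝓝 x, z ∈ V := hV.mem_nhds hxV
  have e4 : ∀ᶠ z in 𝓝 x, z ∈ O := hO.mem_nhds hxO
  obtain ⟨R, hR, hball⟩ := Metric.eventually_nhds_iff_ball.1 (e1.and (e2.and (e3.and e4)))
  set M := ‖fderiv ℝ ρ x‖ + 1 with hM
  have hM0 : 0 < M := by positivity
  -- by the mean value theorem all three claims reduce to `∂ρ/∂d > c/2` and `‖∇ρ‖ ≤ M` near `x`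
  have hmvt : ∀ y ∈ Metric.ball x R, ∀ y' ∈ Metric.ball x R, ∃ z ∈ Metric.ball x R,
      ρ y' - ρ y = fderiv ℝ ρ z (y' - y) := by
    intro y hy y' hy'
    obtain ⟨z, hz, h⟩ := domain_mvt (f := ρ) (f' := fderiv ℝ ρ) (s := Metric.ball x R) (x := y) (y := y')
      (fun z hz => (((hρ.contDiffAt (hV.mem_nhds (hball z hz).2.2.1)).differentiableAt
        (by simp)).hasFDerivAt).hasFDerivWithinAt) (convex_ball x R) hy hy'
    exact ⟨z, (convex_ball x R).segment_subset hy hy' hz, h⟩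
  have hsub : ∀ y ∈ Metric.ball x (R / 2), ∀ t ∈ Icc (-(R / 2)) (R / 2), y + t • d ∈ Metric.ball x R := by
    intro y hy t ht
    have h1 : ‖y - x‖ < R / 2 := by simpa [dist_eq_norm] using hy
    rw [Metric.mem_ball, dist_eq_norm]
    calc ‖y + t • d - x‖ = ‖(y - x) + t • d‖ := by congr 1; abel
      _ ≤ ‖y - x‖ + ‖t • d‖ := norm_add_le _ _
      _ = ‖y - x‖ + |t| := by rw [norm_smul, hdn, mul_one, Real.norm_eq_abs]
      _ < R := by have := abs_le.2 ht; linarith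
  have hballsub : Metric.ball x (R / 2) ⊆ Metric.ball x R := Metric.ball_subset_ball (by linarith)
  have hfront : ∀ y ∈ frontier Ω ∩ Metric.ball x (R / 2), ρ y = 0 := by
    rintro y ⟨hyf, hyb⟩
    have hyV := (hball y (hballsub hyb)).2.2.1
    refine le_antisymm (nonpos_of_mem_closure hV hρ.continuousOn hiff hyV
      (frontier_subset_closure hyf)) (not_lt.1 fun h => ?_)
    rw [hΩ.isOpen.frontier_eq] at hyf
    exact hyf.2 ((hiff y hyV).2 h)
  refine ⟨k, σ, R / 2, R / 2, (2 * (2 * M / c + 1)).toNNReal, by positivity, by positivity,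
    hσ, ?_, ?_, ?_⟩
  · intro y hy hyΩ t ht
    have hyt := hsub y hy t ⟨by linarith [ht.1], ht.2⟩
    have hyR := hballsub hy
    obtain ⟨z, hz, h⟩ := hmvt y hyR _ hyt
    rw [add_sub_cancel_left, map_smul, smul_eq_mul] at h
    have h1 : 0 ≤ ρ y := not_lt.1 fun h' => hyΩ ((hiff y (hball y hyR).2.2.1).2 h')
    have h2 : 0 < t * fderiv ℝ ρ z d := mul_pos ht.1 (by linarith [(hball z hz).1])
    refine ⟨(hball _ hyt).2.2.2, fun hcl => ?_⟩
    have := nonpos_of_mem_closure hV hρ.continuousOn hiff (hball _ hyt).2.2.1 hcl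
    linarith
  · intro y hy hyΩ t ht
    have hyt := hsub y hy (-t) ⟨by linarith [ht.2], by linarith [ht.1]⟩
    rw [neg_smul, ← sub_eq_add_neg] at hyt
    have hyR := hballsub hy
    obtain ⟨z, hz, h⟩ := hmvt _ hyt y hyR
    rw [sub_sub_cancel, map_smul, smul_eq_mul] at h
    have h1 := nonpos_of_mem_closure hV hρ.continuousOn hiff (hball _ hyR).2.2.1 hyΩ
    have h2 : 0 < t * fderiv ℝ ρ z d := mul_pos ht.1 (by linarith [(hball z hz).1])
    exact (hiff _ (hball _ hyt).2.2.1).2 (by linarith)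
  · intro y hy y' hy'
    obtain ⟨z, hz, h⟩ := hmvt _ (hballsub hy'.2) _ (hballsub hy.2)
    rw [hfront y hy, hfront y' hy', sub_zero] at h
    set v := y - y' with hv
    set u := v - v k • EuclideanSpace.single k (1 : ℝ) with hu
    have hσσ : σ * σ = 1 := by rw [← abs_mul_abs_self, hσ, one_mul]
    have hvd : v = u + (σ * v k) • d := by
      have : v k • EuclideanSpace.single k (1 : ℝ) = (σ * v k) • d := by
        ext j
        by_cases hj : j = k
        · subst hj; simp [hd]; linear_combination (-v.ofLp j) * hσσ
        · simp [hd, hj]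
      rw [← this, hu]; abel
    have h0 : fderiv ℝ ρ z v = fderiv ℝ ρ z u + (σ * v k) * fderiv ℝ ρ z d := by
      conv_lhs => rw [hvd]
      simp
    have h1 : ‖u‖ ≤ 2 * ‖dropCoord k v‖ := norm_le_abs_add_norm_dropCoord k v
    have h2 : |σ * v k| * (c / 2) ≤ M * ‖u‖ := by
      have h3 : |σ * v k| * fderiv ℝ ρ z d = |fderiv ℝ ρ z u| := by
        rw [← abs_of_pos (show 0 < fderiv ℝ ρ z d by linarith [(hball z hz).1]), ← abs_mul,
          ← abs_neg]
        congr 1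
        linarith
      calc |σ * v k| * (c / 2) ≤ |σ * v k| * fderiv ℝ ρ z d := by
            gcongr; exact (hball z hz).1.le
        _ = |fderiv ℝ ρ z u| := h3
        _ ≤ ‖fderiv ℝ ρ z‖ * ‖u‖ := (fderiv ℝ ρ z).le_opNorm u
        _ ≤ M * ‖u‖ := by gcongr; exact (hball z hz).2.1.le
    have h4 : |σ * v k| ≤ 2 * M / c * ‖u‖ := by
      rw [div_mul_eq_mul_div, le_div_iff₀ hσk]
      linarith
    rw [dist_eq_norm, dist_eq_norm, ← dropCoord_sub, ← hv]
    calc ‖v‖ = ‖u + (σ * v k) • d‖ := by rw [← hvd]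
      _ ≤ ‖u‖ + ‖(σ * v k) • d‖ := norm_add_le _ _
      _ = ‖u‖ + |σ * v k| := by rw [norm_smul, hdn, mul_one, Real.norm_eq_abs]
      _ ≤ ‖u‖ + 2 * M / c * ‖u‖ := by gcongr
      _ = (2 * M / c + 1) * ‖u‖ := by ring
      _ ≤ (2 * M / c + 1) * (2 * ‖dropCoord k v‖) := by gcongr
      _ = _ := by rw [Real.coe_toNNReal _ (by positivity)]; ring

/-! ### Two-dimensional measure of boundary pieces -/

theorem hausdorffMeasure_two_eq_volume : (μH[2] : Measure (Fin 2 → ℝ)) = volume := by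
  have := hausdorffMeasure_pi_real (ι := Fin 2)
  simpa using this

theorem exists_euclideanHausdorffMeasure_eq_smul :
    ∃ c : ℝ≥0, c ≠ 0 ∧ (μHE[2] : Measure E3) = c • μH[2] :=
  ⟨_, Measure.addHaarScalarFactor_volume_hausdorffMeasure_ne_zero 2,
    Measure.euclideanHausdorffMeasure_def 2⟩

/-- A set that projects injectively to a coordinate plane with Lipschitz inverse has surface
measure at most a constant times the area of its projection. -/
theorem exists_surface_measure_le {S : Set E3} {k : Fin 3} {K : ℝ≥0}
    (hS : ∀ y ∈ S, ∀ y' ∈ S, dist y y' ≤ K * dist (dropCoord k y) (dropCoord k y')) :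
    ∃ C : ℝ≥0, ∀ A : Set (Fin 2 → ℝ), (μHE[2] : Measure E3) (S ∩ dropCoord k ⁻¹' A) ≤ C * volume A := by
  obtain ⟨c, -, hc⟩ := exists_euclideanHausdorffMeasure_eq_smul
  refine ⟨c * K ^ 2, fun A => ?_⟩
  have hanti : AntilipschitzWith K (S.domRestrict (dropCoord k)) :=
    AntilipschitzWith.of_le_mul_dist fun y y' => hS y y.2 y' y'.2
  have h1 := hanti.hausdorffMeasure_preimage_le (d := 2) zero_le_two A
  have h2 : (μH[2] : Measure E3) (Subtype.val '' (S.domRestrict (dropCoord k) ⁻¹' A))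
      = μH[2] (S.domRestrict (dropCoord k) ⁻¹' A) :=
    isometry_subtype_coe.hausdorffMeasure_image (Or.inl zero_le_two) _
  have h3 : Subtype.val '' (S.domRestrict (dropCoord k) ⁻¹' A) = S ∩ dropCoord k ⁻¹' A := by
    ext y; simp [and_comm, Set.domRestrict]
  rw [hc, Measure.smul_apply, ENNReal.smul_def, smul_eq_mul, ← h3, h2]
  rw [hausdorffMeasure_two_eq_volume] at h1
  push_cast
  rw [mul_assoc]
  gcongr
  simpa using h1

theorem lintegral_insertCoord (k : Fin 3) {H : E3 → ℝ≥0∞} (hH : Measurable H) :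
    ∫⁻ z, ∫⁻ t, H (insertCoord k t z) = ∫⁻ y, H y := by
  have h1 := (volume_preserving_piFinSuccAbove (fun _ : Fin 3 => ℝ) k).symm
  have h2 := PiLp.volume_preserving_toLp (Fin 3)
  have h3 := (h2.comp h1).lintegral_comp hH
  rw [← h3, Measure.volume_eq_prod, lintegral_prod_symm' (fun a => H ((WithLp.toLp 2 ∘
    (MeasurableEquiv.piFinSuccAbove (fun _ => ℝ) k).symm) a)) (hH.comp (h2.comp h1).measurable)]
  rfl

theorem add_smul_single_eq_insertCoord (k : Fin 3) (y : E3) (t : ℝ) :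
    y + t • EuclideanSpace.single k (1 : ℝ) = insertCoord k (t + y k) (dropCoord k y) := by
  ext j
  refine Fin.succAboveCases k ?_ (fun i => ?_) j
  · simp [insertCoord, add_comm]
  · simp [insertCoord, dropCoord]

/-- Integrating over a boundary piece and along lines transversal to it is controlled by the volume
integral. -/
theorem exists_lintegral_surface_line_le {S : Set E3} {k : Fin 3} {K : ℝ≥0}
    (hS : ∀ y ∈ S, ∀ y' ∈ S, dist y y' ≤ K * dist (dropCoord k y) (dropCoord k y')) :
    ∃ C : ℝ≥0, ∀ H : E3 → ℝ≥0∞, Measurable H →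
      ∫⁻ y in S, ∫⁻ t, H (y + t • EuclideanSpace.single k (1 : ℝ)) ∂(volume : Measure ℝ) ∂(μHE[2] : Measure E3)
        ≤ C * ∫⁻ y, H y := by
  obtain ⟨C, hC⟩ := exists_surface_measure_le hS
  refine ⟨C, fun H hH => ?_⟩
  have hdm : Measurable (dropCoord k) := (continuous_dropCoord k).measurable
  have hmap : ((μHE[2] : Measure E3).restrict S).map (dropCoord k) ≤ C • volume := by
    refine Measure.le_iff.2 fun A hA => ?_
    rw [Measure.map_apply hdm hA, Measure.restrict_apply (hdm hA), inter_comm]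
    exact hC A
  have hF : Measurable fun z => ∫⁻ t, H (insertCoord k t z) := by
    refine Measurable.lintegral_prod_right' (f := fun p : (Fin 2 → ℝ) × ℝ => H (insertCoord k p.2 p.1)) ?_
    exact hH.comp ((continuous_insertCoord k).comp continuous_swap).measurable
  calc ∫⁻ y in S, ∫⁻ t, H (y + t • EuclideanSpace.single k (1 : ℝ)) ∂(volume : Measure ℝ) ∂(μHE[2] : Measure E3)
      = ∫⁻ y in S, ∫⁻ t, H (insertCoord k t (dropCoord k y)) ∂(volume : Measure ℝ) ∂(μHE[2] : Measure E3) := by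
        refine lintegral_congr fun y => ?_
        simp only [add_smul_single_eq_insertCoord]
        exact lintegral_add_right_eq_self (fun t => H (insertCoord k t (dropCoord k y))) (y k)
    _ = ∫⁻ z, ∫⁻ t, H (insertCoord k t z) ∂(volume : Measure ℝ) ∂(((μHE[2] : Measure E3).restrict S).map (dropCoord k)) :=
        (lintegral_map hF hdm).symm
    _ ≤ ∫⁻ z, ∫⁻ t, H (insertCoord k t z) ∂(volume : Measure ℝ) ∂(C • (volume : Measure (Fin 2 → ℝ))) :=
        lintegral_mono' hmap le_rfl
    _ = C * ∫⁻ y, H y := by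
        rw [lintegral_smul_measure, lintegral_insertCoord k hH]
        rfl

namespace IsSmoothBoundedDomain
variable {Ω : Set E3}

/-- Every relatively open nonempty part of the boundary has positive surface measure: its projection
along a transversal direction contains a disc. -/
theorem surface_measure_pos (hΩ : IsSmoothBoundedDomain Ω) {x : E3} (hx : x ∈ frontier Ω) {ε : ℝ}
    (hε : 0 < ε) : 0 < (μHE[2] : Measure E3) (frontier Ω ∩ Metric.ball x ε) := by
  obtain ⟨k, σ, r, δ, K, hr, hδ, hσ, h1, h2, -⟩ :=
    hΩ.exists_boundary_chart hx isOpen_univ (mem_univ x)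
  set d : E3 := EuclideanSpace.single k σ with hd
  have hdn : ‖d‖ = 1 := by simp [hd, hσ]
  have hxb := Metric.mem_ball_self (x := x) hr
  set t := min δ (ε / 2) with ht
  have ht0 : 0 < t := lt_min hδ (half_pos hε)
  have hP : x - t • d ∈ Ω := h2 x hxb (frontier_subset_closure hx) t ⟨ht0, min_le_left _ _⟩
  have hQ : x + t • d ∈ (closure Ω)ᶜ := by
    rw [hΩ.isOpen.frontier_eq] at hx
    exact (h1 x hxb hx.2 t ⟨ht0, min_le_left _ _⟩).2
  set h : (Fin 2 → ℝ) → E3 := fun z => insertCoord k 0 (z - dropCoord k x) with hh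
  have hcont : Continuous h := (continuous_insertCoord k).comp
    (continuous_const.prodMk (continuous_id.sub continuous_const))
  have h0 : h (dropCoord k x) = 0 := by
    ext j; refine Fin.succAboveCases k ?_ (fun i => ?_) j <;> simp [hh, insertCoord]
  have hdrop : ∀ z, dropCoord k (h z) = z - dropCoord k x := fun z => dropCoord_insertCoord _ _ _
  have hnhds : dropCoord k '' (frontier Ω ∩ Metric.ball x ε) ∈ 𝓝 (dropCoord k x) := by
    have e1 : ∀ᶠ z in 𝓝 (dropCoord k x), x - t • d + h z ∈ Ω := by
      have : ContinuousAt (fun z => x - t • d + h z) (dropCoord k x) := by fun_prop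
      exact this.preimage_mem_nhds (by rw [h0, add_zero]; exact hΩ.isOpen.mem_nhds hP)
    have e2 : ∀ᶠ z in 𝓝 (dropCoord k x), x + t • d + h z ∈ (closure Ω)ᶜ := by
      have : ContinuousAt (fun z => x + t • d + h z) (dropCoord k x) := by fun_prop
      exact this.preimage_mem_nhds (by rw [h0, add_zero]; exact isClosed_closure.isOpen_compl.mem_nhds hQ)
    have e3 : ∀ᶠ z in 𝓝 (dropCoord k x), ‖h z‖ < ε / 2 := by
      have : ContinuousAt (fun z => ‖h z‖) (dropCoord k x) := by fun_prop
      exact this.eventually_lt_const (by simpa [h0] using hε)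
    filter_upwards [e1, e2, e3] with z hz1 hz2 hz3
    -- the segment over `z` joins a point of the domain to a point off its closure
    set γ : ℝ → E3 := fun s => x + s • d + h z with hγ
    have hγc : Continuous γ := by fun_prop
    have hpre : IsPreconnected (γ '' Icc (-t) t) := isPreconnected_Icc.image γ hγc.continuousOn
    obtain ⟨s, hs, hyf⟩ : ∃ s ∈ Icc (-t) t, γ s ∈ frontier Ω := by
      by_contra! hcon
      obtain ⟨y, -, hy1, hy2⟩ := hpre Ω (closure Ω)ᶜ hΩ.isOpen isClosed_closure.isOpen_compl
        (by
          rintro _ ⟨s, hs, rfl⟩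
          have := hcon s hs
          rw [hΩ.isOpen.frontier_eq] at this
          by_cases hγΩ : γ s ∈ Ω
          · exact Or.inl hγΩ
          · exact Or.inr fun hcl => this ⟨hcl, hγΩ⟩)
        ⟨γ (-t), ⟨-t, ⟨le_rfl, by linarith⟩, rfl⟩, by simpa [hγ, ← sub_eq_add_neg] using hz1⟩
        ⟨γ t, ⟨t, ⟨by linarith, le_rfl⟩, rfl⟩, hz2⟩
      exact hy2 (subset_closure hy1)
    refine ⟨γ s, ⟨hyf, ?_⟩, ?_⟩
    · rw [Metric.mem_ball, dist_eq_norm]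
      calc ‖γ s - x‖ = ‖s • d + h z‖ := by congr 1; simp only [hγ]; abel
        _ ≤ ‖s • d‖ + ‖h z‖ := norm_add_le _ _
        _ = |s| + ‖h z‖ := by rw [norm_smul, hdn, mul_one, Real.norm_eq_abs]
        _ < ε / 2 + ε / 2 := by
          have := abs_le.2 hs
          have := min_le_right δ (ε / 2)
          linarith
        _ = ε := by ring
    · simp only [hγ, hd, dropCoord_add, hdrop, dropCoord_smul_single]
      abel
  have hpos : 0 < (volume : Measure (Fin 2 → ℝ)) (dropCoord k '' (frontier Ω ∩ Metric.ball x ε)) :=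
    Measure.measure_pos_of_mem_nhds _ hnhds
  rw [← hausdorffMeasure_two_eq_volume] at hpos
  have hle := (lipschitzWith_dropCoord k).hausdorffMeasure_image_le (d := 2) zero_le_two
    (frontier Ω ∩ Metric.ball x ε)
  obtain ⟨c, hc0, hc⟩ := exists_euclideanHausdorffMeasure_eq_smul
  rw [hc, Measure.smul_apply, ENNReal.smul_def, smul_eq_mul]
  refine ENNReal.mul_pos (by simpa using hc0) (ne_of_gt ?_)
  simpa using hpos.trans_le hle

theorem isCompact_frontier (hΩ : IsSmoothBoundedDomain Ω) : IsCompact (frontier Ω) :=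
  Metric.isCompact_of_isClosed_isBounded isClosed_frontier
    (hΩ.isBounded.closure.subset frontier_subset_closure)

theorem surface_measure_lt_top (hΩ : IsSmoothBoundedDomain Ω) :
    (μHE[2] : Measure E3) (frontier Ω) < ⊤ := by
  refine hΩ.isCompact_frontier.measure_lt_top_of_nhdsWithin fun x hx => ?_
  obtain ⟨k, σ, r, δ, K, hr, -, -, -, -, h3⟩ :=
    hΩ.exists_boundary_chart hx isOpen_univ (mem_univ x)
  obtain ⟨C, hC⟩ := exists_surface_measure_le h3
  refine ⟨frontier Ω ∩ Metric.ball x r,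
    inter_mem self_mem_nhdsWithin (mem_nhdsWithin_of_mem_nhds (Metric.ball_mem_nhds x hr)), ?_⟩
  have hsub : frontier Ω ∩ Metric.ball x r ⊆ (frontier Ω ∩ Metric.ball x r) ∩
      dropCoord k ⁻¹' (Metric.ball (dropCoord k x) r) := by
    intro y hy
    refine ⟨hy, ?_⟩
    have := (lipschitzWith_dropCoord k).dist_le_mul y x
    simp only [NNReal.coe_one, one_mul] at this
    exact this.trans_lt hy.2
  exact (measure_mono hsub).trans_lt ((hC _).trans_lt
    (ENNReal.mul_lt_top ENNReal.coe_lt_top measure_ball_lt_top))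

theorem continuousOn_outwardNormal (hΩ : IsSmoothBoundedDomain Ω) :
    ContinuousOn (outwardNormal Ω) (frontier Ω) := by
  intro x hx
  obtain ⟨ρ, V, hV, hxV, hρ, hiff, hgrad⟩ := hΩ.smooth_boundary x hx
  have hgc : ContinuousOn (∇ ρ) V :=
    (InnerProductSpace.toDual ℝ E3).symm.continuous.comp_continuousOn
      (hρ.continuousOn_fderiv_of_isOpen hV (by simp))
  have hgx : ContinuousAt (∇ ρ) x := hgc.continuousAt (hV.mem_nhds hxV)
  have h1 : ContinuousAt (fun y => ‖∇ ρ y‖⁻¹ • ∇ ρ y) x :=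
    (hgx.norm.inv₀ (norm_ne_zero_iff.2 hgrad)).smul hgx
  refine h1.continuousWithinAt.congr_of_eventuallyEq ?_
    (outwardNormal_eq hΩ.isOpen hx ⟨V, hV, hxV, hρ, hiff, hgrad⟩)
  filter_upwards [self_mem_nhdsWithin, mem_nhdsWithin_of_mem_nhds (hV.mem_nhds hxV),
    mem_nhdsWithin_of_mem_nhds (hgx.eventually_ne hgrad)] with y hy hyV hyg
  exact outwardNormal_eq hΩ.isOpen hy ⟨V, hV, hyV, hρ, hiff, hyg⟩

theorem norm_outwardNormal_le (Ω : Set E3) (x : E3) : ‖outwardNormal Ω x‖ ≤ 1 := by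
  unfold outwardNormal
  split_ifs with h
  · rw [norm_smul, norm_inv, norm_norm]
    exact inv_mul_le_one
  · simp

theorem integrableOn_dilData (hΩ : IsSmoothBoundedDomain Ω) (s : ℝ) (v : E3) :
    IntegrableOn (fun x => s + ⟪v, outwardNormal Ω x⟫_ℝ) (frontier Ω) μHE[2] := by
  have : IsFiniteMeasure ((μHE[2] : Measure E3).restrict (frontier Ω)) :=
    ⟨by simpa using hΩ.surface_measure_lt_top⟩
  refine Integrable.of_bound (C := |s| + ‖v‖) ?_ (Eventually.of_forall fun x => ?_)
  · exact (continuousOn_const.add (continuousOn_const.inner hΩ.continuousOn_outwardNormal)).aestronglyMeasurable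
      isClosed_frontier.measurableSet
  · refine (norm_add_le _ _).trans (add_le_add le_rfl ((norm_inner_le_norm _ _).trans ?_))
    exact mul_le_of_le_one_right (norm_nonneg _) (norm_outwardNormal_le Ω x)

end IsSmoothBoundedDomain

/-! ### The exterior domain -/

section Exterior
variable {N : ℕ} {Ω : Fin N → Set E3}

theorem isOpen_exterior (Ω : Fin N → Set E3) : IsOpen (exterior Ω) :=
  (isClosed_iUnion_of_finite fun _ => isClosed_closure).isOpen_compl

theorem notMem_of_mem_exterior {x : E3} (hx : x ∈ exterior Ω) (i : Fin N) : x ∉ closure (Ω i) :=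
  fun h => hx (mem_iUnion.2 ⟨i, h⟩)

theorem exists_norm_ge_mem_exterior (hΩ : ∀ i, IsSmoothBoundedDomain (Ω i)) :
    ∃ R > 0, ∀ x : E3, R ≤ ‖x‖ → x ∈ exterior Ω := by
  have hb : Bornology.IsBounded (⋃ i, closure (Ω i)) :=
    (Bornology.isBounded_iUnion).2 fun i => (hΩ i).isBounded.closure
  obtain ⟨R, hR⟩ := hb.subset_ball (0 : E3)
  refine ⟨max R 1, by positivity, fun x hx hmem => ?_⟩
  have := mem_ball_zero_iff.1 (hR hmem)
  linarith [le_max_left R 1]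

theorem closure_subset_compl_other (hdisj : ∀ i j, i ≠ j → Disjoint (closure (Ω i)) (closure (Ω j)))
    (i : Fin N) : closure (Ω i) ⊆ (⋃ j ∈ {j | j ≠ i}, closure (Ω j))ᶜ := by
  intro x hx hmem
  simp only [mem_iUnion, mem_ofPred_eq] at hmem
  obtain ⟨j, hj, hxj⟩ := hmem
  exact (hdisj j i hj).le_bot ⟨hxj, hx⟩

theorem isOpen_compl_other (Ω : Fin N → Set E3) (i : Fin N) :
    IsOpen (⋃ j ∈ {j | j ≠ i}, closure (Ω j))ᶜ :=
  ((Set.toFinite _).isClosed_biUnion fun _ _ => isClosed_closure).isOpen_compl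

/-- A boundary chart of `Ω i` for the exterior domain: short transversal translations move points off
`Ω i` into the exterior, avoiding the other domains as well. -/
theorem exists_exterior_chart (hΩ : ∀ i, IsSmoothBoundedDomain (Ω i))
    (hdisj : ∀ i j, i ≠ j → Disjoint (closure (Ω i)) (closure (Ω j))) {i : Fin N} {x : E3}
    (hx : x ∈ frontier (Ω i)) :
    ∃ (k : Fin 3) (σ r δ : ℝ) (K : ℝ≥0), 0 < r ∧ 0 < δ ∧ |σ| = 1 ∧
      (∀ y ∈ Metric.ball x r, y ∉ Ω i → ∀ t ∈ Ioc 0 δ,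
        y + t • EuclideanSpace.single k σ ∈ exterior Ω) ∧
      (∀ y ∈ frontier (Ω i) ∩ Metric.ball x r, ∀ y' ∈ frontier (Ω i) ∩ Metric.ball x r,
        dist y y' ≤ K * dist (dropCoord k y) (dropCoord k y')) := by
  obtain ⟨k, σ, r, δ, K, hr, hδ, hσ, h1, -, h3⟩ := (hΩ i).exists_boundary_chart hx
    (isOpen_compl_other Ω i) (closure_subset_compl_other hdisj i (frontier_subset_closure hx))
  refine ⟨k, σ, r, δ, K, hr, hδ, hσ, fun y hy hyΩ t ht => ?_, h3⟩
  obtain ⟨h4, h5⟩ := h1 y hy hyΩ t ht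
  intro hmem
  obtain ⟨j, hj⟩ := mem_iUnion.1 hmem
  by_cases hji : j = i
  · exact h5 (hji ▸ hj)
  · exact h4 (by simp only [mem_iUnion, mem_ofPred_eq]; exact ⟨j, hji, hj⟩)

theorem mem_frontier_of_mem_closure_exterior (hΩ : ∀ i, IsSmoothBoundedDomain (Ω i)) {x : E3}
    (hx : x ∈ closure (exterior Ω)) (hxU : x ∉ exterior Ω) : ∃ i, x ∈ frontier (Ω i) := by
  obtain ⟨i, hi⟩ := mem_iUnion.1 (not_not.1 hxU)
  refine ⟨i, ?_⟩
  rw [(hΩ i).isOpen.frontier_eq]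
  refine ⟨hi, fun hxi => ?_⟩
  obtain ⟨y, hy1, hy2⟩ := mem_closure_iff.1 hx _ (hΩ i).isOpen hxi
  exact notMem_of_mem_exterior hy2 i (subset_closure hy1)

/-- Control at one point of the exterior domain propagates to all points, including those of the
boundary, which short transversal translations move into the domain. -/
theorem controlledAt_exterior (hΩ : ∀ i, IsSmoothBoundedDomain (Ω i))
    (hdisj : ∀ i j, i ≠ j → Disjoint (closure (Ω i)) (closure (Ω j)))
    (hconn : IsConnected (exterior Ω)) {𝒞 : Set (E3 → ℝ)} {Q : (E3 → ℝ) → ℝ≥0∞}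
    (h𝒞 : ∀ f ∈ 𝒞, ContDiffOn ℝ 1 f (exterior Ω))
    (hQ : ∀ f ∈ 𝒞, ∫⁻ y in exterior Ω, ‖fderiv ℝ f y‖ₑ ^ 2 ≤ Q f) {x₀ : E3} (hx₀ : x₀ ∈ exterior Ω)
    (h₀ : ControlledAt (exterior Ω) 𝒞 Q x₀) (x : E3) : ControlledAt (exterior Ω) 𝒞 Q x := by
  have hin : ∀ x ∈ exterior Ω, ControlledAt (exterior Ω) 𝒞 Q x := fun x hx =>
    h₀.of_isPreconnected (isOpen_exterior Ω) hconn.isPreconnected h𝒞 hQ hx₀ hx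
  by_cases hxU : x ∈ exterior Ω
  · exact hin x hxU
  by_cases hxc : x ∈ closure (exterior Ω)
  · obtain ⟨i, hi⟩ := mem_frontier_of_mem_closure_exterior hΩ hxc hxU
    obtain ⟨k, σ, r, δ, K, hr, hδ, -, h1, -⟩ := exists_exterior_chart hΩ hdisj hi
    have hxΩ : x ∉ Ω i := by rw [(hΩ i).isOpen.frontier_eq] at hi; exact hi.2
    refine ControlledAt.of_translate (h := δ • EuclideanSpace.single k σ) (isOpen_exterior Ω) h𝒞 hQ
      (hin _ (h1 x (Metric.mem_ball_self hr) hxΩ δ ⟨hδ, le_rfl⟩)) hr fun y hy t ht => ?_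
    rcases ht.1.eq_or_lt with rfl | ht0
    · simpa using hy.1
    · rw [smul_smul]
      exact h1 y hy.2 (fun h => notMem_of_mem_exterior hy.1 i (subset_closure h)) _
        ⟨mul_pos ht0 hδ, mul_le_of_le_one_left hδ.le ht.2⟩
  · obtain ⟨r, hr, hball⟩ := Metric.isOpen_iff.1 isClosed_closure.isOpen_compl x hxc
    refine ⟨r, hr, 0, fun f _ => ?_⟩
    have : exterior Ω ∩ Metric.ball x r = ∅ :=
      eq_empty_of_forall_notMem fun y hy => hball hy.2 (subset_closure hy.1)
    simp [this]

end Exterior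

/-! ### Hardy's inequality along rays -/

theorem lintegral_comp_smul_pos {t : ℝ} (ht : 0 < t) (F : E3 → ℝ≥0∞) :
    ∫⁻ y, F (t • y) = ENNReal.ofReal ((t ^ 3)⁻¹) * ∫⁻ y, F y := by
  have h := Measure.map_addHaar_smul (volume : Measure E3) ht.ne'
  have h2 : ∫⁻ y, F y ∂(Measure.map (fun y => t • y) (volume : Measure E3)) = ∫⁻ y, F (t • y) :=
    lintegral_map_equiv F (Homeomorph.smulOfNeZero t ht.ne').toMeasurableEquiv
  rw [← h2]
  erw [h]
  rw [lintegral_smul_measure]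
  simp [abs_of_pos ht]

theorem lintegral_Ioi_rpow_lt_top :
    ∫⁻ t in Ioi (1 : ℝ), ENNReal.ofReal (t ^ (-(3 / 2) : ℝ)) < ⊤ := by
  have h := integrableOn_Ioi_rpow_of_lt (a := -(3 / 2)) (by norm_num) one_pos
  have := h.2
  refine lt_of_le_of_lt (lintegral_mono fun t => ?_) this
  rw [← ofReal_norm]
  exact ENNReal.ofReal_le_ofReal (Real.le_norm_self _)

/-- A compactly supported function is controlled on a set `S` by its gradient on the union of the
rays issuing from `S`. This is Cauchy–Schwarz for `φ y = -∫ ∇φ (t y) · y dt` over `t > 1`: with the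
weights `t ^ (± 3 / 4)` one factor is the convergent integral of `t ^ (-3 / 2)`, and the Jacobian
`t ^ (-3)` of `y ↦ t y` turns the weight `t ^ (3 / 2)` of the other one into `t ^ (-3 / 2)` too. -/
theorem exists_lintegral_sq_le_of_rays {U S : Set E3} (hU : IsOpen U) (hS : Bornology.IsBounded S)
    (hSm : MeasurableSet S) (hray : ∀ y ∈ S, ∀ t : ℝ, 1 ≤ t → t • y ∈ U) (hS0 : (0 : E3) ∉ S) :
    ∃ C : ℝ≥0, ∀ φ : E3 → ℝ, ContDiff ℝ 1 φ → HasCompactSupport φ →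
      ∫⁻ y in S, ‖φ y‖ₑ ^ 2 ≤ C * ∫⁻ y in U, ‖fderiv ℝ φ y‖ₑ ^ 2 := by
  obtain ⟨L, hL⟩ := hS.exists_norm_le
  set A := ∫⁻ t in Ioi (1 : ℝ), ENNReal.ofReal (t ^ (-(3 / 2) : ℝ)) with hA
  have hAt : A ≠ ⊤ := lintegral_Ioi_rpow_lt_top.ne
  have hCt : ENNReal.ofReal L ^ 2 * (A * A) ≠ ⊤ :=
    ENNReal.mul_ne_top (ENNReal.pow_ne_top ENNReal.ofReal_ne_top) (ENNReal.mul_ne_top hAt hAt)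
  refine ⟨(ENNReal.ofReal L ^ 2 * (A * A)).toNNReal, fun φ hφ hc => ?_⟩
  rw [ENNReal.coe_toNNReal hCt]
  set G := U.indicator fun z => ‖fderiv ℝ φ z‖ₑ with hG
  have hGm : Measurable G := measurable_indicator_fderiv hU φ
  have hGs : Measurable fun p : E3 × ℝ => G (p.2 • p.1) := hGm.comp (by fun_prop)
  have hpt : ∀ y ∈ S, ‖φ y‖ₑ ^ 2 ≤ ENNReal.ofReal L ^ 2 *
      (A * ∫⁻ t in Ioi (1 : ℝ), ENNReal.ofReal (t ^ (3 / 2 : ℝ)) * G (t • y) ^ 2) := by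
    intro y hy
    have hy0 : y ≠ 0 := fun h => hS0 (h ▸ hy)
    obtain ⟨R, hR⟩ := hc.isCompact.isBounded.exists_norm_le
    set M := max 1 ((R + 1) / ‖y‖) with hM
    have hMy : φ (M • y) = 0 := by
      refine image_eq_zero_of_notMem_tsupport fun hmem => ?_
      have h1 := hR _ hmem
      rw [norm_smul, Real.norm_of_nonneg (le_trans zero_le_one (le_max_left _ _))] at h1
      have h2 : (R + 1) / ‖y‖ * ‖y‖ ≤ M * ‖y‖ := by gcongr; exact le_max_right _ _
      rw [div_mul_cancel₀ _ (norm_ne_zero_iff.2 hy0)] at h2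
      linarith
    have h1 := enorm_sub_le_lintegral_segment hU hφ.contDiffOn (y := 0) (h := y)
      (le_max_left 1 ((R + 1) / ‖y‖)) fun t ht => by
        rw [zero_add]; exact hray y hy t ht.1
    rw [← hM] at h1
    simp only [zero_add, hMy, zero_sub, enorm_neg, one_smul] at h1
    have h2 : ‖φ y‖ₑ ≤ ENNReal.ofReal L * ∫⁻ t in Ioi (1 : ℝ),
        ENNReal.ofReal (t ^ (-(3 / 4) : ℝ)) * (ENNReal.ofReal (t ^ (3 / 4 : ℝ)) * G (t • y)) := by
      refine h1.trans ?_
      rw [← lintegral_const_mul' _ _ ENNReal.ofReal_ne_top]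
      refine (lintegral_mono_set Ioc_subset_Ioi_self).trans ?_
      refine setLIntegral_mono' measurableSet_Ioi fun t ht => ?_
      have ht0 : (0 : ℝ) < t := lt_trans one_pos ht
      rw [← mul_assoc (ENNReal.ofReal (t ^ (-(3 / 4) : ℝ))), ← ENNReal.ofReal_mul (by positivity),
        ← Real.rpow_add ht0]
      simp only [neg_add_cancel, Real.rpow_zero, ENNReal.ofReal_one, one_mul]
      gcongr
      rw [← ofReal_norm]
      exact ENNReal.ofReal_le_ofReal (hL y hy)
    refine (pow_le_pow_left' h2 2).trans ?_
    rw [mul_pow]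
    gcongr
    have hw : ∀ a : ℝ, Measurable fun t : ℝ => ENNReal.ofReal (t ^ a) := fun a =>
      (measurable_id.pow_const a).ennreal_ofReal
    refine (sq_lintegral_mul_le _ (hw _).aemeasurable
      ((hw _).mul (hGs.comp (measurable_prodMk_left (x := y)))).aemeasurable).trans (le_of_eq ?_)
    have hsq : ∀ a : ℝ, ∀ t ∈ Ioi (1 : ℝ), ENNReal.ofReal (t ^ a) ^ 2 = ENNReal.ofReal (t ^ (2 * a)) := by
      intro a t ht
      have ht0 : (0 : ℝ) < t := lt_trans one_pos ht
      rw [← ENNReal.ofReal_pow (by positivity), ← Real.rpow_natCast, ← Real.rpow_mul ht0.le]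
      congr 2; push_cast; ring
    congr 1
    · refine setLIntegral_congr_fun measurableSet_Ioi fun t ht => ?_
      rw [hsq _ t ht]; norm_num
    · refine setLIntegral_congr_fun measurableSet_Ioi fun t ht => ?_
      simp only [Pi.mul_apply, Function.comp_apply, mul_pow]
      rw [hsq _ t ht]; norm_num
  have hw : Measurable fun t : ℝ => ENNReal.ofReal (t ^ (3 / 2 : ℝ)) :=
    (measurable_id.pow_const _).ennreal_ofReal
  calc ∫⁻ y in S, ‖φ y‖ₑ ^ 2
      ≤ ∫⁻ y in S, ENNReal.ofReal L ^ 2 *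
        (A * ∫⁻ t in Ioi (1 : ℝ), ENNReal.ofReal (t ^ (3 / 2 : ℝ)) * G (t • y) ^ 2) :=
        setLIntegral_mono' hSm hpt
    _ ≤ ∫⁻ y, ENNReal.ofReal L ^ 2 *
        (A * ∫⁻ t in Ioi (1 : ℝ), ENNReal.ofReal (t ^ (3 / 2 : ℝ)) * G (t • y) ^ 2) :=
        setLIntegral_le_lintegral _ _
    _ = ENNReal.ofReal L ^ 2 * (A * ∫⁻ y, ∫⁻ t in Ioi (1 : ℝ),
          ENNReal.ofReal (t ^ (3 / 2 : ℝ)) * G (t • y) ^ 2) := by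
        rw [lintegral_const_mul' _ _ (ENNReal.pow_ne_top ENNReal.ofReal_ne_top),
          lintegral_const_mul' _ _ hAt]
    _ = ENNReal.ofReal L ^ 2 * (A * ∫⁻ t in Ioi (1 : ℝ), ∫⁻ y,
          ENNReal.ofReal (t ^ (3 / 2 : ℝ)) * G (t • y) ^ 2) := by
        rw [lintegral_lintegral_swap]
        exact ((hw.comp measurable_snd).mul (hGs.pow_const 2)).aemeasurable
    _ = ENNReal.ofReal L ^ 2 * (A * (A * ∫⁻ y, G y ^ 2)) := by
        congr 2
        rw [hA, ← lintegral_mul_const _ (by fun_prop)]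
        refine setLIntegral_congr_fun measurableSet_Ioi fun t ht => ?_
        have ht0 : (0 : ℝ) < t := lt_trans one_pos ht
        rw [lintegral_const_mul' _ _ ENNReal.ofReal_ne_top,
          lintegral_comp_smul_pos ht0 fun y => G y ^ 2, ← mul_assoc,
          ← ENNReal.ofReal_mul (by positivity)]
        congr 2
        rw [← Real.rpow_natCast t 3, ← Real.rpow_neg ht0.le, ← Real.rpow_add ht0]
        norm_num
    _ = ENNReal.ofReal L ^ 2 * (A * A) * ∫⁻ y in U, ‖fderiv ℝ φ y‖ₑ ^ 2 := by
        rw [← lintegral_indicator hU.measurableSet, mul_assoc, mul_assoc]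
        congr 3
        refine lintegral_congr fun y => ?_
        by_cases hy : y ∈ U <;> simp [hG, hy]

section Exterior
variable {N : ℕ} {Ω : Fin N → Set E3}

/-- The class of compactly supported `C¹` functions on `ℝ³`. -/
def compactC1 : Set (E3 → ℝ) := {φ | ContDiff ℝ 1 φ ∧ HasCompactSupport φ}

/-- Compactly supported functions are controlled in `L²_loc` of the closed exterior domain by the
`L²` norm of their gradients over the domain. -/
theorem controlledAt_compactC1 (hΩ : ∀ i, IsSmoothBoundedDomain (Ω i))
    (hdisj : ∀ i j, i ≠ j → Disjoint (closure (Ω i)) (closure (Ω j)))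
    (hconn : IsConnected (exterior Ω)) (x : E3) :
    ControlledAt (exterior Ω) compactC1 (fun φ => ∫⁻ y in exterior Ω, ‖fderiv ℝ φ y‖ₑ ^ 2) x := by
  obtain ⟨R, hR, hU⟩ := exists_norm_ge_mem_exterior hΩ
  set x₀ : E3 := EuclideanSpace.single 0 (R + 1) with hx₀
  have hx₀n : ‖x₀‖ = R + 1 := by
    rw [hx₀, PiLp.norm_single, Real.norm_of_nonneg (by linarith)]
  have hball : ∀ y ∈ Metric.ball x₀ 1, R ≤ ‖y‖ := by
    intro y hy
    have h1 : ‖y - x₀‖ < 1 := by simpa [dist_eq_norm] using hy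
    have h2 := norm_sub_norm_le x₀ y
    rw [norm_sub_rev] at h2
    linarith
  obtain ⟨C, hC⟩ := exists_lintegral_sq_le_of_rays (isOpen_exterior Ω)
    (S := Metric.ball x₀ 1) Metric.isBounded_ball measurableSet_ball
    (fun y hy t ht => hU _ (by
      rw [norm_smul, Real.norm_of_nonneg (by linarith)]
      nlinarith [hball y hy, norm_nonneg y]))
    (fun h => by have := hball 0 h; rw [norm_zero] at this; linarith)
  refine controlledAt_exterior hΩ hdisj hconn (fun f hf => hf.1.contDiffOn) (fun f _ => le_rfl)
    (hU x₀ (by linarith)) ⟨1, one_pos, C, fun f hf => ?_⟩ x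
  exact (lintegral_mono_set inter_subset_right).trans (hC f hf.1 hf.2)

/-- Dirichlet bound: on bounded parts of the exterior domain, the `L²` norm is controlled by the `L²`
norm of the gradient over the whole domain. -/
theorem exists_lintegral_sq_le (hΩ : ∀ i, IsSmoothBoundedDomain (Ω i))
    (hdisj : ∀ i j, i ≠ j → Disjoint (closure (Ω i)) (closure (Ω j)))
    (hconn : IsConnected (exterior Ω)) {K : Set E3} (hK : Bornology.IsBounded K) :
    ∃ C : ℝ≥0, ∀ φ : E3 → ℝ, ContDiff ℝ 1 φ → HasCompactSupport φ →
      ∫⁻ y in exterior Ω ∩ K, ‖φ y‖ₑ ^ 2 ≤ C * ∫⁻ y in exterior Ω, ‖fderiv ℝ φ y‖ₑ ^ 2 := by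
  obtain ⟨C, hC⟩ := ControlledAt.of_isCompact (K := closure K) hK.isCompact_closure
    fun x _ => controlledAt_compactC1 hΩ hdisj hconn x
  exact ⟨C, fun φ h1 h2 => (lintegral_mono_set (inter_subset_inter_right _ subset_closure)).trans
    (hC φ ⟨h1, h2⟩)⟩

/-! ### The trace inequality -/

theorem lintegral_line_eq {H : E3 → ℝ≥0∞} (k : Fin 3) {σ : ℝ} (hσ : |σ| = 1) (y : E3) :
    ∫⁻ t : ℝ, H (y + t • EuclideanSpace.single k σ)
      = ∫⁻ t : ℝ, H (y + t • EuclideanSpace.single k (1 : ℝ)) := by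
  rcases (abs_eq zero_le_one).1 hσ with rfl | rfl
  · rfl
  · rw [← lintegral_neg_eq_self]
    refine lintegral_congr fun t => ?_
    congr 2
    ext j
    by_cases hj : j = k <;> simp [hj]

/-- Trace inequality: the `L²` norm over the boundary is controlled by the `L²` norm of the gradient
over the exterior domain. -/
theorem exists_lintegral_frontier_sq_le (hΩ : ∀ i, IsSmoothBoundedDomain (Ω i))
    (hdisj : ∀ i j, i ≠ j → Disjoint (closure (Ω i)) (closure (Ω j)))
    (hconn : IsConnected (exterior Ω)) (i : Fin N) :
    ∃ C : ℝ≥0, ∀ φ : E3 → ℝ, ContDiff ℝ 1 φ → HasCompactSupport φ →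
      ∫⁻ y in frontier (Ω i), ‖φ y‖ₑ ^ 2 ∂(μHE[2] : Measure E3)
        ≤ C * ∫⁻ y in exterior Ω, ‖fderiv ℝ φ y‖ₑ ^ 2 := by
  have hUm : MeasurableSet (exterior Ω) := (isOpen_exterior Ω).measurableSet
  suffices h : ∃ C : ℝ≥0, ∀ φ : E3 → ℝ, ContDiff ℝ 1 φ → HasCompactSupport φ →
      ∫⁻ y in frontier (Ω i) ∩ frontier (Ω i), ‖φ y‖ₑ ^ 2 ∂(μHE[2] : Measure E3)
        ≤ C * ∫⁻ y in exterior Ω, ‖fderiv ℝ φ y‖ₑ ^ 2 by rwa [inter_self] at h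
  refine (hΩ i).isCompact_frontier.induction_on (p := fun K => ∃ C : ℝ≥0, ∀ φ : E3 → ℝ,
    ContDiff ℝ 1 φ → HasCompactSupport φ →
      ∫⁻ y in frontier (Ω i) ∩ K, ‖φ y‖ₑ ^ 2 ∂(μHE[2] : Measure E3)
        ≤ C * ∫⁻ y in exterior Ω, ‖fderiv ℝ φ y‖ₑ ^ 2) ⟨0, by simp⟩ ?_ ?_ ?_
  · rintro s t hst ⟨C, hC⟩
    exact ⟨C, fun f hf hc =>
      (lintegral_mono_set (inter_subset_inter_right _ hst)).trans (hC f hf hc)⟩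
  · rintro s t ⟨C, hC⟩ ⟨D, hD⟩
    refine ⟨C + D, fun f hf hc => ?_⟩
    rw [inter_union_distrib_left]
    refine (lintegral_union_le _ _ _).trans ?_
    push_cast
    rw [add_mul]
    exact add_le_add (hC f hf hc) (hD f hf hc)
  · intro x hx
    obtain ⟨k, σ, r, δ, K, hr, hδ, hσ, h1, h2⟩ := exists_exterior_chart hΩ hdisj hx
    obtain ⟨C₁, hC₁⟩ := exists_lintegral_surface_line_le h2
    obtain ⟨C₂, hC₂⟩ := exists_lintegral_sq_le hΩ hdisj hconn
      (Metric.isBounded_ball (x := x) (r := r + δ))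
    set D : ℝ≥0 := δ.toNNReal with hD
    have hD0 : (D : ℝ≥0∞) ≠ 0 := by simpa [hD] using hδ
    have hDδ : (D : ℝ≥0∞) = ENNReal.ofReal δ := rfl
    refine ⟨Metric.ball x r, mem_nhdsWithin_of_mem_nhds (Metric.ball_mem_nhds x hr),
      D⁻¹ * (C₁ * (2 * C₂ + 2 * D ^ 2)), fun φ hφ hc => ?_⟩
    set d : E3 := EuclideanSpace.single k σ with hd
    have hdn : ‖d‖ₑ = 1 := by
      rw [← ofReal_norm]; simp [hd, hσ]
    have hfc : Continuous (fderiv ℝ φ) := hφ.continuous_fderiv (by simp)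
    set T := exterior Ω ∩ Metric.ball x (r + δ) with hT
    have hTm : MeasurableSet T := hUm.inter measurableSet_ball
    set H : E3 → ℝ≥0∞ := T.indicator fun z => 2 * ‖φ z‖ₑ ^ 2 + 2 * D ^ 2 * ‖fderiv ℝ φ z‖ₑ ^ 2 with hH
    have hφm : Measurable fun z => 2 * ‖φ z‖ₑ ^ 2 :=
      (hφ.continuous.measurable.enorm.pow_const 2).const_mul _
    have hφd : ∀ y, Measurable fun t : ℝ => 2 * ‖φ (y + t • d)‖ₑ ^ 2 := fun y =>
      hφm.comp (by fun_prop)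
    have hHm : Measurable H :=
      (hφm.add ((hfc.measurable.enorm.pow_const 2).const_mul _)).indicator hTm
    set S := frontier (Ω i) ∩ Metric.ball x r with hS
    have hSm : MeasurableSet S := isClosed_frontier.measurableSet.inter measurableSet_ball
    have hyT : ∀ y ∈ S, ∀ t ∈ Ioc (0 : ℝ) δ, y + t • d ∈ T := by
      intro y hy t ht
      have hyf := hy.1
      rw [(hΩ i).isOpen.frontier_eq] at hyf
      refine ⟨h1 y hy.2 hyf.2 t ht, ?_⟩
      have hdn' : ‖d‖ = 1 := by simp [hd, hσ]
      have h3 : ‖y - x‖ < r := by simpa [dist_eq_norm] using hy.2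
      rw [Metric.mem_ball, dist_eq_norm]
      calc ‖y + t • d - x‖ = ‖(y - x) + t • d‖ := by congr 1; abel
        _ ≤ ‖y - x‖ + ‖t • d‖ := norm_add_le _ _
        _ = ‖y - x‖ + t := by rw [norm_smul, hdn', mul_one, Real.norm_of_nonneg ht.1.le]
        _ < r + δ := by linarith [ht.2]
    -- average `φ y = φ (y + t d) - (φ (y + t d) - φ y)` over `0 < t ≤ δ`
    have hpt : ∀ y ∈ S, D * ‖φ y‖ₑ ^ 2 ≤ ∫⁻ t : ℝ, H (y + t • EuclideanSpace.single k (1 : ℝ)) := by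
      intro y hy
      set J := ∫⁻ s in Ioc (0 : ℝ) δ, ‖fderiv ℝ φ (y + s • d)‖ₑ ^ 2 with hJ
      have hdiff : ∀ t ∈ Ioc (0 : ℝ) δ, ‖φ (y + t • d) - φ y‖ₑ ^ 2 ≤ D * J := by
        intro t ht
        have h3 := enorm_sub_le_lintegral_segment isOpen_univ hφ.contDiffOn (y := y) (h := d)
          ht.1.le fun _ _ => mem_univ _
        simp only [zero_smul, add_zero, hdn, indicator_univ, one_mul] at h3
        have h4 := h3.trans (lintegral_mono_set (Ioc_subset_Ioc_right ht.2))
        refine (pow_le_pow_left' h4 2).trans ((sq_lintegral_le _ ?_).trans ?_)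
        · exact (hfc.comp (by fun_prop)).measurable.enorm.aemeasurable
        · simp [hDδ, hJ]
      have hle : ∀ t ∈ Ioc (0 : ℝ) δ, ‖φ y‖ₑ ^ 2 ≤ 2 * ‖φ (y + t • d)‖ₑ ^ 2 + 2 * (D * J) := by
        intro t ht
        refine le_trans ?_ (add_le_add le_rfl (mul_le_mul_right (hdiff t ht) 2))
        refine le_trans (pow_le_pow_left' ?_ 2) (ennreal_add_sq_le _ _)
        calc ‖φ y‖ₑ = ‖φ (y + t • d) - (φ (y + t • d) - φ y)‖ₑ := by congr 1; ring
          _ ≤ _ := enorm_sub_le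
      calc D * ‖φ y‖ₑ ^ 2 = ∫⁻ t in Ioc (0 : ℝ) δ, ‖φ y‖ₑ ^ 2 := by simp [hDδ, mul_comm]
        _ ≤ ∫⁻ t in Ioc (0 : ℝ) δ, (2 * ‖φ (y + t • d)‖ₑ ^ 2 + 2 * (D * J)) :=
          setLIntegral_mono' measurableSet_Ioc hle
        _ = (∫⁻ t in Ioc (0 : ℝ) δ, 2 * ‖φ (y + t • d)‖ₑ ^ 2)
            + ∫⁻ t in Ioc (0 : ℝ) δ, 2 * D ^ 2 * ‖fderiv ℝ φ (y + t • d)‖ₑ ^ 2 := by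
          rw [lintegral_add_left (hφd y), setLIntegral_const,
            lintegral_const_mul' (2 * (D : ℝ≥0∞) ^ 2) _ (by simp [ENNReal.mul_eq_top])]
          congr 1
          simp only [Real.volume_Ioc, sub_zero, ← hDδ, ← hJ]
          ring
        _ = ∫⁻ t in Ioc (0 : ℝ) δ, H (y + t • d) := by
          rw [← lintegral_add_left (hφd y)]
          refine setLIntegral_congr_fun measurableSet_Ioc fun t ht => ?_
          simp only [hH, indicator_of_mem (hyT y hy t ht)]
        _ ≤ ∫⁻ t : ℝ, H (y + t • d) := setLIntegral_le_lintegral _ _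
        _ = _ := lintegral_line_eq k hσ y
    have hfin : D * ∫⁻ y in S, ‖φ y‖ₑ ^ 2 ∂(μHE[2] : Measure E3)
        ≤ C₁ * (2 * C₂ + 2 * D ^ 2) * ∫⁻ y in exterior Ω, ‖fderiv ℝ φ y‖ₑ ^ 2 := by
      calc D * ∫⁻ y in S, ‖φ y‖ₑ ^ 2 ∂(μHE[2] : Measure E3)
          = ∫⁻ y in S, D * ‖φ y‖ₑ ^ 2 ∂(μHE[2] : Measure E3) :=
            (lintegral_const_mul' _ _ ENNReal.coe_ne_top).symm
        _ ≤ _ := setLIntegral_mono' hSm hpt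
        _ ≤ _ := hC₁ H hHm
        _ = C₁ * (2 * (∫⁻ y in T, ‖φ y‖ₑ ^ 2) + 2 * D ^ 2 * ∫⁻ y in T, ‖fderiv ℝ φ y‖ₑ ^ 2) := by
            rw [hH, lintegral_indicator hTm, lintegral_add_left hφm,
              lintegral_const_mul' _ _ (by simp), lintegral_const_mul' _ _ (by simp [ENNReal.mul_eq_top])]
        _ ≤ C₁ * (2 * (C₂ * ∫⁻ y in exterior Ω, ‖fderiv ℝ φ y‖ₑ ^ 2)
              + 2 * D ^ 2 * ∫⁻ y in exterior Ω, ‖fderiv ℝ φ y‖ₑ ^ 2) := by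
            gcongr
            · exact hC₂ φ hφ hc
            · exact inter_subset_left
        _ = _ := by ring
    have hDinv : ((D⁻¹ : ℝ≥0) : ℝ≥0∞) = (D : ℝ≥0∞)⁻¹ := ENNReal.coe_inv (by simpa using hD0)
    calc ∫⁻ y in S, ‖φ y‖ₑ ^ 2 ∂(μHE[2] : Measure E3)
        = (D : ℝ≥0∞)⁻¹ * (D * ∫⁻ y in S, ‖φ y‖ₑ ^ 2 ∂(μHE[2] : Measure E3)) := by
          rw [← mul_assoc, ENNReal.inv_mul_cancel hD0 ENNReal.coe_ne_top, one_mul]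
      _ ≤ (D : ℝ≥0∞)⁻¹ * (C₁ * (2 * C₂ + 2 * D ^ 2) * ∫⁻ y in exterior Ω, ‖fderiv ℝ φ y‖ₑ ^ 2) := by
          gcongr
      _ = _ := by
          push_cast
          rw [hDinv]
          ring

end Exterior

/-! ### Gradients of test functions -/

theorem norm_gradient (f : E3 → ℝ) (x : E3) : ‖∇ f x‖ = ‖fderiv ℝ f x‖ :=
  (InnerProductSpace.toDual ℝ E3).symm.norm_map _

theorem enorm_gradient (f : E3 → ℝ) (x : E3) : ‖∇ f x‖ₑ = ‖fderiv ℝ f x‖ₑ := by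
  rw [← ofReal_norm, norm_gradient, ofReal_norm]

theorem inner_gradient_left (f : E3 → ℝ) (x v : E3) : ⟪∇ f x, v⟫_ℝ = fderiv ℝ f x v := by
  simp [gradient]

theorem continuous_gradient {f : E3 → ℝ} (hf : ContDiff ℝ 1 f) : Continuous (∇ f) :=
  (InnerProductSpace.toDual ℝ E3).symm.continuous.comp (hf.continuous_fderiv (by simp))

theorem _root_.HasCompactSupport.gradient {f : E3 → ℝ} (hf : HasCompactSupport f) :
    HasCompactSupport (∇ f) :=
  (hf.fderiv (𝕜 := ℝ)).comp_left (g := (InnerProductSpace.toDual ℝ E3).symm) (by simp)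

theorem memLp_gradient (U : Set E3) {f : E3 → ℝ} (hf : ContDiff ℝ 1 f) (hc : HasCompactSupport f) :
    MemLp (∇ f) 2 (volume.restrict U) :=
  ((continuous_gradient hf).memLp_of_hasCompactSupport hc.gradient (μ := volume)).restrict U

/-- The space `C_c^∞(ℝ³)`. -/
def testFunctions : Submodule ℝ (E3 → ℝ) where
  carrier := {φ | ContDiff ℝ ∞ φ ∧ HasCompactSupport φ}
  zero_mem' := ⟨contDiff_const, HasCompactSupport.zero⟩
  add_mem' := fun h₁ h₂ => ⟨h₁.1.add h₂.1, h₁.2.add h₂.2⟩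
  smul_mem' := fun c _ h => ⟨h.1.const_smul c, h.2.comp_left (g := fun y => c • y) (smul_zero c)⟩

theorem testFunctions.contDiff_one (φ : testFunctions) : ContDiff ℝ 1 (φ : E3 → ℝ) :=
  φ.2.1.of_le (by simp)

theorem testFunctions.differentiable (φ : testFunctions) : Differentiable ℝ (φ : E3 → ℝ) :=
  (testFunctions.contDiff_one φ).differentiable (by simp)

/-- The map `φ ↦ ∇φ|_U` from test functions on `ℝ³` to `L²(U)`. -/
noncomputable def gradTest (U : Set E3) : testFunctions →ₗ[ℝ] VecL2 U where
  toFun φ := (memLp_gradient U (testFunctions.contDiff_one φ) φ.2.2).toLp (∇ (φ : E3 → ℝ))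
  map_add' φ ψ := by
    rw [← MemLp.toLp_add]
    refine MemLp.toLp_congr _ _ (Eventually.of_forall fun x => ?_)
    simp [gradient, fderiv_add (testFunctions.differentiable φ x) (testFunctions.differentiable ψ x)]
  map_smul' c φ := by
    rw [RingHom.id_apply, ← MemLp.toLp_const_smul]
    refine MemLp.toLp_congr _ _ (Eventually.of_forall fun x => ?_)
    simp [gradient, fderiv_const_smul (testFunctions.differentiable φ x)]

theorem coeFn_gradTest (U : Set E3) (φ : testFunctions) :
    gradTest U φ =ᵐ[volume.restrict U] ∇ (φ : E3 → ℝ) :=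
  (memLp_gradient U (testFunctions.contDiff_one φ) φ.2.2).coeFn_toLp

theorem inner_gradTest {U : Set E3} (φ : testFunctions) (w : VecL2 U) :
    ⟪gradTest U φ, w⟫_ℝ = ∫ x in U, ⟪w x, ∇ (φ : E3 → ℝ) x⟫_ℝ := by
  rw [L2.inner_def]
  refine integral_congr_ae ?_
  filter_upwards [coeFn_gradTest U φ] with x hx
  rw [hx, real_inner_comm]

theorem enorm_sq_vecL2 {U : Set E3} (w : VecL2 U) : ‖w‖ₑ ^ 2 = ∫⁻ x in U, ‖w x‖ₑ ^ 2 := by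
  have := eLpNorm_nnreal_pow_eq_lintegral (f := w) (μ := volume.restrict U) (p := 2) (by norm_num)
  rw [Lp.enorm_def]
  simpa using this

theorem enorm_sq_gradTest (U : Set E3) (φ : testFunctions) :
    ‖gradTest U φ‖ₑ ^ 2 = ∫⁻ x in U, ‖fderiv ℝ (φ : E3 → ℝ) x‖ₑ ^ 2 := by
  rw [enorm_sq_vecL2]
  refine lintegral_congr_ae ?_
  filter_upwards [coeFn_gradTest U φ] with x hx
  rw [hx, enorm_gradient]

section Exterior
variable {N : ℕ} {Ω : Fin N → Set E3}

theorem HasNormalTrace.isDivFree {w : VecL2 (exterior Ω)} {g : Fin N → E3 → ℝ}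
    (h : HasNormalTrace Ω w g) : IsDivFree w := by
  intro φ hφ hc hU
  rw [h.2 φ hφ hc, neg_eq_zero]
  refine Finset.sum_eq_zero fun i _ => ?_
  rw [setIntegral_congr_fun (g := fun _ => (0 : ℝ)) isClosed_frontier.measurableSet, integral_zero]
  intro x hx
  have : φ x = 0 := image_eq_zero_of_notMem_tsupport fun hxs =>
    notMem_of_mem_exterior (hU hxs) i (frontier_subset_closure hx)
  simp [this]

/-- `L²_σ(U)` is the orthogonal complement of the gradients of test functions. -/
theorem L2sigma_eq_orthogonal (Ω : Fin N → Set E3) :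
    L2sigma Ω = (LinearMap.range (gradTest (exterior Ω)))ᗮ := by
  ext w
  rw [Submodule.mem_orthogonal]
  constructor
  · rintro ⟨-, h⟩ _ ⟨φ, rfl⟩
    rw [inner_gradTest, h.2 φ φ.2.1 φ.2.2]
    simp
  · intro h
    have ht : HasNormalTrace Ω w (fun _ _ => 0) := by
      refine ⟨fun _ => integrableOn_zero, fun φ hφ hc => ?_⟩
      have := h _ ⟨⟨φ, hφ, hc⟩, rfl⟩
      rw [inner_gradTest] at this
      simpa using this
    exact ⟨ht.isDivFree, ht⟩

theorem L2sigma_orthogonal (Ω : Fin N → Set E3) :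
    (L2sigma Ω)ᗮ = (LinearMap.range (gradTest (exterior Ω))).topologicalClosure := by
  rw [L2sigma_eq_orthogonal, Submodule.orthogonal_orthogonal_eq_closure]

theorem isClosed_L2sigma (Ω : Fin N → Set E3) : IsClosed (L2sigma Ω : Set (VecL2 (exterior Ω))) := by
  rw [L2sigma_eq_orthogonal]
  exact Submodule.isClosed_orthogonal _

end Exterior

/-! ### Existence of fields with prescribed normal trace -/

/-- Riesz representation of a linear functional that is bounded with respect to the seminorm
`‖T ·‖`, by an element of the closure of the range of `T`. -/
theorem exists_mem_closure_range_inner_eq {X H : Type*} [AddCommGroup X] [Module ℝ X]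
    [NormedAddCommGroup H] [InnerProductSpace ℝ H] [CompleteSpace H] (T : X →ₗ[ℝ] H) (l : X →ₗ[ℝ] ℝ)
    {C : ℝ} (hC : ∀ x, |l x| ≤ C * ‖T x‖) :
    ∃ w ∈ (LinearMap.range T).topologicalClosure, ∀ x, ⟪T x, w⟫_ℝ = l x := by
  have hker : LinearMap.ker T ≤ LinearMap.ker l := by
    intro x hx
    rw [LinearMap.mem_ker] at hx ⊢
    have := hC x
    rw [hx, norm_zero, mul_zero] at this
    exact abs_nonpos_iff.1 this
  set f : LinearMap.range T →ₗ[ℝ] ℝ :=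
    (Submodule.liftQ (LinearMap.ker T) l hker).comp T.quotKerEquivRange.symm.toLinearMap with hf
  have hfT : ∀ x, f ⟨T x, x, rfl⟩ = l x := fun x => by
    simp only [hf, LinearMap.comp_apply, LinearEquiv.coe_coe]
    rw [LinearMap.quotKerEquivRange_symm_apply_image T x ⟨x, rfl⟩]
    simp
  obtain ⟨g, hg, -⟩ := exists_extension_norm_eq (LinearMap.range T)
    (f.mkContinuous C (by
      rintro ⟨_, x, rfl⟩
      rw [hfT]
      exact hC x))
  set K := (LinearMap.range T).topologicalClosure with hK
  have hKc : IsClosed (K : Set H) := Submodule.isClosed_topologicalClosure _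
  have : CompleteSpace K := hKc.completeSpace_coe
  set w₀ := (InnerProductSpace.toDual ℝ H).symm g with hw₀
  refine ⟨K.starProjection w₀, Submodule.starProjection_apply_mem _ _, fun x => ?_⟩
  have hxK : T x ∈ K := Submodule.le_topologicalClosure _ ⟨x, rfl⟩
  have h1 : ⟪w₀ - K.starProjection w₀, T x⟫_ℝ = 0 := Submodule.starProjection_inner_eq_zero _ _ hxK
  rw [inner_sub_left, sub_eq_zero] at h1
  rw [real_inner_comm, ← h1, hw₀, InnerProductSpace.toDual_symm_apply]
  have h2 := hg ⟨T x, x, rfl⟩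
  rw [LinearMap.mkContinuous_apply, hfT] at h2
  exact h2

theorem abs_le_of_enorm_sq_le {H : Type*} [NormedAddCommGroup H] {a : ℝ} {b : H} {K : ℝ≥0}
    (h : ‖a‖ₑ ^ 2 ≤ K * ‖b‖ₑ ^ 2) : |a| ≤ Real.sqrt K * ‖b‖ := by
  rw [enorm_eq_nnnorm, enorm_eq_nnnorm] at h
  norm_cast at h
  have h' : |a| ^ 2 ≤ K * ‖b‖ ^ 2 := by exact_mod_cast h
  refine abs_le_of_sq_le_sq' ?_ (by positivity) |>.2
  rw [mul_pow, Real.sq_sqrt K.coe_nonneg]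
  exact h'

section Exterior
variable {N : ℕ} {Ω : Fin N → Set E3}

theorem integrableOn_dilData (hΩ : ∀ i, IsSmoothBoundedDomain (Ω i)) (s : Fin N → ℝ) (v : Fin N → E3)
    (i : Fin N) : IntegrableOn (dilData Ω s v i) (frontier (Ω i)) μHE[2] :=
  (hΩ i).integrableOn_dilData (s i) (v i)

theorem abs_dilData_le (s : Fin N → ℝ) (v : Fin N → E3) (i : Fin N) (x : E3) :
    ‖dilData Ω s v i x‖ ≤ |s i| + ‖v i‖ := by
  refine (norm_add_le _ _).trans (add_le_add le_rfl ((norm_inner_le_norm _ _).trans ?_))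
  exact mul_le_of_le_one_right (norm_nonneg _) (IsSmoothBoundedDomain.norm_outwardNormal_le _ x)

theorem integrable_dilData_mul (hΩ : ∀ i, IsSmoothBoundedDomain (Ω i)) (s : Fin N → ℝ)
    (v : Fin N → E3) (i : Fin N) (φ : testFunctions) :
    Integrable (fun x => dilData Ω s v i x * (φ : E3 → ℝ) x)
      ((μHE[2] : Measure E3).restrict (frontier (Ω i))) := by
  obtain ⟨C, hC⟩ := φ.2.1.continuous.bounded_above_of_compact_support φ.2.2
  exact (integrableOn_dilData hΩ s v i).mul_bdd (c := C) φ.2.1.continuous.aestronglyMeasurable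
    (Filter.Eventually.of_forall hC)

/-- For all data `s i + v i · n` there is a field in the closure of the gradients of test functions
with this normal trace. -/
theorem exists_hasNormalTrace_dilData (hΩ : ∀ i, IsSmoothBoundedDomain (Ω i))
    (hdisj : ∀ i j, i ≠ j → Disjoint (closure (Ω i)) (closure (Ω j)))
    (hconn : IsConnected (exterior Ω)) (s : Fin N → ℝ) (v : Fin N → E3) :
    ∃ w ∈ (L2sigma Ω)ᗮ, HasNormalTrace Ω w (dilData Ω s v) := by
  have hbound : ∀ i, ∃ C : ℝ, ∀ φ : testFunctions,
      |∫ x in frontier (Ω i), dilData Ω s v i x * (φ : E3 → ℝ) x ∂μHE[2]|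
        ≤ C * ‖gradTest (exterior Ω) φ‖ := by
    intro i
    obtain ⟨C, hC⟩ := exists_lintegral_frontier_sq_le hΩ hdisj hconn i
    set M : ℝ≥0∞ := ENNReal.ofReal (|s i| + ‖v i‖) ^ 2 * (μHE[2] : Measure E3) (frontier (Ω i)) with hM
    have hMt : M ≠ ⊤ := ENNReal.mul_ne_top (ENNReal.pow_ne_top ENNReal.ofReal_ne_top)
      (hΩ i).surface_measure_lt_top.ne
    refine ⟨Real.sqrt ((M.toNNReal * C : ℝ≥0) : ℝ), fun φ => abs_le_of_enorm_sq_le ?_⟩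
    have hg : AEMeasurable (fun x => ‖dilData Ω s v i x‖ₑ)
        ((μHE[2] : Measure E3).restrict (frontier (Ω i))) :=
      (integrableOn_dilData hΩ s v i).aestronglyMeasurable.enorm
    calc ‖∫ x in frontier (Ω i), dilData Ω s v i x * (φ : E3 → ℝ) x ∂μHE[2]‖ₑ ^ 2
        ≤ (∫⁻ x in frontier (Ω i), ‖dilData Ω s v i x‖ₑ * ‖(φ : E3 → ℝ) x‖ₑ ∂(μHE[2] : Measure E3)) ^ 2 := by
          refine pow_le_pow_left' ((enorm_integral_le_lintegral_enorm _).trans (le_of_eq ?_)) 2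
          simp only [enorm_mul]
      _ ≤ (∫⁻ x in frontier (Ω i), ‖dilData Ω s v i x‖ₑ ^ 2 ∂(μHE[2] : Measure E3)) *
            ∫⁻ x in frontier (Ω i), ‖(φ : E3 → ℝ) x‖ₑ ^ 2 ∂(μHE[2] : Measure E3) :=
          sq_lintegral_mul_le _ hg φ.2.1.continuous.measurable.enorm.aemeasurable
      _ ≤ M * (C * ‖gradTest (exterior Ω) φ‖ₑ ^ 2) := by
          gcongr
          · rw [hM, ← setLIntegral_const]
            refine lintegral_mono fun x => ?_
            gcongr
            rw [← ofReal_norm]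
            exact ENNReal.ofReal_le_ofReal (abs_dilData_le s v i x)
          · rw [enorm_sq_gradTest]
            exact hC φ (testFunctions.contDiff_one φ) φ.2.2
      _ = _ := by
          push_cast
          rw [ENNReal.coe_toNNReal hMt]
          exact (mul_assoc _ _ _).symm
  choose C hC using hbound
  set l : testFunctions →ₗ[ℝ] ℝ :=
    { toFun := fun φ => -∑ i, ∫ x in frontier (Ω i), dilData Ω s v i x * (φ : E3 → ℝ) x ∂μHE[2]
      map_add' := fun φ ψ => by
        rw [← neg_add, ← Finset.sum_add_distrib]
        congr 1
        refine Finset.sum_congr rfl fun i _ => ?_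
        rw [← integral_add (integrable_dilData_mul hΩ s v i φ) (integrable_dilData_mul hΩ s v i ψ)]
        simp only [Submodule.coe_add, Pi.add_apply, mul_add]
      map_smul' := fun c φ => by
        rw [RingHom.id_apply, smul_eq_mul, mul_neg, Finset.mul_sum]
        congr 1
        refine Finset.sum_congr rfl fun i _ => ?_
        rw [← integral_const_mul]
        simp only [Submodule.coe_smul, Pi.smul_apply, smul_eq_mul, mul_left_comm] } with hl
  obtain ⟨w, hw, hwl⟩ := exists_mem_closure_range_inner_eq (gradTest (exterior Ω)) l
    (C := ∑ i, C i) (fun φ => by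
      simp only [hl, LinearMap.coe_mk, AddHom.coe_mk, abs_neg]
      refine (Finset.abs_sum_le_sum_abs _ _).trans ?_
      rw [Finset.sum_mul]
      exact Finset.sum_le_sum fun i _ => hC i φ)
  refine ⟨w, by rw [L2sigma_orthogonal]; exact hw, integrableOn_dilData hΩ s v, fun φ hφ hc => ?_⟩
  have := hwl ⟨φ, hφ, hc⟩
  rw [inner_gradTest] at this
  simpa [hl] using this

/-! ### The data are determined by the field -/

/-- At a boundary point where the linear function `⟪v, ·⟫` is maximal on the domain, `v` is a
nonnegative multiple of the outward normal. -/
theorem exists_mem_frontier_inner_normal {Ω : Set E3} (hΩ : IsSmoothBoundedDomain Ω) (v : E3) :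
    ∃ x ∈ frontier Ω, ⟪v, outwardNormal Ω x⟫_ℝ = ‖v‖ := by
  have hcomp : IsCompact (closure Ω) := hΩ.isBounded.isCompact_closure
  obtain ⟨x, hxf, hmax⟩ : ∃ x ∈ frontier Ω, ∀ y ∈ Ω, ⟪v, y⟫_ℝ ≤ ⟪v, x⟫_ℝ := by
    by_cases hv : v = 0
    · have hne : (frontier Ω).Nonempty := by
        rw [nonempty_frontier_iff]
        refine ⟨hΩ.isConnected.nonempty, fun h => ?_⟩
        have := hΩ.isBounded
        rw [h] at this
        exact NormedSpace.unbounded_univ ℝ E3 this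
      obtain ⟨x, hx⟩ := hne
      exact ⟨x, hx, by simp [hv]⟩
    obtain ⟨x, hx, hmax⟩ := hcomp.exists_isMaxOn hΩ.isConnected.nonempty.closure
      (f := fun y => ⟪v, y⟫_ℝ) (by fun_prop)
    refine ⟨x, ?_, fun y hy => hmax (subset_closure hy)⟩
    rw [hΩ.isOpen.frontier_eq]
    refine ⟨hx, fun hxΩ => ?_⟩
    -- an interior point is not a maximum point, as moving along `v` increases the linear function
    have h1 : Tendsto (fun t : ℝ => x + t • v) (𝓝[>] 0) (𝓝 x) := by
      have : Continuous fun t : ℝ => x + t • v := by fun_prop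
      simpa using (this.tendsto 0).mono_left (nhdsWithin_le_nhds (s := Ioi 0))
    obtain ⟨t, ht1, ht2⟩ := ((h1.eventually (hΩ.isOpen.mem_nhds hxΩ)).and self_mem_nhdsWithin).exists
    have h2 := hmax (subset_closure ht1)
    simp only [mem_ofPred_eq, inner_add_right, real_inner_smul_right, real_inner_self_eq_norm_sq] at h2
    have h3 : 0 < t * ‖v‖ ^ 2 := mul_pos ht2 (by positivity)
    linarith
  refine ⟨x, hxf, ?_⟩
  obtain ⟨ρ, hρ⟩ := hΩ.smooth_boundary x hxf
  obtain ⟨hd, h0, hi⟩ := hρ.basic hxf hΩ.isOpen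
  have hn := outwardNormal_eq hΩ.isOpen hxf hρ
  obtain ⟨-, -, -, -, -, hne⟩ := hρ
  set n := outwardNormal Ω x with hndef
  have hn1 : ‖n‖ = 1 := by rw [hn]; exact norm_smul_inv_norm (𝕜 := ℝ) hne
  have hnρ : ∇ ρ x = ‖∇ ρ x‖ • n := by
    rw [hn, smul_smul, mul_inv_cancel₀ (norm_ne_zero_iff.2 hne), one_smul]
  -- directions pointing into the domain do not increase the linear function `⟪v, ·⟫`
  have hdir : ∀ d : E3, ⟪n, d⟫_ℝ < 0 → ⟪v, d⟫_ℝ ≤ 0 := by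
    intro d hdn
    have hneg : ∇ (-ρ) x = -∇ ρ x := by
      have : HasGradientAt (-ρ) (-∇ ρ x) x := by
        rw [hasGradientAt_iff_hasFDerivAt, map_neg]
        exact hd.hasGradientAt.hasFDerivAt.neg
      exact this.gradient
    have e1 := line_sign hd.neg (d := d) (by simp [h0]) (by
      rw [hneg, hnρ, inner_neg_left, real_inner_smul_left]
      have := mul_neg_of_pos_of_neg (norm_pos_iff.2 hne) hdn
      linarith)
    have hcont : Tendsto (fun t : ℝ => x + t • d) (𝓝[>] 0) (𝓝 x) := by
      have : Continuous fun t : ℝ => x + t • d := by fun_prop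
      simpa using (this.tendsto 0).mono_left (nhdsWithin_le_nhds (s := Ioi 0))
    obtain ⟨t, ht1, ht2, ht3⟩ := (e1.and ((hcont.eventually hi).and self_mem_nhdsWithin)).exists
    have h2 := hmax _ (ht2.2 (neg_pos.1 ht1))
    rw [inner_add_right, real_inner_smul_right] at h2
    have ht3' : (0 : ℝ) < t := ht3
    by_contra hcon
    have := mul_pos ht3' (not_le.1 hcon)
    linarith
  have hle : ⟪v, n⟫_ℝ ≤ ‖v‖ := by
    have := real_inner_le_norm v n
    rwa [hn1, mul_one] at this
  refine le_antisymm hle (le_of_not_gt fun hlt => ?_)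
  have hv0 : 0 < ‖v‖ := by
    rcases (norm_nonneg v).eq_or_lt with h | h
    · rw [norm_eq_zero.1 h.symm] at hlt; simp at hlt
    · exact h
  have h1 := hdir (v - ‖v‖ • n) (by
    rw [inner_sub_right, real_inner_smul_right, real_inner_self_eq_norm_sq, hn1, real_inner_comm]
    linarith)
  rw [inner_sub_right, real_inner_smul_right, real_inner_self_eq_norm_sq] at h1
  nlinarith

/-- The constants `s i`, `v i` are determined by the normal trace. -/
theorem eq_zero_of_hasNormalTrace_zero (hΩ : ∀ i, IsSmoothBoundedDomain (Ω i))
    (hdisj : ∀ i j, i ≠ j → Disjoint (closure (Ω i)) (closure (Ω j)))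
    {s : Fin N → ℝ} {v : Fin N → E3} (h : HasNormalTrace Ω 0 (dilData Ω s v)) : s = 0 ∧ v = 0 := by
  -- the data vanish almost everywhere, hence everywhere by continuity
  have hzero : ∀ i, ∀ x ∈ frontier (Ω i), dilData Ω s v i x = 0 := by
    intro i
    set μ := (μHE[2] : Measure E3).restrict (frontier (Ω i)) with hμ
    set g := dilData Ω s v i with hg
    have hae : ∀ᵐ x ∂μ, x ∈ (⋃ j ∈ {j | j ≠ i}, closure (Ω j))ᶜ → g x = 0 := by
      refine (isOpen_compl_other Ω i).ae_eq_zero_of_integral_contDiff_smul_eq_zero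
        ((integrableOn_dilData hΩ s v i).locallyIntegrable.locallyIntegrableOn _)
        fun φ hφ hc hsupp => ?_
      have h1 := h.2 φ hφ hc
      rw [integral_inner_zero, eq_comm, neg_eq_zero, Finset.sum_eq_single i] at h1
      · simpa [mul_comm, hμ] using h1
      · intro j _ hj
        rw [setIntegral_congr_fun (g := fun _ => (0 : ℝ)) isClosed_frontier.measurableSet,
          integral_zero]
        intro x hx
        have : φ x = 0 := image_eq_zero_of_notMem_tsupport fun hxs => hsupp hxs (by
          simp only [mem_iUnion, mem_ofPred_eq]
          exact ⟨j, hj, frontier_subset_closure hx⟩)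
        simp [this]
      · simp
    have hcont : ContinuousOn g (frontier (Ω i)) :=
      continuousOn_const.add (continuousOn_const.inner (hΩ i).continuousOn_outwardNormal)
    intro x hx
    by_contra hne
    have hev : ∀ᶠ y in 𝓝[frontier (Ω i)] x, g y ≠ 0 := (hcont x hx).eventually_ne hne
    obtain ⟨ε, hε, hball⟩ := Metric.mem_nhdsWithin_iff.1 hev
    have hpos := (hΩ i).surface_measure_pos hx hε
    have hnull : μ (frontier (Ω i) ∩ Metric.ball x ε) = 0 := by
      refine measure_mono_null ?_ hae
      rintro y ⟨hy1, hy2⟩ hy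
      exact hball ⟨hy2, hy1⟩ (hy (closure_subset_compl_other hdisj i (frontier_subset_closure hy1)))
    rw [hμ, Measure.restrict_apply
      (isClosed_frontier.measurableSet.inter measurableSet_ball), inter_right_comm, inter_self] at hnull
    exact hpos.ne' hnull
  have key : ∀ i, s i = 0 ∧ v i = 0 := by
    intro i
    obtain ⟨x, hx, h1⟩ := exists_mem_frontier_inner_normal (hΩ i) (v i)
    obtain ⟨y, hy, h2⟩ := exists_mem_frontier_inner_normal (hΩ i) (-v i)
    -- the data are `s i + ‖v i‖` at `x` and `s i - ‖v i‖` at `y`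
    have h3 := hzero i x hx
    have h4 := hzero i y hy
    rw [inner_neg_left, norm_neg] at h2
    simp only [dilData] at h3 h4
    have h5 : ‖v i‖ = 0 := by linarith
    exact ⟨by linarith, norm_eq_zero.1 h5⟩
  exact ⟨funext fun i => (key i).1, funext fun i => (key i).2⟩

end Exterior

/-! ### Radial mollifiers -/

/-- A mollifier `η` supported in the unit ball of `ℝ³` such that `-η(y) y` is the gradient of a
function `ζ` supported in the unit ball. (For radial `η` there is always such a `ζ`.) -/
structure RadialMollifier where
  /-- The mollifier. -/
  η : E3 → ℝ
  /-- The potential of `-η(y) y`. -/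
  ζ : E3 → ℝ
  contDiff_η : ContDiff ℝ ∞ η
  contDiff_ζ : ContDiff ℝ ∞ ζ
  η_eq_zero : ∀ y, 1 < ‖y‖ → η y = 0
  ζ_eq_zero : ∀ y, 1 < ‖y‖ → ζ y = 0
  fderiv_ζ : ∀ y v, fderiv ℝ ζ y v = -(η y * ⟪y, v⟫_ℝ)
  integral_η : ∫ y, η y = 1

theorem hasCompactSupport_of_eq_zero {F : Type*} [Zero F] {f : E3 → F} {R : ℝ}
    (h : ∀ y, R < ‖y‖ → f y = 0) : HasCompactSupport f := by
  refine HasCompactSupport.intro (isCompact_closedBall 0 R) fun y hy => h y ?_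
  simpa using hy

/-- With a smooth transition function `Z`, take `ζ y = Z (1 - |y|²)` and `η y = 2 Z' (1 - |y|²)`, both
divided by the integral of the latter. -/
theorem nonempty_radialMollifier : Nonempty RadialMollifier := by
  set Z := Real.smoothTransition with hZ
  have hZc : ContDiff ℝ ∞ Z := Real.smoothTransition.contDiff (n := ⊤)
  have hZd : ContDiff ℝ ∞ (deriv Z) := hZc.deriv'
  have hn : ContDiff ℝ ∞ fun y : E3 => 1 - ‖y‖ ^ 2 := contDiff_const.sub (contDiff_norm_sq ℝ)
  set η₀ : E3 → ℝ := fun y => 2 * deriv Z (1 - ‖y‖ ^ 2) with hη₀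
  have hη₀c : ContDiff ℝ ∞ η₀ := contDiff_const.mul (hZd.comp hn)
  have hη₀0 : ∀ y, 1 < ‖y‖ → η₀ y = 0 := by
    intro y hy
    have h1 : 1 - ‖y‖ ^ 2 < 0 := by nlinarith
    have h2 : Z =ᶠ[𝓝 (1 - ‖y‖ ^ 2)] fun _ => 0 := by
      filter_upwards [gt_mem_nhds h1] with t ht
      exact Real.smoothTransition.zero_of_nonpos (le_of_lt ht)
    simp [hη₀, h2.deriv_eq]
  have hη₀n : 0 ≤ η₀ := fun y =>
    mul_nonneg zero_le_two Real.smoothTransition.monotone.deriv_nonneg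
  obtain ⟨t, ht, htd⟩ : ∃ t ∈ Ioo (0 : ℝ) 1, deriv Z t = 1 := by
    obtain ⟨t, ht, h⟩ := exists_deriv_eq_slope Z one_pos hZc.continuous.continuousOn
      (hZc.differentiable (by simp)).differentiableOn
    exact ⟨t, ht, by rw [h]; simp [hZ]⟩
  set m := ∫ y, η₀ y with hm
  have hm0 : 0 < m := by
    refine hη₀c.continuous.integral_pos_of_hasCompactSupport_nonneg_nonzero
      (hasCompactSupport_of_eq_zero hη₀0) hη₀n
      (x := EuclideanSpace.single 0 (Real.sqrt (1 - t))) ?_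
    have : ‖(EuclideanSpace.single 0 (Real.sqrt (1 - t)) : E3)‖ ^ 2 = 1 - t := by
      rw [PiLp.norm_single, Real.norm_of_nonneg (Real.sqrt_nonneg _), Real.sq_sqrt (by linarith [ht.2])]
    show 2 * deriv Z (1 - ‖(EuclideanSpace.single 0 (Real.sqrt (1 - t)) : E3)‖ ^ 2) ≠ 0
    rw [this, sub_sub_cancel, htd]
    norm_num
  refine ⟨⟨fun y => m⁻¹ * η₀ y, fun y => m⁻¹ * Z (1 - ‖y‖ ^ 2), contDiff_const.mul hη₀c,
    contDiff_const.mul (hZc.comp hn), fun y hy => by simp [hη₀0 y hy], fun y hy => ?_, ?_, ?_⟩⟩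
  · have h1 : 1 - ‖y‖ ^ 2 ≤ 0 := by nlinarith
    simp [hZ, Real.smoothTransition.zero_of_nonpos h1]
  · intro y v
    have h1 : HasFDerivAt (fun y : E3 => 1 - ‖y‖ ^ 2) (-(2 • innerSL ℝ y)) y := by
      simpa using (hasStrictFDerivAt_norm_sq y).hasFDerivAt.const_sub 1
    have h2 : HasDerivAt Z (deriv Z (1 - ‖y‖ ^ 2)) (1 - ‖y‖ ^ 2) :=
      ((hZc.differentiable (by simp)) _).hasDerivAt
    have h3 := (h2.comp_hasFDerivAt y h1).const_mul m⁻¹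
    have h4 : fderiv ℝ (fun y : E3 => m⁻¹ * Z (1 - ‖y‖ ^ 2)) y = _ := h3.fderiv
    rw [h4]
    simp [hη₀]
    ring
  · rw [integral_const_mul, ← hm, inv_mul_cancel₀ hm0.ne']

namespace RadialMollifier
variable (M : RadialMollifier)

theorem hasCompactSupport_η : HasCompactSupport M.η := hasCompactSupport_of_eq_zero M.η_eq_zero

theorem hasCompactSupport_ζ : HasCompactSupport M.ζ := hasCompactSupport_of_eq_zero M.ζ_eq_zero

/-- The rescaled kernel `z ↦ s⁻³ η((x - z)/s)`. -/
noncomputable def kernel (s : ℝ) (x z : E3) : ℝ := (s ^ 3)⁻¹ * M.η (s⁻¹ • (x - z))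

theorem contDiff_kernel (s : ℝ) (x : E3) : ContDiff ℝ ∞ (M.kernel s x) :=
  contDiff_const.mul (M.contDiff_η.comp (by fun_prop))

theorem scaled_norm_gt {s : ℝ} (hs : 0 < s) {x z : E3} (hz : z ∉ Metric.closedBall x s) :
    1 < ‖s⁻¹ • (x - z)‖ := by
  rw [Metric.mem_closedBall, dist_eq_norm, not_le, norm_sub_rev] at hz
  rw [norm_smul, norm_inv, Real.norm_of_nonneg hs.le, ← div_eq_inv_mul, lt_div_iff₀ hs]
  linarith

theorem kernel_eq_zero {s : ℝ} (hs : 0 < s) {x z : E3} (hz : z ∉ Metric.closedBall x s) :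
    M.kernel s x z = 0 := by
  simp [kernel, M.η_eq_zero _ (scaled_norm_gt hs hz)]

theorem tsupport_kernel_subset {s : ℝ} (hs : 0 < s) (x : E3) :
    tsupport (M.kernel s x) ⊆ Metric.closedBall x s :=
  closure_minimal (fun _ hz => by_contra fun h => hz (M.kernel_eq_zero hs h)) Metric.isClosed_closedBall

theorem hasCompactSupport_kernel {s : ℝ} (hs : 0 < s) (x : E3) :
    HasCompactSupport (M.kernel s x) :=
  HasCompactSupport.intro (isCompact_closedBall x s) fun _ hz => M.kernel_eq_zero hs hz

theorem integral_comp_scale {F : Type*} [NormedAddCommGroup F] [NormedSpace ℝ F] (G : E3 → F) {s : ℝ}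
    (hs : 0 < s) (x : E3) : ∫ y, G y = (s ^ 3)⁻¹ • ∫ z, G (s⁻¹ • (x - z)) := by
  rw [integral_sub_left_eq_self (fun z => G (s⁻¹ • z)), Measure.integral_comp_smul]
  rw [smul_smul]
  simp [abs_of_pos hs, hs.ne']

/-- Two forms of the average of `G` over the ball of radius `s` about `x`, weighted by the mollifier. -/
theorem integral_smul_eq_kernel {F : Type*} [NormedAddCommGroup F] [NormedSpace ℝ F] (G : E3 → F)
    {s : ℝ} (hs : 0 < s) (x : E3) :
    ∫ y, M.η y • G (x - s • y) = ∫ z, M.kernel s x z • G z := by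
  rw [integral_comp_scale _ hs x, ← integral_smul]
  refine integral_congr_ae (Eventually.of_forall fun z => ?_)
  simp only [kernel, smul_smul, mul_inv_cancel₀ hs.ne', one_smul, sub_sub_cancel]

theorem integral_kernel {s : ℝ} (hs : 0 < s) (x : E3) : ∫ z, M.kernel s x z = 1 := by
  have := M.integral_smul_eq_kernel (fun _ => (1 : ℝ)) hs x
  simpa [M.integral_η] using this.symm

theorem setIntegral_kernel {F : Type*} [NormedAddCommGroup F] [NormedSpace ℝ F] (G : E3 → F) {s : ℝ}
    (hs : 0 < s) {x : E3} {U : Set E3} (hU : Metric.closedBall x s ⊆ U) :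
    ∫ z in U, M.kernel s x z • G z = ∫ z, M.kernel s x z • G z :=
  setIntegral_eq_integral_of_forall_compl_eq_zero fun z hz => by
    rw [M.kernel_eq_zero hs fun h => hz (hU h), zero_smul]

theorem exists_bound_kernel : ∃ B : ℝ, 0 ≤ B ∧ ∀ s x z, 0 < s → ‖M.kernel s x z‖ ≤ (s ^ 3)⁻¹ * B := by
  obtain ⟨B, hB⟩ := M.contDiff_η.continuous.bounded_above_of_compact_support M.hasCompactSupport_η
  refine ⟨B, (norm_nonneg _).trans (hB 0), fun s x z hs => ?_⟩
  rw [kernel, norm_mul, Real.norm_of_nonneg (by positivity)]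
  gcongr
  exact hB _

/-- The mollification of `φ` at scale `s`. -/
noncomputable def average (φ : E3 → ℝ) (s : ℝ) (x : E3) : ℝ := ∫ y, M.η y * φ (x - s • y)

theorem average_eq_kernel (φ : E3 → ℝ) {s : ℝ} (hs : 0 < s) (x : E3) :
    M.average φ s x = ∫ z, M.kernel s x z * φ z :=
  M.integral_smul_eq_kernel φ hs x

theorem hasFDerivAt_average {φ : E3 → ℝ} (hφ : ContDiff ℝ 1 φ) (hc : HasCompactSupport φ) (s : ℝ)
    (x : E3) : HasFDerivAt (M.average φ s) (innerSL ℝ (∫ y, M.η y • ∇ φ (x - s • y))) x := by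
  have hηc := M.contDiff_η.continuous
  have hgc : Continuous (∇ φ) := continuous_gradient hφ
  have hfc : Continuous (fderiv ℝ φ) := hφ.continuous_fderiv (by simp)
  obtain ⟨B, hB⟩ := hfc.bounded_above_of_compact_support (hc.fderiv (𝕜 := ℝ))
  have hint : ∀ {F : Type} [NormedAddCommGroup F] [NormedSpace ℝ F] {G : E3 → F}, Continuous G → ∀ x : E3,
      Integrable fun y => M.η y • G (x - s • y) := fun hG x =>
    (hηc.smul (hG.comp (by fun_prop))).integrable_of_hasCompactSupport M.hasCompactSupport_η.smul_right
  have h := hasFDerivAt_integral_of_dominated_of_fderiv_le (μ := (volume : Measure E3)) (𝕜 := ℝ)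
    (F := fun x y => M.η y * φ (x - s • y)) (F' := fun x y => M.η y • fderiv ℝ φ (x - s • y))
    (x₀ := x) (s := univ) (bound := fun y => ‖M.η y‖ * B) univ_mem
    (Eventually.of_forall fun x => (hint hφ.continuous x).aestronglyMeasurable)
    (hint hφ.continuous x) (hint hfc x).aestronglyMeasurable
    (Eventually.of_forall fun y x _ => by
      rw [norm_smul]; gcongr; exact hB _)
    ((hηc.integrable_of_hasCompactSupport M.hasCompactSupport_η).norm.mul_const B)
    (Eventually.of_forall fun y x _ => by
      have h1 : HasFDerivAt (fun x : E3 => x - s • y) (ContinuousLinearMap.id ℝ E3) x :=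
        (hasFDerivAt_id x).sub_const _
      have h2 : HasFDerivAt φ (fderiv ℝ φ (x - s • y)) (x - s • y) :=
        (hφ.differentiable (by simp) _).hasFDerivAt
      have h3 := (h2.comp x h1).const_mul (M.η y)
      simpa using h3)
  have heq : ∫ y, M.η y • fderiv ℝ φ (x - s • y) = innerSL ℝ (∫ y, M.η y • ∇ φ (x - s • y)) := by
    rw [← ContinuousLinearMap.integral_comp_comm _ (hint hgc x)]
    refine integral_congr_ae (Eventually.of_forall fun y => ?_)
    ext v
    have h2 : innerSL ℝ (M.η y • ∇ φ (x - s • y)) v = ⟪M.η y • ∇ φ (x - s • y), v⟫_ℝ := rfl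
    rw [h2, real_inner_smul_left, inner_gradient_left]
    rfl
  rw [← heq]
  exact h

/-- The derivative of `φ (x - s y)` in `s` is `∇φ (x - s y) · (-y)`, and `-η(y) y = ∇ζ(y)`. -/
theorem hasDerivAt_average_scale {φ : E3 → ℝ} (hφ : ContDiff ℝ 1 φ) (hc : HasCompactSupport φ) (s : ℝ)
    (x : E3) : HasDerivAt (fun s => M.average φ s x) (∫ y, fderiv ℝ φ (x - s • y) (∇ M.ζ y)) s := by
  have hηc := M.contDiff_η.continuous
  have hfc : Continuous (fderiv ℝ φ) := hφ.continuous_fderiv (by simp)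
  obtain ⟨B, hB⟩ := hfc.bounded_above_of_compact_support (hc.fderiv (𝕜 := ℝ))
  have hgζ : ∀ y, ∇ M.ζ y = -(M.η y • y) := fun y => by
    refine ext_inner_right ℝ fun v => ?_
    rw [inner_gradient_left, M.fderiv_ζ, inner_neg_left, real_inner_smul_left]
  have hd : ∀ s : ℝ, Continuous fun y : E3 => M.η y * fderiv ℝ φ (x - s • y) (-y) := fun s =>
    hηc.mul ((hfc.comp (by fun_prop)).clm_apply continuous_neg)
  have h := hasDerivAt_integral_of_dominated_loc_of_deriv_le (μ := (volume : Measure E3)) (𝕜 := ℝ)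
    (F := fun s y => M.η y * φ (x - s • y))
    (F' := fun s y => M.η y * fderiv ℝ φ (x - s • y) (-y))
    (x₀ := s) (s := univ) (bound := fun y => ‖M.η y‖ * B) univ_mem
    (Eventually.of_forall fun (s : ℝ) => (hηc.mul (hφ.continuous.comp (by fun_prop))).aestronglyMeasurable)
    ((hηc.mul (hφ.continuous.comp (by fun_prop))).integrable_of_hasCompactSupport
      M.hasCompactSupport_η.mul_right)
    (hd s).aestronglyMeasurable
    (Eventually.of_forall fun y (s : ℝ) _ => by
      rw [norm_mul]
      by_cases hy : 1 < ‖y‖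
      · simp [M.η_eq_zero y hy]
      · gcongr
        refine ((fderiv ℝ φ (x - s • y)).le_opNorm _).trans ?_
        rw [norm_neg]
        exact (mul_le_of_le_one_right (norm_nonneg _) (not_lt.1 hy)).trans (hB _))
    ((hηc.integrable_of_hasCompactSupport M.hasCompactSupport_η).norm.mul_const B)
    (Eventually.of_forall fun y s _ => by
      have h1 : HasDerivAt (fun s : ℝ => x - s • y) (-y) s := by
        simpa using ((hasDerivAt_id s).smul_const y).const_sub x
      have h2 : HasFDerivAt φ (fderiv ℝ φ (x - s • y)) (x - s • y) :=
        (hφ.differentiable (by simp) _).hasFDerivAt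
      exact (h2.comp_hasDerivAt s h1).const_mul (M.η y))
  have heq : ∫ y, fderiv ℝ φ (x - s • y) (∇ M.ζ y) = ∫ y, M.η y * fderiv ℝ φ (x - s • y) (-y) := by
    refine integral_congr_ae (Eventually.of_forall fun y => ?_)
    simp only [hgζ, map_neg, map_smul, smul_eq_mul, mul_neg]
  rw [heq]
  exact h.2

/-- The test function `z ↦ ζ((x - z)/s)`. -/
noncomputable def potential (s : ℝ) (x z : E3) : ℝ := M.ζ (s⁻¹ • (x - z))

theorem contDiff_potential (s : ℝ) (x : E3) : ContDiff ℝ ∞ (M.potential s x) :=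
  M.contDiff_ζ.comp (by fun_prop)

theorem potential_eq_zero {s : ℝ} (hs : 0 < s) {x z : E3} (hz : z ∉ Metric.closedBall x s) :
    M.potential s x z = 0 :=
  M.ζ_eq_zero _ (scaled_norm_gt hs hz)

theorem tsupport_potential_subset {s : ℝ} (hs : 0 < s) (x : E3) :
    tsupport (M.potential s x) ⊆ Metric.closedBall x s :=
  closure_minimal (fun _ hz => by_contra fun h => hz (M.potential_eq_zero hs h))
    Metric.isClosed_closedBall

theorem hasCompactSupport_potential {s : ℝ} (hs : 0 < s) (x : E3) :
    HasCompactSupport (M.potential s x) :=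
  HasCompactSupport.intro (isCompact_closedBall x s) fun _ hz => M.potential_eq_zero hs hz

theorem fderiv_potential (s : ℝ) (x z : E3) :
    fderiv ℝ (M.potential s x) z = -s⁻¹ • fderiv ℝ M.ζ (s⁻¹ • (x - z)) := by
  have h1 : HasFDerivAt (fun z : E3 => s⁻¹ • (x - z)) (s⁻¹ • -ContinuousLinearMap.id ℝ E3) z :=
    ((hasFDerivAt_id z).const_sub x).const_smul s⁻¹
  have h2 : HasFDerivAt M.ζ (fderiv ℝ M.ζ (s⁻¹ • (x - z))) (s⁻¹ • (x - z)) :=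
    (M.contDiff_ζ.differentiable (by simp) _).hasFDerivAt
  rw [show M.potential s x = M.ζ ∘ fun z => s⁻¹ • (x - z) from rfl, (h2.comp z h1).fderiv]
  ext v
  simp

theorem gradient_potential (s : ℝ) (x z : E3) :
    ∇ (M.potential s x) z = -s⁻¹ • ∇ M.ζ (s⁻¹ • (x - z)) := by
  refine ext_inner_right ℝ fun v => ?_
  rw [inner_gradient_left, fderiv_potential, real_inner_smul_left, inner_gradient_left]
  rfl

/-- The derivative of the mollification with respect to the scale is a pairing of `∇φ` with the
gradient of a test function, that is, it depends only on the divergence of `∇φ`. -/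
theorem hasDerivAt_average_scale_eq_inner {φ : E3 → ℝ} (hφ : ContDiff ℝ 1 φ) (hc : HasCompactSupport φ)
    {s : ℝ} (hs : 0 < s) (x : E3) :
    HasDerivAt (fun s => M.average φ s x) (-(s ^ 2)⁻¹ * ∫ z, ⟪∇ φ z, ∇ (M.potential s x) z⟫_ℝ) s := by
  convert M.hasDerivAt_average_scale hφ hc s x using 1
  rw [integral_comp_scale (fun y => fderiv ℝ φ (x - s • y) (∇ M.ζ y)) hs x, smul_eq_mul,
    ← integral_const_mul, ← integral_const_mul]
  refine integral_congr_ae (Eventually.of_forall fun z => ?_)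
  simp only [smul_smul, mul_inv_cancel₀ hs.ne', one_smul, sub_sub_cancel, gradient_potential,
    inner_smul_right, inner_gradient_left]
  field_simp

end RadialMollifier

/-! ### Divergence-free limits of gradients -/

/-- Locally in `U`, up to the boundary, the `L²` norm of a test function is controlled by the
Dirichlet integral over `U`. -/
def HasDirichletBound (U : Set E3) : Prop :=
  ∀ K : Set E3, Bornology.IsBounded K → ∃ C : ℝ≥0, ∀ φ : E3 → ℝ, ContDiff ℝ 1 φ → HasCompactSupport φ →
    ∫⁻ y in U ∩ K, ‖φ y‖ₑ ^ 2 ≤ C * ∫⁻ y in U, ‖fderiv ℝ φ y‖ₑ ^ 2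

theorem norm_vecL2_le {U : Set E3} {w : VecL2 U} {F : E3 → E3} (hw : w =ᵐ[volume.restrict U] F)
    {x : E3} {r B : ℝ} (h0 : ∀ z ∉ Metric.closedBall x r, F z = 0) (hB : ∀ z, ‖F z‖ ≤ B) :
    ‖w‖ ≤ B * Real.sqrt (volume.real (Metric.closedBall x r)) := by
  have hB0 : 0 ≤ B := (norm_nonneg _).trans (hB 0)
  have h1 : ‖w‖ₑ ^ 2 ≤ ENNReal.ofReal B ^ 2 * volume (Metric.closedBall x r) := by
    rw [enorm_sq_vecL2]
    calc ∫⁻ z in U, ‖w z‖ₑ ^ 2 = ∫⁻ z in U, ‖F z‖ₑ ^ 2 := by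
          refine lintegral_congr_ae ?_
          filter_upwards [hw] with z hz
          rw [hz]
      _ ≤ ∫⁻ z, ‖F z‖ₑ ^ 2 := setLIntegral_le_lintegral _ _
      _ ≤ ∫⁻ z, (Metric.closedBall x r).indicator (fun _ => ENNReal.ofReal B ^ 2) z := by
          refine lintegral_mono fun z => ?_
          by_cases hz : z ∈ Metric.closedBall x r
          · rw [indicator_of_mem hz, ← ofReal_norm]
            gcongr
            exact hB z
          · simp [h0 z hz]
      _ = _ := by rw [lintegral_indicator_const Metric.isClosed_closedBall.measurableSet]
  have hvol : volume (Metric.closedBall x r) ≠ ⊤ := measure_closedBall_lt_top.ne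
  have h2 := ENNReal.toReal_mono (ENNReal.mul_ne_top (ENNReal.pow_ne_top ENNReal.ofReal_ne_top) hvol) h1
  rw [ENNReal.toReal_pow, toReal_enorm, ENNReal.toReal_mul, ENNReal.toReal_pow,
    ENNReal.toReal_ofReal hB0] at h2
  refine abs_le_of_sq_le_sq' ?_ (by positivity) |>.2
  rw [mul_pow, Real.sq_sqrt measureReal_nonneg]
  exact h2

namespace RadialMollifier
variable (M : RadialMollifier) {U : Set E3}

theorem average_sub (φ ψ : testFunctions) (s : ℝ) (x : E3) :
    M.average (φ - ψ : testFunctions) s x = M.average φ s x - M.average ψ s x := by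
  have hint : ∀ φ : testFunctions, Integrable fun y => M.η y * (φ : E3 → ℝ) (x - s • y) := fun φ =>
    (M.contDiff_η.continuous.mul (φ.2.1.continuous.comp (by fun_prop))).integrable_of_hasCompactSupport
      M.hasCompactSupport_η.mul_right
  simp only [average]
  rw [← integral_sub (hint φ) (hint ψ)]
  refine integral_congr_ae (Eventually.of_forall fun y => ?_)
  simp [mul_sub]

theorem lintegral_kernel_sq_lt_top {s : ℝ} (hs : 0 < s) (x : E3) :
    ∫⁻ z, ‖M.kernel s x z‖ₑ ^ 2 < ⊤ := by
  have h := (M.contDiff_kernel s x).continuous.memLp_of_hasCompactSupport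
    (M.hasCompactSupport_kernel hs x) (μ := (volume : Measure E3)) (p := 2)
  have := eLpNorm_nnreal_pow_eq_lintegral (f := M.kernel s x) (μ := (volume : Measure E3)) (p := 2)
    (by norm_num)
  have h2 : ∫⁻ z, ‖M.kernel s x z‖ₑ ^ 2 = eLpNorm (M.kernel s x) 2 volume ^ 2 := by
    simpa using this.symm
  rw [h2]
  exact ENNReal.pow_lt_top h.eLpNorm_lt_top

/-- On an interior ball, the mollification at a fixed scale is bounded in the Dirichlet norm. -/
theorem exists_abs_average_le (hP : HasDirichletBound U) {s : ℝ} (hs : 0 < s) {x : E3}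
    (hU : Metric.closedBall x s ⊆ U) :
    ∃ C : ℝ, ∀ φ : testFunctions, |M.average φ s x| ≤ C * ‖gradTest U φ‖ := by
  obtain ⟨C, hC⟩ := hP (Metric.closedBall x s) Metric.isBounded_closedBall
  have hA := (M.lintegral_kernel_sq_lt_top hs x).ne
  set A := ∫⁻ z, ‖M.kernel s x z‖ₑ ^ 2 with hAdef
  refine ⟨Real.sqrt ((A.toNNReal * C : ℝ≥0) : ℝ), fun φ => abs_le_of_enorm_sq_le ?_⟩
  have hset : ∫ z, M.kernel s x z * (φ : E3 → ℝ) z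
      = ∫ z in U ∩ Metric.closedBall x s, M.kernel s x z * (φ : E3 → ℝ) z := by
    rw [setIntegral_eq_integral_of_forall_compl_eq_zero fun z hz => by
      rw [M.kernel_eq_zero hs fun h => hz ⟨hU h, h⟩, zero_mul]]
  rw [average_eq_kernel M _ hs, hset]
  calc _ ≤ (∫⁻ z in U ∩ Metric.closedBall x s, ‖M.kernel s x z‖ₑ * ‖(φ : E3 → ℝ) z‖ₑ) ^ 2 := by
        refine pow_le_pow_left' ((enorm_integral_le_lintegral_enorm _).trans (le_of_eq ?_)) 2
        simp only [enorm_mul]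
    _ ≤ _ := sq_lintegral_mul_le _ (M.contDiff_kernel s x).continuous.measurable.enorm.aemeasurable
        φ.2.1.continuous.measurable.enorm.aemeasurable
    _ ≤ A * (C * ‖gradTest U φ‖ₑ ^ 2) := by
        gcongr
        · exact setLIntegral_le_lintegral _ _
        · rw [enorm_sq_gradTest]
          exact hC φ (testFunctions.contDiff_one φ) φ.2.2
    _ = _ := by
        push_cast
        rw [ENNReal.coe_toNNReal hA]
        exact (mul_assoc _ _ _).symm

/-- If the gradient of `φ` is close to a divergence-free field, then its averages over concentric
balls are close to each other. -/
theorem exists_abs_average_sub_le {a b : ℝ} (ha : 0 < a) (hab : a ≤ b) {x : E3}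
    (hU : Metric.closedBall x b ⊆ U) :
    ∃ C : ℝ, ∀ (w : VecL2 U) (φ : testFunctions), IsDivFree w →
      |M.average φ b x - M.average φ a x| ≤ C * ‖gradTest U φ - w‖ := by
  obtain ⟨B, hB⟩ := (continuous_gradient (M.contDiff_ζ.of_le (by simp))).bounded_above_of_compact_support
    M.hasCompactSupport_ζ.gradient
  have hB0 : 0 ≤ B := (norm_nonneg _).trans (hB 0)
  set V := Real.sqrt (volume.real (Metric.closedBall x b)) with hV
  refine ⟨(a ^ 2)⁻¹ * (a⁻¹ * B * V) * (b - a), fun w φ hw => ?_⟩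
  have key := Convex.norm_image_sub_le_of_norm_hasDerivWithin_le (𝕜 := ℝ) (s := Icc a b)
    (f := fun s => M.average φ s x)
    (f' := fun s => -(s ^ 2)⁻¹ * ∫ z, ⟪∇ (φ : E3 → ℝ) z, ∇ (M.potential s x) z⟫_ℝ)
    (C := (a ^ 2)⁻¹ * (a⁻¹ * B * V * ‖gradTest U φ - w‖))
    (fun s hs => (M.hasDerivAt_average_scale_eq_inner (testFunctions.contDiff_one φ) φ.2.2
      (ha.trans_le hs.1) x).hasDerivWithinAt) ?_ (convex_Icc a b)
    (left_mem_Icc.2 hab) (right_mem_Icc.2 hab)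
  · refine key.trans (le_of_eq ?_)
    rw [Real.norm_of_nonneg (sub_nonneg.2 hab)]
    ring
  · intro s hs
    have hs0 : 0 < s := ha.trans_le hs.1
    have hsub : Metric.closedBall x s ⊆ Metric.closedBall x b := Metric.closedBall_subset_closedBall hs.2
    set p : testFunctions := ⟨M.potential s x, M.contDiff_potential s x, M.hasCompactSupport_potential hs0 x⟩
      with hp
    have hg0 : ∀ z ∉ Metric.closedBall x b, ∇ (p : E3 → ℝ) z = 0 := by
      intro z hz
      show ∇ (M.potential s x) z = 0
      have : M.ζ =ᶠ[𝓝 (s⁻¹ • (x - z))] fun _ => 0 := by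
        filter_upwards [(isOpen_lt continuous_const continuous_norm).mem_nhds
          (scaled_norm_gt hs0 fun h => hz (hsub h))] with y hy
        exact M.ζ_eq_zero y hy
      rw [gradient_potential, gradient, this.fderiv_eq]
      simp
    have hpn : ‖gradTest U p‖ ≤ a⁻¹ * B * V := by
      refine norm_vecL2_le (coeFn_gradTest U p) hg0 fun z => ?_
      show ‖∇ (M.potential s x) z‖ ≤ _
      rw [gradient_potential, norm_smul, norm_neg, norm_inv, Real.norm_of_nonneg hs0.le]
      gcongr
      · exact hs.1
      · exact hB _
    -- `w` is divergence-free, so it may be subtracted in the pairing with `∇p`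
    have hint : ∫ z, ⟪∇ (φ : E3 → ℝ) z, ∇ (M.potential s x) z⟫_ℝ = ⟪gradTest U p, gradTest U φ - w⟫_ℝ := by
      rw [inner_sub_right, inner_gradTest p w, hw _ p.2.1 p.2.2
        ((M.tsupport_potential_subset hs0 x).trans (hsub.trans hU)), sub_zero, inner_gradTest]
      have e1 : ∫ z in U, ⟪gradTest U φ z, ∇ (p : E3 → ℝ) z⟫_ℝ
          = ∫ z in U, ⟪∇ (φ : E3 → ℝ) z, ∇ (p : E3 → ℝ) z⟫_ℝ := by
        refine integral_congr_ae ?_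
        filter_upwards [coeFn_gradTest U φ] with z hz
        rw [hz]
      rw [e1, setIntegral_eq_integral_of_forall_compl_eq_zero fun z hz => by
        rw [hg0 z fun h => hz (hU h), inner_zero_right]]
    rw [hint, norm_mul, norm_neg, norm_inv, norm_pow, Real.norm_of_nonneg hs0.le]
    gcongr
    · exact hs.1
    · exact (norm_inner_le_norm _ _).trans (by gcongr)

/-- Mollifications of test functions whose gradients converge to a divergence-free field converge,
and the limit does not depend on the scale. -/
theorem exists_tendsto_average (hU : IsOpen U) (hP : HasDirichletBound U) {w : VecL2 U} (hw : IsDivFree w)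
    {φ : ℕ → testFunctions} (hφ : Tendsto (fun n => gradTest U (φ n)) atTop (𝓝 w)) :
    ∃ q : E3 → ℝ, ∀ x s, 0 < s → Metric.closedBall x s ⊆ U →
      Tendsto (fun n => M.average (φ n) s x) atTop (𝓝 (q x)) := by
  have hlim : ∀ x s, 0 < s → Metric.closedBall x s ⊆ U →
      ∃ l, Tendsto (fun n => M.average (φ n) s x) atTop (𝓝 l) := by
    intro x s hs hxU
    obtain ⟨C, hC⟩ := M.exists_abs_average_le hP hs hxU
    refine cauchySeq_tendsto_of_complete ?_
    have h1 := hφ.cauchySeq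
    rw [Metric.cauchySeq_iff'] at h1 ⊢
    intro ε hε
    obtain ⟨n₀, hn₀⟩ := h1 (ε / (|C| + 1)) (by positivity)
    refine ⟨n₀, fun n hn => ?_⟩
    have h2 := hn₀ n hn
    rw [dist_eq_norm, ← map_sub] at h2
    rw [Real.dist_eq, ← average_sub]
    calc _ ≤ C * ‖gradTest U (φ n - φ n₀)‖ := hC _
      _ ≤ (|C| + 1) * ‖gradTest U (φ n - φ n₀)‖ := by
        gcongr
        linarith [le_abs_self C]
      _ < _ := by rwa [lt_div_iff₀' (by positivity)] at h2
  have hindep : ∀ x a b l, 0 < a → a ≤ b → Metric.closedBall x b ⊆ U →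
      (Tendsto (fun n => M.average (φ n) a x) atTop (𝓝 l) ↔
        Tendsto (fun n => M.average (φ n) b x) atTop (𝓝 l)) := by
    intro x a b l ha hab hxU
    obtain ⟨C, hC⟩ := M.exists_abs_average_sub_le ha hab hxU
    have h0 : Tendsto (fun n => M.average (φ n) b x - M.average (φ n) a x) atTop (𝓝 0) := by
      refine squeeze_zero_norm (fun n => hC w (φ n) hw) ?_
      have := (tendsto_iff_norm_sub_tendsto_zero.1 hφ).const_mul C
      simpa using this
    constructor
    · intro h
      have := h.add h0
      simpa using this
    · intro h
      have := h.sub h0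
      simpa using this
  have hex : ∀ x, ∃ l, ∀ s, 0 < s → Metric.closedBall x s ⊆ U →
      Tendsto (fun n => M.average (φ n) s x) atTop (𝓝 l) := by
    intro x
    by_cases hx : x ∈ U
    · obtain ⟨r, hr, hrU⟩ := Metric.nhds_basis_closedBall.mem_iff.1 (hU.mem_nhds hx)
      obtain ⟨l, hl⟩ := hlim x r hr hrU
      refine ⟨l, fun s hs hsU => ?_⟩
      rcases le_total s r with h | h
      · exact (hindep x s r l hs h hrU).2 hl
      · exact (hindep x r s l hr h hsU).1 hl
    · exact ⟨0, fun s hs hsU => absurd (hsU (Metric.mem_closedBall_self hs.le)) hx⟩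
  choose q hq using hex
  exact ⟨q, hq⟩

end RadialMollifier

/-! ### Harmonicity of the limit -/

namespace RadialMollifier
variable (M : RadialMollifier) {U : Set E3}

/-- The mollification of the vector field `F` at scale `s`. -/
noncomputable def averageField (F : E3 → E3) (s : ℝ) (x : E3) : E3 := ∫ z, M.kernel s x z • F z

/-- The mollifier at scale `s`, centred at the origin. -/
noncomputable def profile (s : ℝ) (u : E3) : ℝ := (s ^ 3)⁻¹ * M.η (s⁻¹ • u)

theorem contDiff_profile (s : ℝ) : ContDiff ℝ ∞ (M.profile s) :=
  contDiff_const.mul (M.contDiff_η.comp (by fun_prop))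

theorem hasCompactSupport_profile {s : ℝ} (hs : 0 < s) : HasCompactSupport (M.profile s) :=
  hasCompactSupport_of_eq_zero (R := s) fun y hy => by
    have h : 1 < ‖s⁻¹ • y‖ := by
      rw [norm_smul, norm_inv, Real.norm_of_nonneg hs.le, ← div_eq_inv_mul, lt_div_iff₀ hs]
      linarith
    rw [profile, M.η_eq_zero _ h, mul_zero]

theorem averageField_eq_convolution (F : E3 → E3) (s : ℝ) :
    M.averageField F s
      = MeasureTheory.convolution F (M.profile s) (ContinuousLinearMap.lsmul ℝ ℝ).flip volume := by
  ext1 x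
  rfl

theorem contDiff_averageField {F : E3 → E3} (hF : LocallyIntegrable F) {s : ℝ} (hs : 0 < s) :
    ContDiff ℝ ∞ (M.averageField F s) := by
  rw [averageField_eq_convolution]
  exact (M.hasCompactSupport_profile hs).contDiff_convolution_right _ hF (M.contDiff_profile s)

theorem sum_inner_basis (D : E3 →L[ℝ] ℝ) (v : E3) :
    ∑ i, D (EuclideanSpace.basisFun (Fin 3) ℝ i) * ⟪v, EuclideanSpace.basisFun (Fin 3) ℝ i⟫_ℝ = D v := by
  conv_rhs => rw [← (EuclideanSpace.basisFun (Fin 3) ℝ).sum_repr' v, map_sum]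
  refine Finset.sum_congr rfl fun i _ => ?_
  rw [map_smul, smul_eq_mul, mul_comm, real_inner_comm]

/-- The divergence of a mollified field, with the derivative thrown on the mollifier. -/
theorem divergence_averageField {F : E3 → E3} (hF : LocallyIntegrable F) {s : ℝ} (hs : 0 < s) (x : E3) :
    ∑ i, ⟪fderiv ℝ (M.averageField F s) x (EuclideanSpace.basisFun (Fin 3) ℝ i),
        EuclideanSpace.basisFun (Fin 3) ℝ i⟫_ℝ = -∫ z, ⟪F z, ∇ (M.kernel s x) z⟫_ℝ := by
  set e := EuclideanSpace.basisFun (Fin 3) ℝ with he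
  set L := (ContinuousLinearMap.lsmul ℝ ℝ (E := E3)).flip with hL
  have hc := M.hasCompactSupport_profile hs
  have h1 : ContDiff ℝ 1 (M.profile s) := (M.contDiff_profile s).of_le (by simp)
  have hd := hc.hasFDerivAt_convolution_right L hF h1 x
  rw [← averageField_eq_convolution] at hd
  have hint : Integrable (fun z => L.precompR E3 (F z) (fderiv ℝ (M.profile s) (x - z))) :=
    (hc.fderiv (𝕜 := ℝ)).convolutionExists_right (L.precompR E3) hF (h1.continuous_fderiv (by simp)) x
  set τ : (E3 →L[ℝ] E3) →L[ℝ] ℝ :=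
    ∑ i, (innerSL ℝ (e i)).comp (ContinuousLinearMap.apply ℝ E3 (e i)) with hτ
  have hτa : ∀ A : E3 →L[ℝ] E3, τ A = ∑ i, ⟪A (e i), e i⟫_ℝ := fun A => by
    simp only [hτ, _root_.sum_apply, ContinuousLinearMap.comp_apply,
      ContinuousLinearMap.apply_apply]
    exact Finset.sum_congr rfl fun i _ => real_inner_comm (A (e i)) (e i)
  rw [← hτa, hd.fderiv, MeasureTheory.convolution_def, ← τ.integral_comp_comm hint, ← integral_neg]
  refine integral_congr_ae (Eventually.of_forall fun z => ?_)
  have h2 : HasFDerivAt (M.kernel s x)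
      ((fderiv ℝ (M.profile s) (x - z)).comp (-ContinuousLinearMap.id ℝ E3)) z :=
    ((h1.differentiable (by simp) (x - z)).hasFDerivAt).comp z ((hasFDerivAt_id z).const_sub x)
  simp only
  rw [real_inner_comm, inner_gradient_left, h2.fderiv, hτa]
  have h3 : ∀ i, (L.precompR E3 (F z) (fderiv ℝ (M.profile s) (x - z))) (e i)
      = fderiv ℝ (M.profile s) (x - z) (e i) • F z := fun i => rfl
  simp only [h3, real_inner_smul_left]
  rw [sum_inner_basis]
  simp

theorem locallyIntegrable_indicator (hU : MeasurableSet U) (w : VecL2 U) :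
    LocallyIntegrable (U.indicator w) :=
  ((memLp_indicator_iff_restrict hU).2 (Lp.memLp w)).locallyIntegrable (by norm_num)

theorem averageField_indicator (hU : MeasurableSet U) (w : VecL2 U) (s : ℝ) (x : E3) :
    M.averageField (U.indicator w) s x = ∫ z in U, M.kernel s x z • w z := by
  rw [averageField, ← integral_indicator hU]
  refine integral_congr_ae (Eventually.of_forall fun z => ?_)
  by_cases hz : z ∈ U <;> simp [hz]

theorem lintegral_kernel_sq (s : ℝ) (x : E3) :
    ∫⁻ z, ‖M.kernel s x z‖ₑ ^ 2 = ∫⁻ u, ‖M.profile s u‖ₑ ^ 2 :=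
  lintegral_sub_left_eq_self (fun u => ‖M.profile s u‖ₑ ^ 2) x

theorem integrable_kernel_smul {s : ℝ} (hs : 0 < s) (x : E3) (w : VecL2 U) :
    Integrable (fun z => M.kernel s x z • w z) (volume.restrict U) := by
  have h := ((M.contDiff_kernel s x).continuous.memLp_of_hasCompactSupport
    (M.hasCompactSupport_kernel hs x) (μ := (volume : Measure E3)) (p := 2)).restrict U
  exact memLp_one_iff_integrable.1 ((Lp.memLp w).smul h)

/-- The mollification of a field at a fixed scale is bounded by its `L²` norm, uniformly in the
point. -/
theorem exists_norm_integral_kernel_smul_le (U : Set E3) {s : ℝ} (hs : 0 < s) :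
    ∃ C : ℝ, ∀ (x : E3) (w : VecL2 U), ‖∫ z in U, M.kernel s x z • w z‖ ≤ C * ‖w‖ := by
  have hA := (M.lintegral_kernel_sq_lt_top hs 0).ne
  rw [lintegral_kernel_sq] at hA
  set A := ∫⁻ u, ‖M.profile s u‖ₑ ^ 2 with hAdef
  refine ⟨Real.sqrt (A.toNNReal : ℝ), fun x w => ?_⟩
  have h : ‖‖∫ z in U, M.kernel s x z • w z‖‖ₑ ^ 2 ≤ A.toNNReal * ‖w‖ₑ ^ 2 := by
    rw [enorm_norm, ENNReal.coe_toNNReal hA]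
    calc _ ≤ (∫⁻ z in U, ‖M.kernel s x z‖ₑ * ‖w z‖ₑ) ^ 2 := by
          refine pow_le_pow_left' ((enorm_integral_le_lintegral_enorm _).trans (le_of_eq ?_)) 2
          simp only [enorm_smul]
      _ ≤ _ := sq_lintegral_mul_le _ (M.contDiff_kernel s x).continuous.measurable.enorm.aemeasurable
          (Lp.aestronglyMeasurable w).enorm
      _ ≤ _ := by
          rw [enorm_sq_vecL2, hAdef, ← M.lintegral_kernel_sq s x]
          gcongr
          exact Measure.restrict_le_self
  exact (le_abs_self _).trans (abs_le_of_enorm_sq_le h)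

/-- The limit of the mollified test functions has the mollified field as its gradient. -/
theorem hasFDerivAt_of_tendsto_average (hU : MeasurableSet U) {w : VecL2 U} {φ : ℕ → testFunctions}
    (hφ : Tendsto (fun n => gradTest U (φ n)) atTop (𝓝 w)) {q : E3 → ℝ}
    (hq : ∀ x s, 0 < s → Metric.closedBall x s ⊆ U →
      Tendsto (fun n => M.average (φ n) s x) atTop (𝓝 (q x)))
    {x : E3} {s : ℝ} (hs : 0 < s) (hxU : Metric.closedBall x (2 * s) ⊆ U) :
    HasFDerivAt q (innerSL ℝ (M.averageField (U.indicator w) s x)) x := by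
  have hsub : ∀ y ∈ Metric.ball x s, Metric.closedBall y s ⊆ U := fun y hy =>
    (Metric.closedBall_subset_closedBall' (by have := Metric.mem_ball.1 hy; linarith)).trans hxU
  obtain ⟨C, hC⟩ := M.exists_norm_integral_kernel_smul_le U hs
  refine hasFDerivAt_of_tendstoUniformlyOn (l := atTop) (f := fun n => M.average (φ n) s)
    (f' := fun n y => innerSL ℝ (∫ u, M.η u • ∇ (φ n : E3 → ℝ) (y - s • u)))
    (g' := fun y => innerSL ℝ (M.averageField (U.indicator w) s y))
    Metric.isOpen_ball (s := Metric.ball x s) ?_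
    (fun n y _ => M.hasFDerivAt_average (testFunctions.contDiff_one (φ n)) (φ n).2.2 s y)
    (fun y hy => hq y s hs (hsub y hy)) (Metric.mem_ball_self hs)
  rw [Metric.tendstoUniformlyOn_iff]
  intro ε hε
  have h0 : Tendsto (fun n => C * ‖gradTest U (φ n) - w‖) atTop (𝓝 0) := by
    simpa using (tendsto_iff_norm_sub_tendsto_zero.1 hφ).const_mul C
  filter_upwards [h0.eventually (gt_mem_nhds hε)] with n hn y hy
  rw [dist_comm, dist_eq_norm, ← map_sub, innerSL_apply_norm,
    M.integral_smul_eq_kernel _ hs, ← M.setIntegral_kernel _ hs (hsub y hy),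
    M.averageField_indicator hU]
  refine lt_of_le_of_lt (le_of_eq_of_le ?_ (hC y (gradTest U (φ n) - w))) hn
  have e1 : ∫ z in U, M.kernel s y z • ∇ (φ n : E3 → ℝ) z
      = ∫ z in U, M.kernel s y z • gradTest U (φ n) z := by
    refine integral_congr_ae ?_
    filter_upwards [coeFn_gradTest U (φ n)] with z hz
    rw [hz]
  rw [e1, ← integral_sub (M.integrable_kernel_smul hs y _) (M.integrable_kernel_smul hs y _)]
  congr 1
  refine integral_congr_ae ?_
  filter_upwards [Lp.coeFn_sub (gradTest U (φ n)) w] with z hz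
  rw [hz, Pi.sub_apply, smul_sub]

/-- Near `x` the gradient of the limit is the mollification of `w` at one fixed scale, which is smooth,
and divergence-free because `w` is. -/
theorem harmonicAt_of_tendsto_average (hU : MeasurableSet U) {w : VecL2 U} (hw : IsDivFree w)
    {φ : ℕ → testFunctions} (hφ : Tendsto (fun n => gradTest U (φ n)) atTop (𝓝 w)) {q : E3 → ℝ}
    (hq : ∀ x s, 0 < s → Metric.closedBall x s ⊆ U →
      Tendsto (fun n => M.average (φ n) s x) atTop (𝓝 (q x)))
    {x : E3} {s : ℝ} (hs : 0 < s) (hxU : Metric.closedBall x (3 * s) ⊆ U) :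
    InnerProductSpace.HarmonicAt q x := by
  have hF := locallyIntegrable_indicator hU w
  have hW := M.contDiff_averageField hF hs
  set W := M.averageField (U.indicator w) s with hWdef
  have hd : ∀ y ∈ Metric.ball x s, HasFDerivAt q (innerSL ℝ (W y)) y := fun y hy =>
    M.hasFDerivAt_of_tendsto_average hU hφ hq hs
      ((Metric.closedBall_subset_closedBall' (by have := Metric.mem_ball.1 hy; linarith)).trans hxU)
  refine ⟨?_, ?_⟩
  · have := (contDiffAt_succ_iff_hasFDerivAt (𝕜 := ℝ) (n := 1) (f := q) (x := x)).2
      ⟨fun y => innerSL ℝ (W y), ⟨_, Metric.ball_mem_nhds x hs, hd⟩,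
        ((innerSL ℝ).contDiff.comp (hW.of_le (by simp))).contDiffAt⟩
    exact_mod_cast this
  · filter_upwards [Metric.ball_mem_nhds x hs] with y hy
    have hf : fderiv ℝ q =ᶠ[𝓝 y] fun z => innerSL ℝ (W z) := by
      filter_upwards [Metric.isOpen_ball.mem_nhds hy] with z hz
      exact (hd z hz).fderiv
    have h2 : HasFDerivAt (fun z => innerSL ℝ (W z)) ((innerSL ℝ).comp (fderiv ℝ W y)) y :=
      (innerSL ℝ).hasFDerivAt.comp y (hW.differentiable (by simp) y).hasFDerivAt
    rw [InnerProductSpace.laplacian_eq_iteratedFDeriv_orthonormalBasis q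
      (EuclideanSpace.basisFun (Fin 3) ℝ)]
    simp only [iteratedFDeriv_two_apply, hf.fderiv_eq, h2.fderiv, Pi.zero_apply]
    refine (M.divergence_averageField hF hs y).trans ?_
    have hyU : Metric.closedBall y s ⊆ U :=
      (Metric.closedBall_subset_closedBall' (by have := Metric.mem_ball.1 hy; linarith)).trans hxU
    have h3 := hw _ (M.contDiff_kernel s y) (M.hasCompactSupport_kernel hs y)
      ((M.tsupport_kernel_subset hs y).trans hyU)
    rw [neg_eq_zero, ← h3, ← integral_indicator hU]
    refine integral_congr_ae (Eventually.of_forall fun z => ?_)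
    by_cases hz : z ∈ U <;> simp [hz]

/-- Mollifications of a locally integrable field converge almost everywhere. -/
theorem ae_tendsto_averageField {F : E3 → E3} (hF : LocallyIntegrable F) :
    ∀ᵐ x, Tendsto (fun s => M.averageField F s x) (𝓝[>] 0) (𝓝 (F x)) := by
  obtain ⟨B, hB0, hB⟩ := M.exists_bound_kernel
  filter_upwards [IsUnifLocDoublingMeasure.ae_tendsto_average_norm_sub (μ := (volume : Measure E3)) hF 1]
    with x hx
  have h := hx (l := 𝓝[>] (0 : ℝ)) (fun _ => x) id tendsto_id (by
    filter_upwards [self_mem_nhdsWithin] with s hs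
    exact Metric.mem_closedBall_self (by simpa using (le_of_lt hs : (0 : ℝ) ≤ s)))
  rw [tendsto_iff_norm_sub_tendsto_zero]
  set V := (volume : Measure E3).real (Metric.ball 0 1) with hV
  refine squeeze_zero' (Eventually.of_forall fun _ => norm_nonneg _) ?_
    (by simpa using h.const_mul (B * V))
  filter_upwards [self_mem_nhdsWithin] with s hs
  have hs : 0 < s := hs
  have hk : Continuous (M.kernel s x) := (M.contDiff_kernel s x).continuous
  have i1 : Integrable fun z => M.kernel s x z • F z :=
    hF.integrable_smul_left_of_hasCompactSupport hk (M.hasCompactSupport_kernel hs x)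
  have i2 : Integrable fun z => M.kernel s x z • F x :=
    (hk.integrable_of_hasCompactSupport (M.hasCompactSupport_kernel hs x)).smul_const _
  have e1 : M.averageField F s x - F x = ∫ z in Metric.closedBall x s, M.kernel s x z • (F z - F x) := by
    rw [setIntegral_eq_integral_of_forall_compl_eq_zero fun z hz => by
      rw [M.kernel_eq_zero hs hz, zero_smul]]
    simp only [smul_sub]
    rw [integral_sub i1 i2, integral_smul_const, M.integral_kernel hs, one_smul]
    rfl
  have i3 : IntegrableOn (fun z => ‖F z - F x‖) (Metric.closedBall x s) :=
    ((hF.integrableOn_isCompact (isCompact_closedBall x s)).sub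
      (integrableOn_const (by exact measure_closedBall_lt_top.ne))).norm
  rw [e1, setAverage_eq, smul_eq_mul, Measure.addHaar_real_closedBall _ _ hs.le, ← hV]
  calc _ ≤ ∫ z in Metric.closedBall x s, (s ^ 3)⁻¹ * B * ‖F z - F x‖ := by
        refine norm_integral_le_of_norm_le (i3.const_mul _) (Eventually.of_forall fun z => ?_)
        rw [norm_smul]
        gcongr
        exact hB s x z hs
    _ = _ := by
        rw [integral_const_mul]
        have hV0 : V ≠ 0 := (ENNReal.toReal_pos (Metric.measure_ball_pos _ _ one_pos).ne'
          measure_ball_lt_top.ne).ne'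
        simp only [finrank_euclideanSpace, Fintype.card_fin]
        field_simp

end RadialMollifier

/-- A divergence-free field in the closure of the gradients of test functions is the gradient of a
harmonic function. -/
theorem exists_harmonicOnNhd_of_mem_closure {U : Set E3} (hU : IsOpen U) (hP : HasDirichletBound U)
    {w : VecL2 U} (hw : w ∈ (LinearMap.range (gradTest U)).topologicalClosure) (hd : IsDivFree w) :
    ∃ q : E3 → ℝ, InnerProductSpace.HarmonicOnNhd q U ∧ w =ᵐ[volume.restrict U] ∇ q := by
  obtain ⟨M⟩ := nonempty_radialMollifier
  obtain ⟨g, hg, hgw⟩ := mem_closure_iff_seq_limit.1 hw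
  choose φ hφ using hg
  have hφw : Tendsto (fun n => gradTest U (φ n)) atTop (𝓝 w) := by simpa only [hφ] using hgw
  obtain ⟨q, hq⟩ := M.exists_tendsto_average hU hP hd hφw
  refine ⟨q, fun x hx => ?_, ?_⟩
  · obtain ⟨r, hr, hrU⟩ := Metric.nhds_basis_closedBall.mem_iff.1 (hU.mem_nhds hx)
    exact M.harmonicAt_of_tendsto_average hU.measurableSet hd hφw hq (s := r / 3) (by positivity)
      (by rwa [mul_div_cancel₀ r (by norm_num : (3 : ℝ) ≠ 0)])
  · rw [EventuallyEq, ae_restrict_iff' hU.measurableSet]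
    filter_upwards [M.ae_tendsto_averageField
      (RadialMollifier.locallyIntegrable_indicator hU.measurableSet w)] with x hx hxU
    rw [indicator_of_mem hxU] at hx
    obtain ⟨r, hr, hrU⟩ := Metric.nhds_basis_closedBall.mem_iff.1 (hU.mem_nhds hxU)
    refine tendsto_nhds_unique hx (tendsto_const_nhds.congr' ?_)
    filter_upwards [Ioo_mem_nhdsGT (show (0 : ℝ) < r / 2 by positivity)] with s hs
    refine ext_inner_right ℝ fun v => ?_
    rw [inner_gradient_left, (M.hasFDerivAt_of_tendsto_average hU.measurableSet hφw hq hs.1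
      ((Metric.closedBall_subset_closedBall (by linarith [hs.2])).trans hrU)).fderiv]
    rfl

/-! ### Limits of gradients of test functions -/

namespace RadialMollifier
variable (M : RadialMollifier)

theorem contDiff_average {f : E3 → ℝ} (hf : LocallyIntegrable f) {s : ℝ} (hs : 0 < s) :
    ContDiff ℝ ∞ (M.average f s) := by
  have h : M.average f s
      = MeasureTheory.convolution f (M.profile s) (ContinuousLinearMap.lsmul ℝ ℝ).flip volume := by
    ext1 x
    rw [average_eq_kernel M f hs]
    rfl
  rw [h]
  exact (M.hasCompactSupport_profile hs).contDiff_convolution_right _ hf (M.contDiff_profile s)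

theorem average_eq_zero {f : E3 → ℝ} {R : ℝ} (hf : ∀ y, R < ‖y‖ → f y = 0) {s : ℝ} (hs : 0 < s) {x : E3}
    (hx : R + s < ‖x‖) : M.average f s x = 0 := by
  rw [average, ← integral_zero E3 ℝ]
  refine integral_congr_ae (Eventually.of_forall fun y => ?_)
  by_cases hy : 1 < ‖y‖
  · simp [M.η_eq_zero y hy]
  · have h1 : ‖s • y‖ ≤ s := by
      rw [norm_smul, Real.norm_of_nonneg hs.le]
      exact mul_le_of_le_one_right hs.le (not_lt.1 hy)
    have h2 := norm_sub_norm_le x (s • y)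
    simp [hf (x - s • y) (by linarith)]

/-- The gradient of the mollification is close to the gradient, where the gradient oscillates little at
the scale of the mollification. -/
theorem norm_gradient_average_sub_le {f : E3 → ℝ} (hf : ContDiff ℝ 1 f) (hc : HasCompactSupport f)
    {s ε : ℝ} (hs : 0 < s) (x : E3) (hε : ∀ z, ‖z - x‖ ≤ s → ‖∇ f z - ∇ f x‖ ≤ ε) :
    ‖∇ (M.average f s) x - ∇ f x‖ ≤ ε * ∫ y, ‖M.η y‖ := by
  have hη := M.contDiff_η.continuous
  have hηi := hη.integrable_of_hasCompactSupport M.hasCompactSupport_η (μ := (volume : Measure E3))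
  have h1 : ∇ (M.average f s) x = ∫ y, M.η y • ∇ f (x - s • y) := by
    refine ext_inner_right ℝ fun v => ?_
    rw [inner_gradient_left, (M.hasFDerivAt_average hf hc s x).fderiv]
    rfl
  have h2 : ∇ f x = ∫ y, M.η y • ∇ f x := by
    rw [integral_smul_const, M.integral_η, one_smul]
  have i1 : Integrable fun y => M.η y • ∇ f (x - s • y) :=
    (hη.smul ((continuous_gradient hf).comp (by fun_prop))).integrable_of_hasCompactSupport
      M.hasCompactSupport_η.smul_right
  rw [h1]
  nth_rewrite 1 [h2]
  rw [← integral_sub i1 (hηi.smul_const _), ← integral_const_mul]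
  refine norm_integral_le_of_norm_le (hηi.norm.const_mul ε) (Eventually.of_forall fun y => ?_)
  rw [← smul_sub, norm_smul, mul_comm]
  by_cases hy : 1 < ‖y‖
  · simp [M.η_eq_zero y hy]
  · gcongr
    refine hε _ ?_
    rw [sub_sub_cancel_left, norm_neg, norm_smul, Real.norm_of_nonneg hs.le]
    exact mul_le_of_le_one_right hs.le (not_lt.1 hy)

end RadialMollifier

/-- Gradients of compactly supported `C¹` functions are limits of gradients of test functions. -/
theorem mem_closure_of_contDiff_one {U : Set E3} {f : E3 → ℝ} (hf : ContDiff ℝ 1 f)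
    (hc : HasCompactSupport f) {w : VecL2 U} (hw : w =ᵐ[volume.restrict U] ∇ f) :
    w ∈ (LinearMap.range (gradTest U)).topologicalClosure := by
  obtain ⟨M⟩ := nonempty_radialMollifier
  obtain ⟨R, hR⟩ := hc.isCompact.isBounded.subset_closedBall 0
  have hf0 : ∀ y, R < ‖y‖ → f y = 0 := fun y hy => image_eq_zero_of_notMem_tsupport fun h => by
    have := hR h
    rw [mem_closedBall_zero_iff] at this
    linarith
  have hg0 : ∀ y, R < ‖y‖ → ∇ f y = 0 := fun y hy => by
    have : f =ᶠ[𝓝 y] fun _ => 0 := by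
      filter_upwards [(isOpen_lt continuous_const continuous_norm).mem_nhds hy] with z hz
      exact hf0 z hz
    rw [gradient, this.fderiv_eq]
    simp
  have hunif := hc.gradient.uniformContinuous_of_continuous (continuous_gradient hf)
  refine Metric.mem_closure_iff.2 fun ε hε => ?_
  set I := ∫ y, ‖M.η y‖ with hI
  set V := Real.sqrt (volume.real (Metric.closedBall (0 : E3) (R + 1))) with hV
  have hI0 : 0 ≤ I := integral_nonneg fun _ => norm_nonneg _
  have hV0 : 0 ≤ V := Real.sqrt_nonneg _
  set ε' := ε / (I * V + 1) with hε'
  have hε'0 : 0 < ε' := by positivity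
  obtain ⟨δ, hδ, hδf⟩ := Metric.uniformContinuous_iff.1 hunif ε' hε'0
  set s := min (δ / 2) 1 with hs
  have hs0 : 0 < s := lt_min (half_pos hδ) one_pos
  have hs1 : s ≤ 1 := min_le_right _ _
  have hsδ : s < δ := (min_le_left _ _).trans_lt (half_lt_self hδ)
  have ha0 : ∀ x, R + 1 < ‖x‖ → M.average f s x = 0 := fun x hx =>
    M.average_eq_zero hf0 hs0 (by linarith)
  set φ : testFunctions := ⟨M.average f s, M.contDiff_average hf.continuous.locallyIntegrable hs0,
    hasCompactSupport_of_eq_zero ha0⟩ with hφ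
  refine ⟨gradTest U φ, ⟨φ, rfl⟩, ?_⟩
  rw [dist_comm, dist_eq_norm]
  have hae : (gradTest U φ - w : VecL2 U) =ᵐ[volume.restrict U]
      fun x => ∇ (M.average f s) x - ∇ f x := by
    filter_upwards [Lp.coeFn_sub (gradTest U φ) w, coeFn_gradTest U φ, hw] with x h1 h2 h3
    rw [h1, Pi.sub_apply, h2, h3]
  have key := norm_vecL2_le hae (x := 0) (r := R + 1) (B := ε' * I) (fun z hz => by
      rw [mem_closedBall_zero_iff, not_le] at hz
      have : M.average f s =ᶠ[𝓝 z] fun _ => 0 := by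
        filter_upwards [(isOpen_lt continuous_const continuous_norm).mem_nhds hz] with y hy
        exact ha0 y hy
      rw [hg0 z (by linarith), gradient, this.fderiv_eq]
      simp)
    (fun z => M.norm_gradient_average_sub_le hf hc hs0 z fun y hy => by
      have := hδf (a := y) (b := z) (by rw [dist_eq_norm]; linarith)
      rw [dist_eq_norm] at this
      exact this.le)
  refine key.trans_lt ?_
  rw [mul_assoc, hε', div_mul_eq_mul_div, div_lt_iff₀ (by positivity)]
  exact mul_lt_mul_of_pos_left (lt_add_one _) hε

/-! ### Approximation up to the boundary -/

theorem exists_contDiff_one_of_isCompact {C A : Set E3} (hC : IsCompact C) (hA : IsOpen A) (h : C ⊆ A) :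
    ∃ θ : E3 → ℝ, ContDiff ℝ ∞ θ ∧ HasCompactSupport θ ∧ tsupport θ ⊆ A ∧ ∀ y ∈ C, θ y = 1 := by
  obtain ⟨L, hL, hCL, hLA⟩ := exists_compact_between hC hA h
  obtain ⟨θ, h0, h1, -⟩ := exists_contMDiffMap_zero_one_of_isClosed (n := ⊤) (modelWithCornersSelf ℝ E3)
    isOpen_interior.isClosed_compl hC.isClosed (disjoint_compl_left_iff_subset.2 hCL)
  have hs : tsupport θ ⊆ L := closure_minimal (fun y hy => by_contra fun hyL =>
    hy (h0 fun hyi => hyL (interior_subset hyi))) hL.isClosed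
  exact ⟨θ, θ.contMDiff.contDiff, hL.of_isClosed_subset (isClosed_tsupport _) hs, hs.trans hLA,
    fun y hy => h1 hy⟩

/-- Near every point there is a direction such that small translations in this direction map the
closure of `U` into `U`. (At points off the closure of `U` this is void, and in `U` the direction `0`
will do.) -/
def HasInwardTranslations (U : Set E3) : Prop :=
  ∀ x : E3, ∃ r > 0, ∃ δ > 0, ∃ d : E3, ∀ y ∈ Metric.ball x r, y ∈ closure U → ∀ t ∈ Ioc (0 : ℝ) δ,
    y + t • d ∈ U

theorem hasInwardTranslations_exterior {N : ℕ} {Ω : Fin N → Set E3} (hΩ : ∀ i, IsSmoothBoundedDomain (Ω i))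
    (hdisj : ∀ i j, i ≠ j → Disjoint (closure (Ω i)) (closure (Ω j))) :
    HasInwardTranslations (exterior Ω) := by
  intro x
  by_cases hxU : x ∈ exterior Ω
  · obtain ⟨r, hr, h⟩ := Metric.isOpen_iff.1 (isOpen_exterior Ω) x hxU
    exact ⟨r, hr, 1, one_pos, 0, fun y hy _ t _ => by simpa using h hy⟩
  by_cases hxc : x ∈ closure (exterior Ω)
  · obtain ⟨i, hi⟩ := mem_frontier_of_mem_closure_exterior hΩ hxc hxU
    obtain ⟨k, σ, r, δ, K, hr, hδ, -, h1, -⟩ := exists_exterior_chart hΩ hdisj hi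
    refine ⟨r, hr, δ, hδ, EuclideanSpace.single k σ, fun y hy hyU t ht => h1 y hy (fun hyi => ?_) t ht⟩
    obtain ⟨z, hz1, hz2⟩ := mem_closure_iff.1 hyU _ (hΩ i).isOpen hyi
    exact notMem_of_mem_exterior hz2 i (subset_closure hz1)
  · obtain ⟨r, hr, h⟩ := Metric.isOpen_iff.1 isClosed_closure.isOpen_compl x hxc
    exact ⟨r, hr, 1, one_pos, 0, fun y hy hyU => absurd hyU (h hy)⟩

/-- If `g` is supported in a small ball, its translates along the inward direction agree on `U` with
compactly supported `C¹` functions, and their gradients converge in `L²(U)`. -/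
theorem mem_closure_of_eq_zero_off_ball {U : Set E3} (hU : IsOpen U) {x d : E3} {r δ : ℝ} (hδ : 0 < δ)
    (hd : ∀ y ∈ Metric.ball x r, y ∈ closure U → ∀ t ∈ Ioc (0 : ℝ) δ, y + t • d ∈ U)
    {g : E3 → ℝ} (hg : ContDiffOn ℝ 1 g U) {K : Set E3} (hK : IsCompact K) (hKr : K ⊆ Metric.ball x r)
    (hg0 : ∀ y ∉ K, g y = 0) {w : VecL2 U} (hw : w =ᵐ[volume.restrict U] ∇ g) :
    w ∈ (LinearMap.range (gradTest U)).topologicalClosure := by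
  have hgrad0 : ∀ y ∉ K, ∇ g y = 0 := fun y hy => by
    have : g =ᶠ[𝓝 y] fun _ => 0 := by
      filter_upwards [hK.isClosed.isOpen_compl.mem_nhds hy] with z hz
      exact hg0 z hz
    rw [gradient, this.fderiv_eq]
    simp
  set H : E3 → E3 := U.indicator (∇ g) with hH
  have hHm : MemLp H 2 volume := (memLp_indicator_iff_restrict hU.measurableSet).2
    ((memLp_congr_ae hw).1 (Lp.memLp w))
  set Hp : Lp E3 2 (volume : Measure E3) := hHm.toLp H with hHp
  obtain ⟨ρ, hρ, hρK⟩ := hK.exists_thickening_subset_open Metric.isOpen_ball hKr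
  -- for small `t`, an element of the closure that agrees with `H (· + t d)` on `U`
  have hex : ∀ t ∈ Ioc (0 : ℝ) δ, t * ‖d‖ < ρ → ∃ u ∈ (LinearMap.range (gradTest U)).topologicalClosure,
      u =ᵐ[volume.restrict U] fun y => H (t • d + y) := by
    intro t ht htρ
    have hKt : ∀ y, y + t • d ∈ K → y ∈ Metric.ball x r := fun y hy => hρK <| by
      refine Metric.mem_thickening_iff.2 ⟨_, hy, ?_⟩
      rw [dist_eq_norm, sub_add_cancel_left, norm_neg, norm_smul, Real.norm_of_nonneg ht.1.le]
      exact htρ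
    have hcont : Continuous fun y : E3 => y + t • d := by fun_prop
    set A : Set E3 := (fun y => y + t • d) ⁻¹' U with hA
    have hAo : IsOpen A := hU.preimage hcont
    -- the cutoff `θ` makes the translate smooth on all of `ℝ³` without changing it on `U`
    set C : Set E3 := closure U ∩ (fun y => y + t • d) ⁻¹' K with hC
    have hCc : IsCompact C :=
      ((Homeomorph.addRight (t • d)).isCompact_preimage.2 hK).inter_left isClosed_closure
    have hCA : C ⊆ A := fun y hy => hd y (hKt y hy.2) hy.1 t ht
    obtain ⟨θ, hθ, hθc, hθA, hθ1⟩ := exists_contDiff_one_of_isCompact hCc hAo hCA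
    set G : E3 → ℝ := fun y => θ y * g (y + t • d) with hG
    have hGc : HasCompactSupport G := hθc.mul_right
    have hG1 : ContDiff ℝ 1 G := by
      refine contDiff_iff_contDiffAt.2 fun y => ?_
      by_cases hy : y ∈ tsupport θ
      · have h1 : ContDiffAt ℝ 1 (fun y : E3 => y + t • d) y := by fun_prop
        exact (hθ.of_le (by simp)).contDiffAt.mul ((hg.contDiffAt (hU.mem_nhds (hθA hy))).comp y h1)
      · refine (contDiffAt_const (c := (0 : ℝ))).congr_of_eventuallyEq ?_
        filter_upwards [(isClosed_tsupport θ).isOpen_compl.mem_nhds hy] with z hz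
        simp [hG, image_eq_zero_of_notMem_tsupport hz]
    have hGU : ∀ y ∈ U, G y = g (y + t • d) := by
      intro y hy
      by_cases hyK : y + t • d ∈ K
      · simp only [hG, hθ1 y ⟨subset_closure hy, hyK⟩, one_mul]
      · simp [hG, hg0 _ hyK]
    refine ⟨(memLp_gradient U hG1 hGc).toLp _, mem_closure_of_contDiff_one hG1 hGc
      (memLp_gradient U hG1 hGc).coeFn_toLp, (memLp_gradient U hG1 hGc).coeFn_toLp.trans ?_⟩
    filter_upwards [ae_restrict_mem hU.measurableSet] with y hy
    have h1 : G =ᶠ[𝓝 y] fun y => g (y + t • d) := by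
      filter_upwards [hU.mem_nhds hy] with z hz
      exact hGU z hz
    have h2 : ∇ G y = ∇ g (y + t • d) := by
      rw [gradient, gradient, h1.fderiv_eq, fderiv_comp_add_right]
    rw [h2, add_comm, hH]
    by_cases hyU : t • d + y ∈ U
    · rw [indicator_of_mem hyU]
    · rw [indicator_of_notMem hyU]
      refine hgrad0 _ fun hyK => hyU ?_
      rw [add_comm] at hyK ⊢
      exact hd y (hKt y hyK) (subset_closure hy) t ht
  have hcl : IsClosed ((LinearMap.range (gradTest U)).topologicalClosure : Set (VecL2 U)) :=
    Submodule.isClosed_topologicalClosure _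
  rw [← SetLike.mem_coe, ← hcl.closure_eq, Metric.mem_closure_iff]
  intro ε hε
  have : Fact ((2 : ℝ≥0∞) ≠ ⊤) := ⟨by norm_num⟩
  -- continuity of translations in `L²(ℝ³)`
  have htr : Tendsto (fun t : ℝ => ‖(DomAddAct.mk (t • d) +ᵥ Hp) - Hp‖) (𝓝[>] 0) (𝓝 0) := by
    have hc : Continuous fun t : ℝ => ‖(DomAddAct.mk (t • d) +ᵥ Hp) - Hp‖ := by
      have : Continuous fun t : ℝ => DomAddAct.mk (t • d) :=
        DomAddAct.continuous_mk.comp (by fun_prop)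
      fun_prop
    have h0 := hc.tendsto 0
    simp only [zero_smul, DomAddAct.mk_zero, zero_vadd, sub_self, norm_zero] at h0
    exact h0.mono_left nhdsWithin_le_nhds
  have hsm : Tendsto (fun t : ℝ => t * ‖d‖) (𝓝[>] 0) (𝓝 0) := by
    have : Continuous fun t : ℝ => t * ‖d‖ := by fun_prop
    have h0 := this.tendsto 0
    simp only [zero_mul] at h0
    exact h0.mono_left nhdsWithin_le_nhds
  obtain ⟨t, ht1, ht2, ht3⟩ := ((htr.eventually (gt_mem_nhds hε)).and
    ((hsm.eventually (gt_mem_nhds hρ)).and (Ioc_mem_nhdsGT hδ))).exists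
  obtain ⟨u, hu, huH⟩ := hex t ht3 ht2
  refine ⟨u, hu, lt_of_le_of_lt ?_ ht1⟩
  rw [dist_comm, dist_eq_norm, Lp.norm_def, Lp.norm_def]
  refine ENNReal.toReal_mono (Lp.eLpNorm_ne_top _) ?_
  have e1 : ((u - w : VecL2 U) : E3 → E3) =ᵐ[volume.restrict U] fun y => H (t • d + y) - H y := by
    filter_upwards [Lp.coeFn_sub u w, huH, hw, ae_restrict_mem hU.measurableSet] with y h1 h2 h3 hy
    rw [h1, Pi.sub_apply, h2, h3, hH, indicator_of_mem hy]
  have e2 : (((DomAddAct.mk (t • d) +ᵥ Hp) - Hp : Lp E3 2 (volume : Measure E3)) : E3 → E3)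
      =ᵐ[volume] fun y => H (t • d + y) - H y := by
    rw [hHp, DomAddAct.mk_vadd_toLp]
    filter_upwards [Lp.coeFn_sub ((hHm.comp_measurePreserving (measurePreserving_vadd (t • d) volume)).toLp
      (fun y => H (t • d +ᵥ y))) (hHm.toLp H), MemLp.coeFn_toLp (hHm.comp_measurePreserving
        (measurePreserving_vadd (t • d) (volume : Measure E3))), hHm.coeFn_toLp] with y h1 h2 h3
    rw [h1, Pi.sub_apply, h3]
    exact congrArg (· - H y) h2
  rw [eLpNorm_congr_ae e1, eLpNorm_congr_ae e2]
  exact eLpNorm_mono_measure _ Measure.restrict_le_self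

theorem gradient_mul {f g : E3 → ℝ} {y : E3} (hf : DifferentiableAt ℝ f y) (hg : DifferentiableAt ℝ g y) :
    ∇ (fun z => f z * g z) y = f y • ∇ g y + g y • ∇ f y := by
  refine ext_inner_right ℝ fun v => ?_
  have h : fderiv ℝ (fun z => f z * g z) y = _ := (hf.hasFDerivAt.mul hg.hasFDerivAt).fderiv
  rw [inner_gradient_left, h, inner_add_left,
    real_inner_smul_left, real_inner_smul_left, inner_gradient_left, inner_gradient_left]
  rfl

theorem memLp_gradient_mul {U : Set E3} (hU : IsOpen U) {ψ f : E3 → ℝ} (hψ : ContDiff ℝ 1 ψ)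
    (hψc : HasCompactSupport ψ) (hf : ContDiffOn ℝ 1 f U) (hf2 : MemLp f 2 (volume.restrict U))
    (hg2 : MemLp (∇ f) 2 (volume.restrict U)) :
    MemLp (∇ fun z => ψ z * f z) 2 (volume.restrict U) := by
  have h1 : MemLp (fun z => ψ z • ∇ f z) 2 (volume.restrict U) :=
    MemLp.smul (p := ⊤) hg2 ((hψ.continuous.memLp_top_of_hasCompactSupport hψc volume).restrict U)
  have h2 : MemLp (fun z => f z • ∇ ψ z) 2 (volume.restrict U) :=
    MemLp.smul (q := ⊤) (((continuous_gradient hψ).memLp_top_of_hasCompactSupport hψc.gradient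
      volume).restrict U) hf2
  refine (memLp_congr_ae ?_).1 (h1.add h2)
  filter_upwards [ae_restrict_mem hU.measurableSet] with y hy
  exact (gradient_mul (hψ.differentiable (by simp) y)
    ((hf.contDiffAt (hU.mem_nhds hy)).differentiableAt (by simp))).symm

/-- The gradient of a function with bounded support is a limit of gradients of test functions. -/
theorem mem_closure_of_bounded_support {U : Set E3} (hU : IsOpen U) (hI : HasInwardTranslations U)
    {f : E3 → ℝ} (hf : ContDiffOn ℝ 1 f U) {R : ℝ} (hf0 : ∀ y, R < ‖y‖ → f y = 0)
    (hf2 : MemLp f 2 (volume.restrict U)) {w : VecL2 U} (hw : w =ᵐ[volume.restrict U] ∇ f) :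
    w ∈ (LinearMap.range (gradTest U)).topologicalClosure := by
  choose r hr δ hδ d hd using hI
  have hg2 : MemLp (∇ f) 2 (volume.restrict U) := (memLp_congr_ae hw).1 (Lp.memLp w)
  obtain ⟨T, -, hT⟩ := (isCompact_closedBall (0 : E3) R).elim_nhds_subcover (fun x => Metric.ball x (r x))
    fun x _ => Metric.ball_mem_nhds x (hr x)
  obtain ⟨ψ, hψ⟩ := SmoothPartitionOfUnity.exists_isSubordinate (modelWithCornersSelf ℝ E3)
    (Metric.isClosed_closedBall (x := (0 : E3)) (ε := R)) (fun x : T => Metric.ball (x : E3) (r x))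
    (fun _ => Metric.isOpen_ball) (by simpa [iUnion_subtype] using hT)
  have hψ1 : ∀ i, ContDiff ℝ 1 (ψ i) := fun i => (ψ i).contMDiff.contDiff.of_le (by simp)
  have hψc : ∀ i, HasCompactSupport (ψ i) := fun i =>
    Metric.isCompact_of_isClosed_isBounded (isClosed_tsupport _)
      (Metric.isBounded_ball.subset (hψ i))
  have hm : ∀ i, MemLp (∇ fun z => ψ i z * f z) 2 (volume.restrict U) := fun i =>
    memLp_gradient_mul hU (hψ1 i) (hψc i) hf hf2 hg2
  have hmem : ∀ i, (hm i).toLp _ ∈ (LinearMap.range (gradTest U)).topologicalClosure := fun i =>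
    mem_closure_of_eq_zero_off_ball hU (hδ i) (hd i) ((hψ1 i).contDiffOn.mul hf)
      (K := tsupport (ψ i)) (hψc i) (hψ i)
      (fun y hy => by rw [image_eq_zero_of_notMem_tsupport hy, zero_mul]) (hm i).coeFn_toLp
  have hsum : w = ∑ i, (hm i).toLp _ := by
    refine Lp.ext ?_
    have h1 : ∀ᵐ y ∂(volume.restrict U), ∀ i, (hm i).toLp _ y = ∇ (fun z => ψ i z * f z) y :=
      ae_all_iff.2 fun i => (hm i).coeFn_toLp
    filter_upwards [hw, h1, Lp.coeFn_finsetSum Finset.univ fun i => (hm i).toLp _,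
      ae_restrict_mem hU.measurableSet] with y h2 h3 h4 hy
    rw [h2, h4, Finset.sum_apply, Finset.sum_congr rfl fun i _ => h3 i]
    have hfs : f = fun z => ∑ i, ψ i z * f z := by
      ext z
      rw [← Finset.sum_mul]
      by_cases hz : R < ‖z‖
      · simp [hf0 z hz]
      · have := ψ.sum_eq_one (x := z) (by simpa using hz)
        rw [finsum_eq_sum_of_fintype] at this
        rw [this, one_mul]
    have hdi : ∀ i, DifferentiableAt ℝ (fun z => ψ i z * f z) y := fun i =>
      ((hψ1 i).differentiable (by simp) y).mul
        ((hf.contDiffAt (hU.mem_nhds hy)).differentiableAt (by simp))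
    have h5 : fderiv ℝ f y = ∑ i, fderiv ℝ (fun z => ψ i z * f z) y := by
      conv_lhs => rw [hfs]
      exact fderiv_fun_sum fun i _ => hdi i
    simp only [gradient, h5, map_sum]
  rw [hsum]
  exact Submodule.sum_mem _ fun i _ => hmem i

/-! ### Cutting off at infinity -/

/-- The spherical shell `{a < |y| < b}`. -/
def shell (a b : ℝ) : Set E3 := {y | a < ‖y‖ ∧ ‖y‖ < b}

theorem isOpen_shell (a b : ℝ) : IsOpen (shell a b) :=
  (isOpen_lt continuous_const continuous_norm).inter (isOpen_lt continuous_norm continuous_const)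

/-- The closed spherical shell `{a ≤ |y| ≤ b}`. -/
def closedShell (a b : ℝ) : Set E3 := {y | a ≤ ‖y‖ ∧ ‖y‖ ≤ b}

theorem isClosed_closedShell (a b : ℝ) : IsClosed (closedShell a b) :=
  (isClosed_le continuous_const continuous_norm).inter (isClosed_le continuous_norm continuous_const)

theorem isPreconnected_shell {a b : ℝ} (ha : 0 ≤ a) : IsPreconnected (shell a b) := by
  have hS : IsPreconnected (Metric.sphere (0 : E3) 1) := by
    refine isPreconnected_sphere ?_ 0 1
    rw [← Module.finrank_eq_rank]
    simp
  have h := (isPreconnected_Ioo (a := a) (b := b)).prod hS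
  have h2 := h.image (fun p : ℝ × E3 => p.1 • p.2) (by fun_prop)
  convert h2 using 1
  ext y
  constructor
  · rintro ⟨h1, h2⟩
    have hy : ‖y‖ ≠ 0 := by linarith
    refine ⟨(‖y‖, ‖y‖⁻¹ • y), ⟨⟨h1, h2⟩, ?_⟩, ?_⟩
    · rw [mem_sphere_zero_iff_norm, norm_smul, norm_inv, norm_norm, inv_mul_cancel₀ hy]
    · simp only [smul_smul, mul_inv_cancel₀ hy, one_smul]
  · rintro ⟨⟨t, v⟩, ⟨ht, hv⟩, rfl⟩
    rw [mem_sphere_zero_iff_norm] at hv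
    have : ‖t • v‖ = t := by rw [norm_smul, hv, mul_one, Real.norm_of_nonneg (by linarith [ht.1])]
    simp only [shell, mem_ofPred_eq, this]
    exact ht

/-- Poincaré's inequality on a shell: the inequality on a ball in the shell propagates to the functions
`f - c`, with `c` the constant for the ball. -/
theorem exists_lintegral_shell_sub_const_sq_le :
    ∃ C : ℝ≥0, ∀ f : E3 → ℝ, ContDiffOn ℝ 1 f (shell 1 4) → ∃ c : ℝ,
      ∫⁻ y in closedShell 2 3, ‖f y - c‖ₑ ^ 2 ≤ C * ∫⁻ y in shell 1 4, ‖fderiv ℝ f y‖ₑ ^ 2 := by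
  set x₀ : E3 := EuclideanSpace.single 0 (5 / 2) with hx₀
  have hx₀n : ‖x₀‖ = 5 / 2 := by rw [hx₀, PiLp.norm_single]; norm_num
  have hball : Metric.ball x₀ 1 ⊆ shell 1 4 := by
    intro y hy
    rw [Metric.mem_ball, dist_eq_norm] at hy
    have h1 := norm_sub_norm_le y x₀
    have h2 := norm_sub_norm_le x₀ y
    rw [norm_sub_rev] at h2
    constructor <;> linarith
  obtain ⟨C₀, hC₀⟩ := exists_lintegral_sub_const_sq_le x₀ one_pos
  set 𝒞 : Set (E3 → ℝ) := {g | ContDiffOn ℝ 1 g (shell 1 4) ∧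
    ∫⁻ y in Metric.ball x₀ 1, ‖g y‖ₑ ^ 2 ≤ C₀ * ∫⁻ y in Metric.ball x₀ 1, ‖fderiv ℝ g y‖ₑ ^ 2} with h𝒞
  have hctrl : ∀ x ∈ closedShell 2 3, ControlledAt (shell 1 4) 𝒞
      (fun g => ∫⁻ y in shell 1 4, ‖fderiv ℝ g y‖ₑ ^ 2) x := by
    intro x hx
    refine ControlledAt.of_isPreconnected (isOpen_shell 1 4) (isPreconnected_shell zero_le_one)
      (fun g hg => hg.1) (fun g _ => le_rfl) (hball (Metric.mem_ball_self one_pos))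
      ⟨1, one_pos, C₀, fun g hg => ?_⟩ (x := x) ⟨by linarith [hx.1], by linarith [hx.2]⟩
    refine (lintegral_mono_set inter_subset_right).trans (hg.2.trans ?_)
    exact mul_le_mul_right (lintegral_mono_set hball) _
  have hcomp : IsCompact (closedShell 2 3) :=
    (isCompact_closedBall (0 : E3) 3).of_isClosed_subset (isClosed_closedShell 2 3)
      fun y hy => by simpa using hy.2
  obtain ⟨C, hC⟩ := ControlledAt.of_isCompact hcomp hctrl
  refine ⟨C, fun f hf => ?_⟩
  obtain ⟨c, hc⟩ := hC₀ f (hf.mono hball)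
  refine ⟨c, ?_⟩
  have hder : ∀ y, fderiv ℝ (fun y => f y - c) y = fderiv ℝ f y := fun y => fderiv_sub_const c
  have h := hC (fun y => f y - c) ⟨hf.sub contDiffOn_const, by simpa only [hder] using hc⟩
  simp only [hder] at h
  refine le_of_eq_of_le ?_ h
  congr 2
  refine (inter_eq_self_of_subset_right fun y hy => ?_).symm
  exact ⟨by linarith [hy.1], by linarith [hy.2]⟩

/-- The rescaled Poincaré inequality: the factor `R⁻¹ ^ 2` is the one that the square of the gradient
of a cutoff function at scale `R` produces. -/
theorem exists_lintegral_shell_scaled_le :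
    ∃ C : ℝ≥0, ∀ R : ℝ, 0 < R → ∀ f : E3 → ℝ, ContDiffOn ℝ 1 f (shell R (4 * R)) → ∃ c : ℝ,
      ENNReal.ofReal R⁻¹ ^ 2 * ∫⁻ y in closedShell (2 * R) (3 * R), ‖f y - c‖ₑ ^ 2
        ≤ C * ∫⁻ y in shell R (4 * R), ‖fderiv ℝ f y‖ₑ ^ 2 := by
  obtain ⟨C, hC⟩ := exists_lintegral_shell_sub_const_sq_le
  refine ⟨C, fun R hR f hf => ?_⟩
  have hn : ∀ y : E3, ‖R • y‖ = R * ‖y‖ := fun y => by rw [norm_smul, Real.norm_of_nonneg hR.le]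
  have hm1 : ∀ y, R • y ∈ shell R (4 * R) ↔ y ∈ shell 1 4 := fun y => by
    simp only [shell, mem_ofPred_eq, hn, lt_mul_iff_one_lt_right hR]
    rw [mul_comm 4 R, mul_lt_mul_iff_right₀ hR]
  have hm2 : ∀ y, R • y ∈ closedShell (2 * R) (3 * R) ↔ y ∈ closedShell 2 3 := fun y => by
    simp only [closedShell, mem_ofPred_eq, hn]
    rw [mul_comm 2 R, mul_comm 3 R, mul_le_mul_iff_right₀ hR, mul_le_mul_iff_right₀ hR]
  obtain ⟨c, hc⟩ := hC (fun y => f (R • y)) (hf.comp (by fun_prop) fun y hy => (hm1 y).2 hy)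
  refine ⟨c, ?_⟩
  set a := ENNReal.ofReal ((R ^ 3)⁻¹) with ha
  have ha0 : a ≠ 0 := by
    rw [ha, Ne, ENNReal.ofReal_eq_zero, not_le]
    positivity
  have hat : a ≠ ⊤ := ENNReal.ofReal_ne_top
  have hm1s : MeasurableSet (shell 1 4) := (isOpen_shell _ _).measurableSet
  have hm1s' : MeasurableSet (shell R (4 * R)) := (isOpen_shell _ _).measurableSet
  have hm2s : MeasurableSet (closedShell 2 3) := (isClosed_closedShell _ _).measurableSet
  have hm2s' : MeasurableSet (closedShell (2 * R) (3 * R)) := (isClosed_closedShell _ _).measurableSet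
  have e1 : ∫⁻ y in closedShell 2 3, ‖f (R • y) - c‖ₑ ^ 2
      = a * ∫⁻ y in closedShell (2 * R) (3 * R), ‖f y - c‖ₑ ^ 2 := by
    rw [← lintegral_indicator hm2s', ← lintegral_comp_smul_pos hR, ← lintegral_indicator hm2s]
    refine lintegral_congr fun y => ?_
    by_cases hy : y ∈ closedShell 2 3
    · rw [indicator_of_mem hy, indicator_of_mem ((hm2 y).2 hy)]
    · rw [indicator_of_notMem hy, indicator_of_notMem (mt (hm2 y).1 hy)]
  have e2 : ∫⁻ y in shell 1 4, ‖fderiv ℝ (fun y => f (R • y)) y‖ₑ ^ 2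
      = a * (ENNReal.ofReal R ^ 2 * ∫⁻ y in shell R (4 * R), ‖fderiv ℝ f y‖ₑ ^ 2) := by
    rw [← lintegral_const_mul' _ _ (ENNReal.pow_ne_top ENNReal.ofReal_ne_top),
      ← lintegral_indicator hm1s', ← lintegral_comp_smul_pos hR, ← lintegral_indicator hm1s]
    refine lintegral_congr fun y => ?_
    by_cases hy : y ∈ shell 1 4
    · rw [indicator_of_mem hy, indicator_of_mem ((hm1 y).2 hy), fderiv_comp_smul, enorm_smul, mul_pow,
        Real.enorm_eq_ofReal hR.le]
    · rw [indicator_of_notMem hy, indicator_of_notMem (mt (hm1 y).1 hy)]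
  rw [e1, e2, mul_left_comm, ENNReal.mul_le_mul_iff_right ha0 hat] at hc
  calc _ ≤ ENNReal.ofReal R⁻¹ ^ 2 *
        (C * (ENNReal.ofReal R ^ 2 * ∫⁻ y in shell R (4 * R), ‖fderiv ℝ f y‖ₑ ^ 2)) := by gcongr
    _ = (ENNReal.ofReal R⁻¹ * ENNReal.ofReal R) ^ 2 *
        (C * ∫⁻ y in shell R (4 * R), ‖fderiv ℝ f y‖ₑ ^ 2) := by ring
    _ = _ := by
      rw [← ENNReal.ofReal_mul (by positivity), inv_mul_cancel₀ hR.ne', ENNReal.ofReal_one, one_pow, one_mul]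

section Exterior
variable {N : ℕ} {Ω : Fin N → Set E3}

/-- A function with square-integrable gradient in an exterior domain is square-integrable on bounded
subsets, up to the boundary. -/
theorem lintegral_sq_lt_top_of_gradient (hΩ : ∀ i, IsSmoothBoundedDomain (Ω i))
    (hdisj : ∀ i j, i ≠ j → Disjoint (closure (Ω i)) (closure (Ω j)))
    (hconn : IsConnected (exterior Ω)) {q : E3 → ℝ} (hq : ContDiffOn ℝ 1 q (exterior Ω))
    (hg : ∫⁻ y in exterior Ω, ‖fderiv ℝ q y‖ₑ ^ 2 < ⊤) (R : ℝ) :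
    ∫⁻ y in exterior Ω ∩ Metric.closedBall 0 R, ‖q y‖ₑ ^ 2 < ⊤ := by
  set S := ∫⁻ y in exterior Ω, ‖fderiv ℝ q y‖ₑ ^ 2 with hS
  obtain ⟨x₀, hx₀⟩ := hconn.nonempty
  obtain ⟨r, hr, hrU⟩ := Metric.nhds_basis_closedBall.mem_iff.1 ((isOpen_exterior Ω).mem_nhds hx₀)
  obtain ⟨B, hB⟩ := (isCompact_closedBall x₀ r).exists_bound_of_continuousOn (hq.continuousOn.mono hrU)
  have hfin : ∫⁻ y in exterior Ω ∩ Metric.ball x₀ r, ‖q y‖ₑ ^ 2 < ⊤ := by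
    calc _ ≤ ∫⁻ y in Metric.ball x₀ r, ‖q y‖ₑ ^ 2 := lintegral_mono_set inter_subset_right
      _ ≤ ∫⁻ _ in Metric.ball x₀ r, ENNReal.ofReal B ^ 2 := by
        refine setLIntegral_mono' measurableSet_ball fun y hy => ?_
        rw [← ofReal_norm]
        gcongr
        exact hB y (Metric.ball_subset_closedBall hy)
      _ < ⊤ := by
        rw [setLIntegral_const]
        exact ENNReal.mul_lt_top (ENNReal.pow_lt_top ENNReal.ofReal_lt_top) measure_ball_lt_top
  -- for a single function, control at `x₀` is just finiteness; `+ 1` covers the case `S = 0`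
  have hc : ControlledAt (exterior Ω) {q} (fun _ => S + 1) x₀ := by
    refine ⟨r, hr, (∫⁻ y in exterior Ω ∩ Metric.ball x₀ r, ‖q y‖ₑ ^ 2).toNNReal, ?_⟩
    rintro _ rfl
    rw [ENNReal.coe_toNNReal hfin.ne]
    exact le_mul_of_one_le_right zero_le le_add_self
  obtain ⟨C, hC⟩ := ControlledAt.of_isCompact (isCompact_closedBall (0 : E3) R) fun x _ =>
    controlledAt_exterior hΩ hdisj hconn (by rintro _ rfl; exact hq)
      (by rintro _ rfl; exact le_self_add) hx₀ hc x
  exact (hC q rfl).trans_lt (ENNReal.mul_lt_top ENNReal.coe_lt_top (ENNReal.add_lt_top.2 ⟨hg, ENNReal.one_lt_top⟩))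

end Exterior

theorem memLp_two_of_lintegral_lt_top {F : Type*} [NormedAddCommGroup F] {μ : Measure E3} {f : E3 → F}
    (hf : AEStronglyMeasurable f μ) (h : ∫⁻ y, ‖f y‖ₑ ^ 2 ∂μ < ⊤) : MemLp f 2 μ := by
  refine ⟨hf, ?_⟩
  have := eLpNorm_nnreal_pow_eq_lintegral (f := f) (μ := μ) (p := 2) (by norm_num)
  have h2 : eLpNorm f 2 μ ^ 2 = ∫⁻ y, ‖f y‖ₑ ^ 2 ∂μ := by simpa using this
  rw [← h2] at h
  exact (ENNReal.pow_lt_top_iff.1 h).resolve_right (by norm_num)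

theorem continuousOn_gradient {U : Set E3} (hU : IsOpen U) {f : E3 → ℝ} (hf : ContDiffOn ℝ 1 f U) :
    ContinuousOn (∇ f) U :=
  (InnerProductSpace.toDual ℝ E3).symm.continuous.comp_continuousOn
    (hf.continuousOn_fderiv_of_isOpen hU (by simp))

theorem tendsto_lintegral_tail {μ : Measure E3} {F : E3 → ℝ≥0∞} (hF : Measurable F)
    (h : ∫⁻ y, F y ∂μ < ⊤) :
    Tendsto (fun n : ℕ => ∫⁻ y, {y : E3 | (n : ℝ) < ‖y‖}.indicator F y ∂μ) atTop (𝓝 0) := by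
  have key := tendsto_lintegral_of_dominated_convergence (μ := μ) F (f := fun _ => 0)
    (F := fun (n : ℕ) => {y : E3 | (n : ℝ) < ‖y‖}.indicator F)
    (fun n => hF.indicator (measurableSet_lt measurable_const measurable_norm))
    (fun n => Eventually.of_forall fun y => indicator_le_self _ _ _) h.ne
    (Eventually.of_forall fun y => by
      obtain ⟨n₀, hn₀⟩ := exists_nat_ge ‖y‖
      refine tendsto_const_nhds.congr' ?_
      filter_upwards [eventually_ge_atTop n₀] with n hn
      have : ‖y‖ ≤ n := hn₀.trans (by exact_mod_cast hn)
      rw [indicator_of_notMem]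
      simpa using this)
  simpa using key

/-- A square-integrable gradient is a limit of gradients of test functions. The function is cut off at
infinity after subtraction of a constant; by Poincaré's inequality on the shell, the
error is controlled by the gradient near infinity. -/
theorem mem_closure_of_gradient {U : Set E3} (hU : IsOpen U) (hI : HasInwardTranslations U) {R₀ : ℝ}
    (hR₀ : 0 < R₀) (hR₀U : ∀ x : E3, R₀ ≤ ‖x‖ → x ∈ U) {q : E3 → ℝ} (hq : ContDiffOn ℝ 1 q U)
    {w : VecL2 U} (hw : w =ᵐ[volume.restrict U] ∇ q)
    (hloc : ∀ R, ∫⁻ y in U ∩ Metric.closedBall 0 R, ‖q y‖ₑ ^ 2 < ⊤) :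
    w ∈ (LinearMap.range (gradTest U)).topologicalClosure := by
  have hg2 : MemLp (∇ q) 2 (volume.restrict U) := (memLp_congr_ae hw).1 (Lp.memLp w)
  have hwq : ‖w‖ₑ ^ 2 = ∫⁻ y in U, ‖fderiv ℝ q y‖ₑ ^ 2 := by
    rw [enorm_sq_vecL2]
    refine lintegral_congr_ae ?_
    filter_upwards [hw] with y hy
    rw [hy, enorm_gradient]
  have hfin : ∫⁻ y in U, ‖fderiv ℝ q y‖ₑ ^ 2 < ⊤ := by
    rw [← hwq]
    exact ENNReal.pow_lt_top enorm_lt_top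
  obtain ⟨C, hC⟩ := exists_lintegral_shell_scaled_le
  set χ : ContDiffBump (0 : E3) := ⟨2, 3, two_pos, by norm_num⟩ with hχ
  have hχ1 : ContDiff ℝ 1 (χ : E3 → ℝ) := χ.contDiff
  obtain ⟨B, hB⟩ := (continuous_gradient hχ1).bounded_above_of_compact_support
    χ.hasCompactSupport.gradient
  set D : ℝ≥0∞ := 2 + 2 * (ENNReal.ofReal B ^ 2 * C) with hD
  have hDt : D ≠ ⊤ := by
    rw [hD]
    exact ENNReal.add_ne_top.2 ⟨by norm_num, ENNReal.mul_ne_top (by norm_num)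
      (ENNReal.mul_ne_top (ENNReal.pow_ne_top ENNReal.ofReal_ne_top) ENNReal.coe_ne_top)⟩
  set tail : ℝ → ℝ≥0∞ := fun R => ∫⁻ y in U, {y : E3 | R < ‖y‖}.indicator
    (fun y => ‖fderiv ℝ q y‖ₑ ^ 2) y with htail
  have hex : ∀ R, R₀ ≤ R → ∃ u ∈ (LinearMap.range (gradTest U)).topologicalClosure,
      ‖u - w‖ₑ ^ 2 ≤ D * tail R := by
    intro R hR
    have hR0 : 0 < R := hR₀.trans_le hR
    have hsU : shell R (4 * R) ⊆ U := fun y hy => hR₀U y (hR.trans hy.1.le)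
    obtain ⟨c, hc⟩ := hC R hR0 q (hq.mono hsU)
    set ψ : E3 → ℝ := fun y => χ (R⁻¹ • y) with hψ
    have hψ1 : ContDiff ℝ 1 ψ := hχ1.comp (by fun_prop)
    have hn : ∀ y : E3, ‖R⁻¹ • y‖ = ‖y‖ / R := fun y => by
      rw [norm_smul, norm_inv, Real.norm_of_nonneg hR0.le, inv_mul_eq_div]
    have hψ0 : ∀ y, 3 * R < ‖y‖ → ψ y = 0 := fun y hy => χ.zero_of_le_dist (by
      rw [dist_zero_right, hn]
      exact ((lt_div_iff₀ hR0).2 hy).le)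
    have hψone : ∀ y, ‖y‖ < 2 * R → ψ =ᶠ[𝓝 y] fun _ => 1 := fun y hy => by
      filter_upwards [(isOpen_lt continuous_norm continuous_const).mem_nhds hy] with z hz
      refine χ.one_of_mem_closedBall ?_
      rw [mem_closedBall_zero_iff, hn]
      exact (div_le_iff₀ hR0).2 (le_of_lt hz)
    have hψz : ∀ y, 3 * R < ‖y‖ → ψ =ᶠ[𝓝 y] fun _ => 0 := fun y hy => by
      filter_upwards [(isOpen_lt continuous_const continuous_norm).mem_nhds hy] with z hz
      exact hψ0 z hz
    have hψg : ∀ y, ∇ ψ y = R⁻¹ • ∇ (χ : E3 → ℝ) (R⁻¹ • y) := fun y => by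
      refine ext_inner_right ℝ fun v => ?_
      rw [inner_gradient_left, real_inner_smul_left, inner_gradient_left, hψ, fderiv_comp_smul]
      rfl
    have hψg0 : ∀ y ∉ closedShell (2 * R) (3 * R), ∇ ψ y = 0 := fun y hy => by
      rw [gradient]
      rcases lt_or_ge ‖y‖ (2 * R) with h | h
      · rw [(hψone y h).fderiv_eq]; simp
      · rw [(hψz y (not_le.1 fun h2 => hy ⟨h, h2⟩)).fderiv_eq]; simp
    set f : E3 → ℝ := fun y => ψ y * (q y - c) with hf
    have hqc : ContDiffOn ℝ 1 (fun y => q y - c) U := hq.sub contDiffOn_const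
    have hf1 : ContDiffOn ℝ 1 f U := hψ1.contDiffOn.mul hqc
    have hf0 : ∀ y, 3 * R < ‖y‖ → f y = 0 := fun y hy => by simp [hf, hψ0 y hy]
    have hf2 : MemLp f 2 (volume.restrict U) := by
      refine memLp_two_of_lintegral_lt_top (hf1.continuousOn.aestronglyMeasurable hU.measurableSet) ?_
      have hq2 := hloc (3 * R)
      calc ∫⁻ y in U, ‖f y‖ₑ ^ 2
          ≤ ∫⁻ y in U, (Metric.closedBall 0 (3 * R)).indicator
              (fun y => 2 * ‖q y‖ₑ ^ 2 + 2 * ‖c‖ₑ ^ 2) y := by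
            refine lintegral_mono fun y => ?_
            by_cases hy : y ∈ Metric.closedBall (0 : E3) (3 * R)
            · rw [indicator_of_mem hy]
              refine le_trans ?_ (ennreal_add_sq_le _ _)
              gcongr
              rw [hf, enorm_mul]
              refine (mul_le_of_le_one_left zero_le ?_).trans (enorm_sub_le)
              rw [Real.enorm_of_nonneg χ.nonneg]
              exact ENNReal.ofReal_le_one.2 χ.le_one
            · rw [mem_closedBall_zero_iff, not_le] at hy
              simp [hf0 y hy]
        _ = ∫⁻ y in U ∩ Metric.closedBall 0 (3 * R), (2 * ‖q y‖ₑ ^ 2 + 2 * ‖c‖ₑ ^ 2) := by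
            rw [lintegral_indicator Metric.isClosed_closedBall.measurableSet,
              Measure.restrict_restrict Metric.isClosed_closedBall.measurableSet, inter_comm]
        _ < ⊤ := by
            rw [lintegral_add_right _ measurable_const, lintegral_const_mul' _ _ (by norm_num),
              setLIntegral_const]
            refine ENNReal.add_lt_top.2 ⟨ENNReal.mul_lt_top (by norm_num) hq2, ENNReal.mul_lt_top
              (ENNReal.mul_lt_top (by norm_num) (ENNReal.pow_lt_top enorm_lt_top)) ?_⟩
            exact (measure_mono inter_subset_right).trans_lt measure_closedBall_lt_top
    -- `∇f - ∇q = (ψ - 1) ∇q + (q - c) ∇ψ`, where `∇ψ` lives on the closed shell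
    have hpt : ∀ y ∈ U, ‖∇ f y - ∇ q y‖ₑ ^ 2
        ≤ 2 * {y : E3 | R < ‖y‖}.indicator (fun y => ‖fderiv ℝ q y‖ₑ ^ 2) y
          + 2 * (ENNReal.ofReal B ^ 2 * (ENNReal.ofReal R⁻¹ ^ 2 *
            (closedShell (2 * R) (3 * R)).indicator (fun y => ‖q y - c‖ₑ ^ 2) y)) := by
      intro y hy
      have hqd : DifferentiableAt ℝ (fun y => q y - c) y :=
        (hqc.contDiffAt (hU.mem_nhds hy)).differentiableAt (by simp)
      have hqg : ∇ (fun y => q y - c) y = ∇ q y := by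
        rw [gradient, gradient, fderiv_sub_const]
      have e : ∇ f y - ∇ q y = (ψ y - 1) • ∇ q y + (q y - c) • ∇ ψ y := by
        rw [hf, gradient_mul (hψ1.differentiable (by simp) y) hqd, hqg, sub_smul (ψ y) 1, one_smul]
        abel
      rw [e]
      refine (pow_le_pow_left' (enorm_add_le _ _) 2).trans ((ennreal_add_sq_le _ _).trans ?_)
      gcongr
      · rcases lt_or_ge ‖y‖ (2 * R) with h | h
        · have : ψ y = 1 := (hψone y h).self_of_nhds
          simp [this]
        · have hyR : y ∈ {y : E3 | R < ‖y‖} := by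
            simp only [mem_ofPred_eq]
            linarith
          rw [indicator_of_mem hyR, enorm_smul, enorm_gradient]
          gcongr
          refine mul_le_of_le_one_left zero_le ?_
          rw [← ofReal_norm, Real.norm_eq_abs, abs_sub_comm]
          refine ENNReal.ofReal_le_one.2 ?_
          have h0 : 0 ≤ ψ y := χ.nonneg
          have h1 : ψ y ≤ 1 := χ.le_one
          rw [abs_of_nonneg (by linarith)]
          linarith
      · by_cases hyS : y ∈ closedShell (2 * R) (3 * R)
        · rw [indicator_of_mem hyS, enorm_smul, mul_pow, hψg, enorm_smul, mul_pow,
            Real.enorm_eq_ofReal (inv_nonneg.2 hR0.le)]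
          calc _ ≤ ‖q y - c‖ₑ ^ 2 * (ENNReal.ofReal R⁻¹ ^ 2 * ENNReal.ofReal B ^ 2) := by
                gcongr
                rw [← ofReal_norm]
                exact ENNReal.ofReal_le_ofReal (hB _)
            _ = _ := by ring
        · rw [hψg0 y hyS]
          simp
    have hDle : ∫⁻ y in U, ‖∇ f y - ∇ q y‖ₑ ^ 2 ≤ D * tail R := by
      refine (setLIntegral_mono' hU.measurableSet hpt).trans ?_
      have hD2 : D * tail R = 2 * tail R + 2 * (ENNReal.ofReal B ^ 2 * (C * tail R)) := by
        rw [hD]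
        ring
      have hm1 : Measurable fun y : E3 => 2 * {y : E3 | R < ‖y‖}.indicator (fun y => ‖fderiv ℝ q y‖ₑ ^ 2) y :=
        (((measurable_fderiv ℝ q).enorm.pow_const 2).indicator
          (measurableSet_lt measurable_const measurable_norm)).const_mul 2
      rw [lintegral_add_left hm1, lintegral_const_mul' _ _ (by norm_num),
        lintegral_const_mul' _ _ (by norm_num),
        lintegral_const_mul' _ _ (ENNReal.pow_ne_top ENNReal.ofReal_ne_top),
        lintegral_const_mul' _ _ (ENNReal.pow_ne_top ENNReal.ofReal_ne_top), hD2]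
      refine add_le_add le_rfl (mul_le_mul_right (mul_le_mul_right ?_ _) _)
      calc _ ≤ ENNReal.ofReal R⁻¹ ^ 2 * ∫⁻ y in closedShell (2 * R) (3 * R), ‖q y - c‖ₑ ^ 2 := by
            rw [lintegral_indicator (isClosed_closedShell _ _).measurableSet,
              Measure.restrict_restrict (isClosed_closedShell _ _).measurableSet]
            gcongr
            exact inter_subset_left
        _ ≤ _ := hc
        _ ≤ C * tail R := by
            gcongr
            rw [htail]
            simp only
            rw [lintegral_indicator (measurableSet_lt measurable_const measurable_norm),
              Measure.restrict_restrict (measurableSet_lt measurable_const measurable_norm)]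
            exact lintegral_mono_set fun y hy => ⟨hy.1, hsU hy⟩
    have htl : tail R ≤ ∫⁻ y in U, ‖fderiv ℝ q y‖ₑ ^ 2 :=
      lintegral_mono fun y => indicator_le_self _ _ _
    have hdm : MemLp (fun y => ∇ f y - ∇ q y) 2 (volume.restrict U) :=
      memLp_two_of_lintegral_lt_top (((continuousOn_gradient hU hf1).sub
        (continuousOn_gradient hU hq)).aestronglyMeasurable hU.measurableSet)
        (hDle.trans_lt (ENNReal.mul_lt_top hDt.lt_top (htl.trans_lt hfin)))
    have hfm : MemLp (∇ f) 2 (volume.restrict U) := by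
      refine (memLp_congr_ae (Eventually.of_forall fun y => ?_)).1 (hdm.add hg2)
      simp
    refine ⟨hfm.toLp _, mem_closure_of_bounded_support hU hI
      hf1 hf0 hf2 hfm.coeFn_toLp, ?_⟩
    rw [enorm_sq_vecL2]
    refine le_of_eq_of_le (lintegral_congr_ae ?_) hDle
    filter_upwards [Lp.coeFn_sub (hfm.toLp _) w, hfm.coeFn_toLp, hw] with y h1 h2 h3
    rw [h1, Pi.sub_apply, h2, h3]
  have hcl : IsClosed ((LinearMap.range (gradTest U)).topologicalClosure : Set (VecL2 U)) :=
    Submodule.isClosed_topologicalClosure _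
  rw [← SetLike.mem_coe, ← hcl.closure_eq, EMetric.mem_closure_iff]
  intro ε hε
  have ht : Tendsto (fun n : ℕ => D * tail n) atTop (𝓝 0) := by
    have h1 := tendsto_lintegral_tail (μ := volume.restrict U)
      ((measurable_fderiv ℝ q).enorm.pow_const 2) hfin
    have h2 := ENNReal.Tendsto.const_mul (a := D) h1 (Or.inr hDt)
    rwa [mul_zero] at h2
  obtain ⟨n, hn1, hn2⟩ := ((ht.eventually (gt_mem_nhds (ENNReal.pow_pos hε 2))).and
    (tendsto_natCast_atTop_atTop.eventually_ge_atTop R₀)).exists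
  obtain ⟨u, hu, huw⟩ := hex n hn2
  refine ⟨u, hu, ?_⟩
  rw [edist_comm, edist_eq_enorm_sub]
  exact lt_of_pow_lt_pow_left' 2 (huw.trans_lt hn1)

/-! ### The space of gradients with rigid and dilating boundary data -/

section Exterior
variable {N : ℕ} {Ω : Fin N → Set E3}

/-- The divergence-free fields orthogonal to `L²_σ(U)` are the square-integrable gradients of harmonic
functions. -/
theorem mem_orthogonal_L2sigma_iff (hΩ : ∀ i, IsSmoothBoundedDomain (Ω i))
    (hdisj : ∀ i j, i ≠ j → Disjoint (closure (Ω i)) (closure (Ω j)))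
    (hconn : IsConnected (exterior Ω)) {w : VecL2 (exterior Ω)} (hd : IsDivFree w) :
    w ∈ (L2sigma Ω)ᗮ ↔ ∃ q : E3 → ℝ, InnerProductSpace.HarmonicOnNhd q (exterior Ω) ∧
      w =ᵐ[volume.restrict (exterior Ω)] ∇ q := by
  have hU := isOpen_exterior Ω
  rw [L2sigma_orthogonal]
  constructor
  · exact fun hw => exists_harmonicOnNhd_of_mem_closure hU
      (fun K hK => exists_lintegral_sq_le hΩ hdisj hconn hK) hw hd
  · rintro ⟨q, hq, hwq⟩
    have hq1 : ContDiffOn ℝ 1 q (exterior Ω) := fun x hx =>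
      ((hq x hx).1.of_le (by norm_num)).contDiffWithinAt
    have hfin : ∫⁻ y in exterior Ω, ‖fderiv ℝ q y‖ₑ ^ 2 < ⊤ := by
      have h : ‖w‖ₑ ^ 2 = ∫⁻ y in exterior Ω, ‖fderiv ℝ q y‖ₑ ^ 2 := by
        rw [enorm_sq_vecL2]
        refine lintegral_congr_ae ?_
        filter_upwards [hwq] with y hy
        rw [hy, enorm_gradient]
      rw [← h]
      exact ENNReal.pow_lt_top enorm_lt_top
    obtain ⟨R₀, hR₀, hR₀U⟩ := exists_norm_ge_mem_exterior hΩ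
    exact mem_closure_of_gradient hU (hasInwardTranslations_exterior hΩ hdisj) hR₀ hR₀U hq1 hwq
      (lintegral_sq_lt_top_of_gradient hΩ hdisj hconn hq1 hfin)

theorem isNeumannGradient_iff (hΩ : ∀ i, IsSmoothBoundedDomain (Ω i))
    (hdisj : ∀ i j, i ≠ j → Disjoint (closure (Ω i)) (closure (Ω j)))
    (hconn : IsConnected (exterior Ω)) {w : VecL2 (exterior Ω)} {g : Fin N → E3 → ℝ} :
    IsNeumannGradient Ω w g ↔ w ∈ (L2sigma Ω)ᗮ ∧ HasNormalTrace Ω w g := by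
  constructor
  · rintro ⟨q, hq, hwq, ht⟩
    exact ⟨(mem_orthogonal_L2sigma_iff hΩ hdisj hconn ht.isDivFree).2 ⟨q, hq, hwq⟩, ht⟩
  · rintro ⟨hw, ht⟩
    obtain ⟨q, hq, hwq⟩ := (mem_orthogonal_L2sigma_iff hΩ hdisj hconn ht.isDivFree).1 hw
    exact ⟨q, hq, hwq, ht⟩

theorem mem_Gspace_iff {w : VecL2 (exterior Ω)} :
    w ∈ Gspace Ω ↔ w ∈ (L2sigma Ω)ᗮ ∧ ∃ (s : Fin N → ℝ) (v : Fin N → E3),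
      HasNormalTrace Ω w (dilData Ω s v) := by
  refine ⟨fun h => ⟨h.2, h.1.2⟩, ?_⟩
  rintro ⟨h1, s, v, ht⟩
  exact ⟨⟨ht.isDivFree, s, v, ht⟩, h1⟩

/-- A field orthogonal to `L²_σ(U)` is determined by its normal trace. -/
theorem eq_of_hasNormalTrace {w₁ w₂ : VecL2 (exterior Ω)} (h₁ : w₁ ∈ (L2sigma Ω)ᗮ)
    (h₂ : w₂ ∈ (L2sigma Ω)ᗮ) {g : Fin N → E3 → ℝ} (ht₁ : HasNormalTrace Ω w₁ g)
    (ht₂ : HasNormalTrace Ω w₂ g) : w₁ = w₂ := by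
  have ht : HasNormalTrace Ω (w₁ + (-1 : ℝ) • w₂) (fun _ _ => 0) := by
    simpa using ht₁.add (ht₂.smul (-1))
  have hmem : w₁ + (-1 : ℝ) • w₂ ∈ L2sigma Ω := ⟨ht.isDivFree, ht⟩
  have hmem' : w₁ + (-1 : ℝ) • w₂ ∈ (L2sigma Ω)ᗮ :=
    Submodule.add_mem _ h₁ (Submodule.smul_mem _ _ h₂)
  have h0 : w₁ + (-1 : ℝ) • w₂ = 0 := by
    have := Submodule.mem_inf.2 ⟨hmem, hmem'⟩
    rwa [Submodule.inf_orthogonal_eq_bot, Submodule.mem_bot] at this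
  rwa [neg_one_smul, ← sub_eq_add_neg, sub_eq_zero] at h0

theorem L2sigma_le_L2dil (Ω : Fin N → Set E3) : L2sigma Ω ≤ L2dil Ω := by
  rintro w ⟨h1, h2⟩
  refine ⟨h1, 0, 0, ?_⟩
  convert h2 using 3
  simp [dilData]

/-- The normal velocities `s i + v i · n`, in terms of the coordinates of all the `s i` and `v i`. -/
noncomputable def dilDataOfCoord (Ω : Fin N → Set E3) (a : Fin N ⊕ Fin N × Fin 3 → ℝ) :
    Fin N → E3 → ℝ :=
  dilData Ω (fun i => a (Sum.inl i)) (fun i => WithLp.toLp 2 fun k => a (Sum.inr (i, k)))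

theorem dilDataOfCoord_apply (a : Fin N ⊕ Fin N × Fin 3 → ℝ) (i : Fin N) (x : E3) :
    dilDataOfCoord Ω a i x
      = a (Sum.inl i) + ∑ k, outwardNormal (Ω i) x k * a (Sum.inr (i, k)) := by
  simp [dilDataOfCoord, dilData, PiLp.inner_apply]

theorem exists_coord (s : Fin N → ℝ) (v : Fin N → E3) :
    ∃ a : Fin N ⊕ Fin N × Fin 3 → ℝ, dilDataOfCoord Ω a = dilData Ω s v :=
  ⟨Sum.elim s fun p => v p.1 p.2, rfl⟩

/-- The space `𝔾(U)` is parametrized linearly by the coordinates of the `s i` and `v i`. -/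
theorem exists_linearEquiv_Gspace (hΩ : ∀ i, IsSmoothBoundedDomain (Ω i))
    (hdisj : ∀ i j, i ≠ j → Disjoint (closure (Ω i)) (closure (Ω j)))
    (hconn : IsConnected (exterior Ω)) :
    ∃ e : (Fin N ⊕ Fin N × Fin 3 → ℝ) ≃ₗ[ℝ] Gspace Ω, ∀ a,
      HasNormalTrace Ω (e a : VecL2 (exterior Ω)) (dilDataOfCoord Ω a) := by
  have hex : ∀ a : Fin N ⊕ Fin N × Fin 3 → ℝ, ∃ w : Gspace Ω,
      HasNormalTrace Ω (w : VecL2 (exterior Ω)) (dilDataOfCoord Ω a) := by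
    intro a
    obtain ⟨w, hw, ht⟩ := exists_hasNormalTrace_dilData hΩ hdisj hconn
      (fun i => a (Sum.inl i)) (fun i => WithLp.toLp 2 fun k => a (Sum.inr (i, k)))
    exact ⟨⟨w, mem_Gspace_iff.2 ⟨hw, _, _, ht⟩⟩, ht⟩
  choose F hF using hex
  have huniq : ∀ (w : Gspace Ω) (a : Fin N ⊕ Fin N × Fin 3 → ℝ),
      HasNormalTrace Ω (w : VecL2 (exterior Ω)) (dilDataOfCoord Ω a) → w = F a := fun w a h =>
    Subtype.ext (eq_of_hasNormalTrace w.2.2 (F a).2.2 h (hF a))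
  set L : (Fin N ⊕ Fin N × Fin 3 → ℝ) →ₗ[ℝ] Gspace Ω :=
    { toFun := F
      map_add' := fun a b => by
        refine (huniq _ _ ?_).symm
        have h : dilDataOfCoord Ω (a + b)
            = fun i x => dilDataOfCoord Ω a i x + dilDataOfCoord Ω b i x := by
          funext i x
          simp only [dilDataOfCoord_apply, Pi.add_apply, mul_add, Finset.sum_add_distrib]
          ring
        rw [h]
        exact (hF a).add (hF b)
      map_smul' := fun c a => by
        refine (huniq _ _ ?_).symm
        have h : dilDataOfCoord Ω (c • a) = fun i x => c * dilDataOfCoord Ω a i x := by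
          funext i x
          simp only [dilDataOfCoord_apply, Pi.smul_apply, smul_eq_mul, mul_add, Finset.mul_sum]
          congr 1
          exact Finset.sum_congr rfl fun k _ => by ring
        rw [RingHom.id_apply, h]
        exact (hF a).smul c } with hL
  refine ⟨LinearEquiv.ofBijective L ⟨?_, ?_⟩, hF⟩
  · rw [injective_iff_map_eq_zero]
    intro a ha
    have h := hF a
    rw [show F a = 0 from ha] at h
    obtain ⟨h1, h2⟩ := eq_zero_of_hasNormalTrace_zero hΩ hdisj h
    ext j
    rcases j with i | ⟨i, k⟩
    · exact congrFun h1 i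
    · have h3 := congrFun h2 i
      exact congrArg (fun u : E3 => u k) h3
  · intro w
    obtain ⟨-, s, v, ht⟩ := mem_Gspace_iff.1 w.2
    obtain ⟨a, ha⟩ := exists_coord (Ω := Ω) s v
    exact ⟨a, (huniq w a (ha ▸ ht)).symm⟩

end Exterior

end ExteriorFlow

open ExteriorFlow in
theorem mainTheorem5 (N : ℕ) (Ω : Fin N → Set E3)
    (hΩ : ∀ i, IsSmoothBoundedDomain (Ω i))
    (hdisj : ∀ i j, i ≠ j → Disjoint (closure (Ω i)) (closure (Ω j)))
    (hconn : IsConnected (exterior Ω)) :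
    (L2sigma Ω ⟂ Gspace Ω ∧ L2sigma Ω ⊔ Gspace Ω = L2dil Ω) ∧
    (∀ w : VecL2 (exterior Ω), w ∈ Gspace Ω ↔
      ∃ (s : Fin N → ℝ) (v : Fin N → E3), IsNeumannGradient Ω w (dilData Ω s v)) ∧
    (∃ b : Module.Basis (Fin N ⊕ Fin N × Fin 3) ℝ (Gspace Ω),
      (∀ i, IsNeumannGradient Ω (b (Sum.inl i)) (fun j _ => if j = i then 1 else 0)) ∧
      (∀ i k, IsNeumannGradient Ω (b (Sum.inr (i, k)))
        (fun j x => if j = i then outwardNormal (Ω j) x k else 0))) ∧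
    (FiniteDimensional ℝ (Gspace Ω) ∧ Module.finrank ℝ (Gspace Ω) = 4 * N) ∧
    IsClosed (L2dil Ω : Set (VecL2 (exterior Ω))) := by
  have hclosed := isClosed_L2sigma Ω
  have : CompleteSpace (L2sigma Ω) := hclosed.completeSpace_coe
  have hsup : L2sigma Ω ⊔ Gspace Ω = L2dil Ω := by
    rw [Gspace, inf_comm]
    exact Submodule.sup_orthogonal_inf_of_hasOrthogonalProjection (L2sigma_le_L2dil Ω)
  obtain ⟨e, he⟩ := exists_linearEquiv_Gspace hΩ hdisj hconn
  set b := (Pi.basisFun ℝ (Fin N ⊕ Fin N × Fin 3)).map e with hb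
  have hfin : FiniteDimensional ℝ (Gspace Ω) := b.finiteDimensional_of_finite
  have hb' : ∀ j, IsNeumannGradient Ω (b j : VecL2 (exterior Ω))
      (dilDataOfCoord Ω (Pi.single j 1)) := fun j =>
    (isNeumannGradient_iff hΩ hdisj hconn).2 ⟨(b j).2.2, by
      have hbj : b j = e (Pi.single j 1) := by rw [hb, Module.Basis.map_apply, Pi.basisFun_apply]
      rw [hbj]
      exact he _⟩
  refine ⟨⟨?_, hsup⟩, fun w => ?_, ⟨b, fun i => ?_, fun i k => ?_⟩, ⟨hfin, ?_⟩, ?_⟩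
  · exact Submodule.isOrtho_iff_le.2 ((Submodule.le_orthogonal_orthogonal _).trans
      (Submodule.orthogonal_le inf_le_right))
  · rw [mem_Gspace_iff]
    simp only [isNeumannGradient_iff hΩ hdisj hconn, exists_and_left]
  · convert hb' (Sum.inl i) using 3 with j x
    simp [dilDataOfCoord_apply, Pi.single_apply]
  · convert hb' (Sum.inr (i, k)) using 3 with j x
    by_cases hj : j = i <;> simp [dilDataOfCoord_apply, Pi.single_apply, hj]
  · rw [Module.finrank_eq_card_basis b]
    simp only [Fintype.card_sum, Fintype.card_prod, Fintype.card_fin]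
    ring
  · rw [← hsup]
    exact Submodule.isClosed_sup_finiteDimensional _ _ hclosed
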